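/- Let $\pi\colon E\to M$ be a smooth fibre bundle, where $\dim M=m>1$ and $\dim E=m+n$ (all manifolds are real, Hausdorff, second countable and of class $C^\infty$). Let $\mathcal M\pi=\Lambda_2^m\mathrm T^*E$ be the extended multimomentum bundle: the bundle over $E$ whose points are the pairs $(y,\zeta)$ with $y\in E$ and $\zeta$ an $m$-form on $\mathrm T_yE$ that vanishes whenever two of its arguments are $\pi$-vertical. Let $\widetilde\sigma\colon\mathcal M\pi\to E$ be its projection, let $\Theta$ be the tautological $m$-form, $\Theta_{(y,\zeta)}(X_0,\dots,X_{m-1})=\zeta(\mathrm T\widetilde\sigma X_0,\dots,\mathrm T\widetilde\sigma X_{m-1})$, and let $\Omega=-\mathrm d\Theta$. Let $\xi_E$ be a smooth vector field on $E$ that is $\pi$-projectable, i.e. $\mathrm T\pi\circ\xi_E=\xi_M\circ\pi$ for some smooth vector field $\xi_M$ on $M$. Let $\Gamma_\xi$ be the $(m-1)$-form on $\mathcal M\pi$ given by $(\Gamma_\xi)_{(y,\zeta)}=\zeta(\xi_E|_y)$, that is, $(\Gamma_\xi)_{(y,\zeta)}(X_1,\dots,X_{m-1})=\zeta(\xi_E|_y,\mathrm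 T\widetilde\sigma X_1,\dots,\mathrm T\widetilde\sigma X_{m-1})$. The canonical lift of $\xi_E$ to $\mathcal M\pi$ is the smooth vector field $Z_\xi$ whose local flows are $(y,\zeta)\mapsto(\varphi_t(y),(\varphi_t^{-1})^*\zeta)$, where $\varphi_t$ runs over the local flows of $\xi_E$. Then the canonical lift $Z_\xi$ exists and is unique, and it is the unique vector field on $\mathcal M\pi$ satisfying $$ i(Z_\xi)\Omega=\mathrm d\Gamma_\xi ; $$ that is, $Z_\xi$ is the (global) Hamiltonian vector field of $\Gamma_\xi$. Moreover, let $(x^\mu,y^A)$ be any local coordinates on $E$ adapted to $\pi$, and let $(x^\mu,y^A,p_A^\mu,p)$ be the induced coordinates on $\mathcal M\pi$, given by $\zeta=p_A^\mu\,\mathrm dy^A\wedge\mathrm d^{m-1}x_\mu+p\,\mathrm d^mx$ with $\mathrm d^mx=\mathrm dx^0\wedge\dots\wedge\mathrm dx^{m-1}$ and $\mathrm d^{m-1}x_\mu=i(\partial/\partial x^\mu)\mathrm d^mx$. If $\xi_E=-\xi^\mu\frac{\partial}{\partial x^\mu}-\xi^A\frac{\partial}{\partial y^A}$, then (repeated indices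 being summed) $$ Z_\xi=-\xi^\mu\frac{\partial}{\partial x^\mu}-\xi^A\frac{\partial}{\partial y^A}-\Big(\frac{\partial\xi^\mu}{\partial x^\nu}p_A^\nu-\frac{\partial\xi^\nu}{\partial x^\nu}p_A^\mu-\frac{\partial\xi^B}{\partial y^A}p_B^\mu\Big)\frac{\partial}{\partial p_A^\mu}+\Big(\frac{\partial\xi^A}{\partial x^\mu}p_A^\mu+\frac{\partial\xi^\mu}{\partial x^\mu}p\Big)\frac{\partial}{\partial p}. $$ -/

import Mathlib

open Set Bundle
open scoped Manifold ContDiff Topology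

noncomputable section

namespace Multimomentum

/-- Coordinate space `ℝ^m` of the base, with `m = d + 1`. -/
abbrev BaseCoord (d : ℕ) : Type := EuclideanSpace ℝ (Fin (d + 1))
/-- Coordinate space `ℝ^n` of the fibre. -/
abbrev FibCoord (n : ℕ) : Type := EuclideanSpace ℝ (Fin n)
/-- Coordinate space `ℝ^(m + n)` of the total space, with `m = d + 1`. -/
abbrev TotCoord (d n : ℕ) : Type := EuclideanSpace ℝ (Fin (d + 1 + n))

/-- A smooth fibre bundle `E → M` with typical fibre `F`, where `dim M = d + 1`, `dim F = n` and
`dim E = d + 1 + n`: a smooth projection with smooth local trivialisations. -/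
structure SmoothFiberBundle (d n : ℕ)
    (M : Type*) [TopologicalSpace M] [ChartedSpace (BaseCoord d) M]
    (E : Type*) [TopologicalSpace E] [ChartedSpace (TotCoord d n) E]
    (F : Type*) [TopologicalSpace F] [ChartedSpace (FibCoord n) F] where
  proj : E → M
  contMDiff_proj : ContMDiff (𝓡 (d + 1 + n)) (𝓡 (d + 1)) ∞ proj
  exists_trivialization : ∀ x : M, ∃ e : Trivialization F proj, x ∈ e.baseSet ∧
    ContMDiffOn (𝓡 (d + 1 + n)) ((𝓡 (d + 1)).prod (𝓡 n)) ∞ e e.source ∧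
    ContMDiffOn ((𝓡 (d + 1)).prod (𝓡 n)) (𝓡 (d + 1 + n)) ∞ e.toOpenPartialHomeomorph.symm e.target

section
variable {d n : ℕ}
  {M : Type*} [TopologicalSpace M] [ChartedSpace (BaseCoord d) M]
  {E : Type*} [TopologicalSpace E] [ChartedSpace (TotCoord d n) E]
  {F : Type*} [TopologicalSpace F] [ChartedSpace (FibCoord n) F]

/-- An adapted chart `(x^μ, y^A)` of `E`: a smooth chart with values in `ℝ^m × ℝ^n` whose first
component is a chart `(x^μ)` of `M` composed with the projection. -/
structure AdaptedChart (B : SmoothFiberBundle d n M E F) where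
  chart : OpenPartialHomeomorph E (BaseCoord d × FibCoord n)
  base : OpenPartialHomeomorph M (BaseCoord d)
  base_mem : base ∈ IsManifold.maximalAtlas (𝓡 (d + 1)) ∞ M
  contMDiffOn_chart : ContMDiffOn (𝓡 (d + 1 + n)) 𝓘(ℝ, BaseCoord d × FibCoord n) ∞
    chart chart.source
  contMDiffOn_symm : ContMDiffOn 𝓘(ℝ, BaseCoord d × FibCoord n) (𝓡 (d + 1 + n)) ∞
    chart.symm chart.target
  proj_mem : ∀ y ∈ chart.source, B.proj y ∈ base.source
  fst_chart : ∀ y ∈ chart.source, (chart y).1 = base (B.proj y)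

theorem exists_adaptedChart [IsManifold (𝓡 (d + 1)) ∞ M] [IsManifold (𝓡 n) ∞ F]
    (B : SmoothFiberBundle d n M E F) (y : E) :
    ∃ e : AdaptedChart B, y ∈ e.chart.source := by
  obtain ⟨t, hx, h1, h2⟩ := B.exists_trivialization (B.proj y)
  let c : OpenPartialHomeomorph (M × F) (BaseCoord d × FibCoord n) :=
    (chartAt (BaseCoord d) (B.proj y)).prod (chartAt (FibCoord n) (t y).2)
  have hc1 : ContMDiffOn ((𝓡 (d + 1)).prod (𝓡 n)) 𝓘(ℝ, BaseCoord d × FibCoord n) ∞ c c.source := by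
    rw [modelWithCornersSelf_prod, ← chartedSpaceSelf_prod]
    exact (contMDiffOn_chart (I := 𝓡 (d+1))).prodMap (contMDiffOn_chart (I := 𝓡 n))
  have hc2 : ContMDiffOn 𝓘(ℝ, BaseCoord d × FibCoord n) ((𝓡 (d + 1)).prod (𝓡 n)) ∞ c.symm c.target := by
    rw [modelWithCornersSelf_prod, ← chartedSpaceSelf_prod]
    exact (contMDiffOn_chart_symm (I := 𝓡 (d+1))).prodMap (contMDiffOn_chart_symm (I := 𝓡 n))
  have hty : y ∈ t.source := by rw [t.source_eq]; exact hx
  refine ⟨⟨t.toOpenPartialHomeomorph.trans c, chartAt _ (B.proj y),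
    IsManifold.chart_mem_maximalAtlas _, ?_, ?_, ?_, ?_⟩, ?_⟩
  · rw [OpenPartialHomeomorph.trans_source]
    exact hc1.comp (h1.mono inter_subset_left) (fun z hz => hz.2)
  · rw [OpenPartialHomeomorph.trans_target]
    exact h2.comp (hc2.mono inter_subset_left) (fun z hz => hz.2)
  · rintro z ⟨hz, hz'⟩
    have := hz'.1
    have h3 := t.proj_toFun z hz
    rw [← h3]; exact this
  · rintro z ⟨hz, hz'⟩
    have h3 := t.proj_toFun z hz
    rw [← h3]; rfl
  · refine ⟨hty, ?_, ?_⟩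
    · have h3 := t.proj_toFun y hty
      change (t y).1 ∈ _
      rw [show (t y).1 = B.proj y from h3]
      exact mem_chart_source _ _
    · exact mem_chart_source _ _


variable (d n) in
/-- The `(d + 1)`-forms on `ℝ^m × ℝ^n` that vanish when two of their arguments lie in `0 × ℝ^n`. -/
def Lambda2Model : Submodule ℝ ((BaseCoord d × FibCoord n) [⋀^Fin (d + 1)]→L[ℝ] ℝ) where
  carrier := {ζ | ∀ v : Fin (d + 1) → BaseCoord d × FibCoord n, ∀ i j, i ≠ j →
    (v i).1 = 0 → (v j).1 = 0 → ζ v = 0}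
  zero_mem' := fun _ _ _ _ _ _ => rfl
  add_mem' := fun {a b} ha hb v i j hij hi hj => by
    change a v + b v = 0
    rw [ha v i j hij hi hj, hb v i j hij hi hj, add_zero]
  smul_mem' := fun c a ha v i j hij hi hj => by
    change c • a v = 0
    rw [ha v i j hij hi hj, smul_zero]

/-- The fibre over `y` of `Λ₂^m T^*E`: the `m`-forms on `T_y E` (`m = d + 1`) that vanish when two
of their arguments are vertical for the projection. -/
def Lambda2 (B : SmoothFiberBundle d n M E F) (y : E) :
    Submodule ℝ (TangentSpace (𝓡 (d + 1 + n)) y [⋀^Fin (d + 1)]→L[ℝ] ℝ) where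
  carrier := {ζ | ∀ v : Fin (d + 1) → TangentSpace (𝓡 (d + 1 + n)) y, ∀ i j, i ≠ j →
    mfderiv (𝓡 (d + 1 + n)) (𝓡 (d + 1)) B.proj y (v i) = 0 →
    mfderiv (𝓡 (d + 1 + n)) (𝓡 (d + 1)) B.proj y (v j) = 0 → ζ v = 0}
  zero_mem' := fun _ _ _ _ _ _ => rfl
  add_mem' := fun {a b} ha hb v i j hij hi hj => by
    change a v + b v = 0
    rw [ha v i j hij hi hj, hb v i j hij hi hj, add_zero]
  smul_mem' := fun c a ha v i j hij hi hj => by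
    change c • a v = 0
    rw [ha v i j hij hi hj, smul_zero]

instance finite_alternating (V : Type*) [NormedAddCommGroup V] [NormedSpace ℝ V]
    [FiniteDimensional ℝ V] (k : ℕ) : FiniteDimensional ℝ (V [⋀^Fin k]→L[ℝ] ℝ) := by
  let f : (V [⋀^Fin k]→L[ℝ] ℝ) →ₗ[ℝ] MultilinearMap ℝ (fun _ : Fin k => V) ℝ :=
    { toFun := fun a => a.toContinuousMultilinearMap.toMultilinearMap
      map_add' := fun _ _ => rfl
      map_smul' := fun _ _ => rfl }
  refine FiniteDimensional.of_injective f fun a b h => ?_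
  ext v
  exact congrArg (fun g : MultilinearMap ℝ (fun _ : Fin k => V) ℝ => g v) h

instance finite_alternating_tangent (y : E) (k : ℕ) :
    FiniteDimensional ℝ (TangentSpace (𝓡 (d + 1 + n)) y [⋀^Fin k]→L[ℝ] ℝ) :=
  inferInstanceAs (FiniteDimensional ℝ (TotCoord d n [⋀^Fin k]→L[ℝ] ℝ))


variable (d n) in
/-- The model fibre of the bundle `Λ₂^m T^*E`, as a normed space. -/
def FormModel : Type := Lambda2Model d n

instance instNormedAddCommGroupFormModel : NormedAddCommGroup (FormModel d n) :=
  inferInstanceAs (NormedAddCommGroup (Lambda2Model d n))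
instance instNormedSpaceFormModel : NormedSpace ℝ (FormModel d n) := inferInstanceAs (NormedSpace ℝ (Lambda2Model d n))
instance instFiniteDimensionalFormModel : FiniteDimensional ℝ (FormModel d n) :=
  inferInstanceAs (FiniteDimensional ℝ (Lambda2Model d n))

/-- The fibre of the bundle `Λ₂^m T^*E` over `y`. -/
def FormFiber (B : SmoothFiberBundle d n M E F) (y : E) : Type := Lambda2 B y

section
variable (B : SmoothFiberBundle d n M E F) (y : E)
instance instAddCommGroupFormFiber : AddCommGroup (FormFiber B y) := inferInstanceAs (AddCommGroup (Lambda2 B y))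
instance instModuleFormFiber : Module ℝ (FormFiber B y) := inferInstanceAs (Module ℝ (Lambda2 B y))
instance instTopologicalSpaceFormFiber : TopologicalSpace (FormFiber B y) := inferInstanceAs (TopologicalSpace (Lambda2 B y))
instance instIsTopologicalAddGroupFormFiber : IsTopologicalAddGroup (FormFiber B y) :=
  inferInstanceAs (IsTopologicalAddGroup (Lambda2 B y))
instance instContinuousSMulFormFiber : ContinuousSMul ℝ (FormFiber B y) := inferInstanceAs (ContinuousSMul ℝ (Lambda2 B y))
instance instT2SpaceFormFiber : T2Space (FormFiber B y) := inferInstanceAs (T2Space (Lambda2 B y))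
instance instFiniteDimensionalFormFiber : FiniteDimensional ℝ (FormFiber B y) :=
  inferInstanceAs (FiniteDimensional ℝ (Lambda2 B y))
end

/-- A linear retraction onto a subspace (used only on elements of the subspace). -/
def retract {V : Type*} [AddCommGroup V] [Module ℝ V] (S : Submodule ℝ V) : V →ₗ[ℝ] S :=
  S.subtype.leftInverse

theorem retract_of_mem {V : Type*} [AddCommGroup V] [Module ℝ V] (S : Submodule ℝ V) {v : V}
    (hv : v ∈ S) : ((retract S v : S) : V) = v := by
  have := LinearMap.leftInverse_apply_of_inj (f := S.subtype) S.ker_subtype ⟨v, hv⟩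
  exact congrArg Subtype.val this

namespace AdaptedChart
variable {B : SmoothFiberBundle d n M E F} (e : AdaptedChart B)

/-- The derivative at `y` of an adapted chart. -/
def dchart (y : E) : TangentSpace (𝓡 (d + 1 + n)) y →L[ℝ] BaseCoord d × FibCoord n :=
  mfderiv (𝓡 (d + 1 + n)) 𝓘(ℝ, BaseCoord d × FibCoord n) e.chart y

/-- The inverse of the derivative at `y` of an adapted chart. -/
def dchartInv (y : E) : BaseCoord d × FibCoord n →L[ℝ] TangentSpace (𝓡 (d + 1 + n)) y :=
  (mfderiv (𝓡 (d + 1 + n)) 𝓘(ℝ, BaseCoord d × FibCoord n) e.chart y).inverse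


theorem mdifferentiableAt_chart {y : E} (hy : y ∈ e.chart.source) :
    MDifferentiableAt (𝓡 (d + 1 + n)) 𝓘(ℝ, BaseCoord d × FibCoord n) e.chart y :=
  ((e.contMDiffOn_chart y hy).contMDiffAt (e.chart.open_source.mem_nhds hy)).mdifferentiableAt
    (by simp)

theorem mdifferentiableAt_symm {z : BaseCoord d × FibCoord n} (hz : z ∈ e.chart.target) :
    MDifferentiableAt 𝓘(ℝ, BaseCoord d × FibCoord n) (𝓡 (d + 1 + n)) e.chart.symm z :=
  ((e.contMDiffOn_symm z hz).contMDiffAt (e.chart.open_target.mem_nhds hz)).mdifferentiableAt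
    (by simp)

theorem isInvertible_dchart {y : E} (hy : y ∈ e.chart.source) : (e.dchart y).IsInvertible := by
  have hz := e.chart.map_source hy
  have hs := e.mdifferentiableAt_symm hz
  have hc := e.mdifferentiableAt_chart hy
  have hc' : MDifferentiableAt (𝓡 (d + 1 + n)) 𝓘(ℝ, BaseCoord d × FibCoord n) e.chart
      (e.chart.symm (e.chart y)) := by rw [e.chart.left_inv hy]; exact hc
  have h1 := mfderiv_comp (I := 𝓡 (d + 1 + n)) y hs hc
  have h2 := mfderiv_comp (I := 𝓘(ℝ, BaseCoord d × FibCoord n)) (e.chart y) hc' hs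
  rw [e.chart.left_inv hy] at h2
  have e1 : (e.chart.symm ∘ e.chart) =ᶠ[𝓝 y] id := by
    filter_upwards [e.chart.open_source.mem_nhds hy] with w hw using e.chart.left_inv hw
  have e2 : (e.chart ∘ e.chart.symm) =ᶠ[𝓝 (e.chart y)] id := by
    filter_upwards [e.chart.open_target.mem_nhds hz] with w hw using e.chart.right_inv hw
  rw [e1.mfderiv_eq, mfderiv_id] at h1
  rw [e2.mfderiv_eq, mfderiv_id] at h2
  exact ContinuousLinearMap.IsInvertible.of_inverse (g := mfderiv 𝓘(ℝ, BaseCoord d × FibCoord n)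
    (𝓡 (d + 1 + n)) e.chart.symm (e.chart y)) h2.symm h1.symm

theorem dchart_dchartInv {y : E} (hy : y ∈ e.chart.source) (v : BaseCoord d × FibCoord n) :
    e.dchart y (e.dchartInv y v) = v :=
  congrArg (fun L : BaseCoord d × FibCoord n →L[ℝ] BaseCoord d × FibCoord n => L v)
    (e.isInvertible_dchart hy).self_comp_inverse

theorem dchartInv_dchart {y : E} (hy : y ∈ e.chart.source) (v : TangentSpace (𝓡 (d + 1 + n)) y) :
    e.dchartInv y (e.dchart y v) = v :=
  congrArg (fun L : TangentSpace (𝓡 (d + 1 + n)) y →L[ℝ] TangentSpace (𝓡 (d + 1 + n)) y => L v)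
    (e.isInvertible_dchart hy).inverse_comp_self

theorem dchartInv_eq {y : E} (hy : y ∈ e.chart.source) :
    e.dchartInv y = mfderiv 𝓘(ℝ, BaseCoord d × FibCoord n) (𝓡 (d + 1 + n)) e.chart.symm (e.chart y) := by
  have hz := e.chart.map_source hy
  have h1 := mfderiv_comp (I := 𝓡 (d + 1 + n)) y (e.mdifferentiableAt_symm hz)
    (e.mdifferentiableAt_chart hy)
  have e1 : (e.chart.symm ∘ e.chart) =ᶠ[𝓝 y] id := by
    filter_upwards [e.chart.open_source.mem_nhds hy] with w hw using e.chart.left_inv hw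
  rw [e1.mfderiv_eq, mfderiv_id] at h1
  refine ContinuousLinearMap.ext fun v => ?_
  have := congrArg (fun L : TangentSpace (𝓡 (d + 1 + n)) y →L[ℝ] TangentSpace (𝓡 (d + 1 + n)) y =>
    L (e.dchartInv y v)) h1
  have h3 : e.dchartInv y v = mfderiv 𝓘(ℝ, BaseCoord d × FibCoord n) (𝓡 (d + 1 + n)) e.chart.symm
    (e.chart y) (e.dchart y (e.dchartInv y v)) := this
  rw [e.dchart_dchartInv hy] at h3
  exact h3

/-- vertical vectors are those with vanishing first chart component -/
theorem vertical_iff [IsManifold (𝓡 (d + 1)) ∞ M] {y : E} (hy : y ∈ e.chart.source)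
    (v : TangentSpace (𝓡 (d + 1 + n)) y) :
    mfderiv (𝓡 (d + 1 + n)) (𝓡 (d + 1)) B.proj y v = 0 ↔ (e.dchart y v).1 = 0 := by
  have hb := e.proj_mem y hy
  have hbd : MDifferentiableAt (𝓡 (d + 1)) (𝓡 (d + 1)) e.base (B.proj y) :=
    ((contMDiffOn_of_mem_maximalAtlas e.base_mem _ hb).contMDiffAt
      (e.base.open_source.mem_nhds hb)).mdifferentiableAt (by simp)
  have hbs : MDifferentiableAt (𝓡 (d + 1)) (𝓡 (d + 1)) e.base.symm (e.base (B.proj y)) :=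
    ((contMDiffOn_symm_of_mem_maximalAtlas e.base_mem _ (e.base.map_source hb)).contMDiffAt
      (e.base.open_target.mem_nhds (e.base.map_source hb))).mdifferentiableAt (by simp)
  have hp : MDifferentiableAt (𝓡 (d + 1 + n)) (𝓡 (d + 1)) B.proj y :=
    B.contMDiff_proj.mdifferentiableAt (by simp)
  have hc := e.mdifferentiableAt_chart hy
  have hfst : MDifferentiableAt 𝓘(ℝ, BaseCoord d × FibCoord n) (𝓡 (d + 1))
      (Prod.fst : BaseCoord d × FibCoord n → BaseCoord d) (e.chart y) :=
    (differentiable_fst _).mdifferentiableAt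
  have h1 := mfderiv_comp (I := 𝓡 (d + 1 + n)) y hbd hp
  have h2 := mfderiv_comp (I := 𝓡 (d + 1 + n)) y hfst hc
  have e1 : (e.base ∘ B.proj) =ᶠ[𝓝 y] (Prod.fst ∘ e.chart) := by
    filter_upwards [e.chart.open_source.mem_nhds hy] with w hw using (e.fst_chart w hw).symm
  rw [e1.mfderiv_eq, h2] at h1
  have h3 : (e.dchart y v).1 = mfderiv (𝓡 (d + 1)) (𝓡 (d + 1)) e.base (B.proj y)
      (mfderiv (𝓡 (d + 1 + n)) (𝓡 (d + 1)) B.proj y v) := by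
    have := congrArg (fun L : TangentSpace (𝓡 (d + 1 + n)) y →L[ℝ] BaseCoord d => L v) h1
    rw [mfderiv_eq_fderiv, fderiv_fst] at this
    exact this
  have h4 := mfderiv_comp (I := 𝓡 (d + 1)) (B.proj y) hbs hbd
  have e2 : (e.base.symm ∘ e.base) =ᶠ[𝓝 (B.proj y)] id := by
    filter_upwards [e.base.open_source.mem_nhds hb] with w hw using e.base.left_inv hw
  rw [e2.mfderiv_eq, mfderiv_id] at h4
  constructor
  · intro h
    rw [h3, h]; exact map_zero _
  · intro h
    rw [h3] at h
    have h5 := congrArg (fun L : TangentSpace (𝓡 (d + 1)) (B.proj y) →L[ℝ] BaseCoord d =>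
      L (mfderiv (𝓡 (d + 1 + n)) (𝓡 (d + 1)) B.proj y v)) h4
    refine Eq.trans h5 ?_
    change mfderiv (𝓡 (d + 1)) (𝓡 (d + 1)) e.base.symm _ (mfderiv (𝓡 (d + 1)) (𝓡 (d + 1)) e.base (B.proj y) _) = 0
    rw [h]; exact map_zero _

/-- A form on `T_y E` read in an adapted chart. -/
def toModel (y : E) : FormFiber B y →ₗ[ℝ] FormModel d n :=
  (retract (Lambda2Model d n)).comp
    ((ContinuousAlternatingMap.compContinuousLinearMapₗ (e.dchartInv y)).comp (Lambda2 B y).subtype)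

/-- The pull-back to `T_y E` of a form on the coordinate space. -/
def fromModel (y : E) : FormModel d n →ₗ[ℝ] FormFiber B y :=
  (retract (Lambda2 B y)).comp
    ((ContinuousAlternatingMap.compContinuousLinearMapₗ (e.dchart y)).comp (Lambda2Model d n).subtype)

section
variable [IsManifold (𝓡 (d + 1)) ∞ M]

theorem coe_toModel {y : E} (hy : y ∈ e.chart.source) (ζ : FormFiber B y) :
    (e.toModel y ζ).1 =
      ζ.1.compContinuousLinearMap (e.dchartInv y) := by
  refine retract_of_mem _ ?_
  intro v i j hij hi hj
  refine ζ.2 (fun k => e.dchartInv y (v k)) i j hij ?_ ?_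
  · rw [e.vertical_iff hy, e.dchart_dchartInv hy, hi]
  · rw [e.vertical_iff hy, e.dchart_dchartInv hy, hj]

theorem coe_fromModel {y : E} (hy : y ∈ e.chart.source) (ζ : FormModel d n) :
    (e.fromModel y ζ).1 =
      ζ.1.compContinuousLinearMap (e.dchart y) := by
  refine retract_of_mem _ ?_
  intro v i j hij hi hj
  exact ζ.2 (fun k => e.dchart y (v k)) i j hij ((e.vertical_iff hy _).1 hi)
    ((e.vertical_iff hy _).1 hj)

theorem fromModel_toModel {y : E} (hy : y ∈ e.chart.source) (ζ : FormFiber B y) :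
    e.fromModel y (e.toModel y ζ) = ζ := by
  apply Subtype.ext
  rw [e.coe_fromModel hy, e.coe_toModel hy]
  ext v
  change ζ.1 (fun k => e.dchartInv y (e.dchart y (v k))) = ζ.1 v
  simp only [e.dchartInv_dchart hy]

theorem toModel_fromModel {y : E} (hy : y ∈ e.chart.source) (ζ : FormModel d n) :
    e.toModel y (e.fromModel y ζ) = ζ := by
  apply Subtype.ext
  rw [e.coe_toModel hy, e.coe_fromModel hy]
  ext v
  change ζ.1 (fun k => e.dchart y (e.dchartInv y (v k))) = ζ.1 v
  simp only [e.dchart_dchartInv hy]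

/-- The trivialisation of `Λ₂^m T^*E` induced by an adapted chart. -/
def pretrivialization : Pretrivialization (FormModel d n)
    (π (FormModel d n) (FormFiber B)) where
  toFun p := (p.1, e.toModel p.1 p.2)
  invFun q := ⟨q.1, e.fromModel q.1 q.2⟩
  source := π (FormModel d n) (FormFiber B) ⁻¹' e.chart.source
  target := e.chart.source ×ˢ univ
  map_source' p hp := ⟨hp, mem_univ _⟩
  map_target' q hq := hq.1
  left_inv' := by
    rintro ⟨y, ζ⟩ hy
    change (⟨y, e.fromModel y (e.toModel y ζ)⟩ :
      TotalSpace (FormModel d n) (FormFiber B)) = ⟨y, ζ⟩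
    rw [e.fromModel_toModel hy]
  right_inv' := by
    rintro ⟨y, ζ⟩ ⟨hy, -⟩
    change (y, e.toModel y (e.fromModel y ζ)) = (y, ζ)
    rw [e.toModel_fromModel hy]
  open_target := e.chart.open_source.prod isOpen_univ
  baseSet := e.chart.source
  open_baseSet := e.chart.open_source
  source_eq := rfl
  target_eq := rfl
  proj_toFun _ _ := rfl

theorem pretrivialization_symm {y : E} (hy : y ∈ e.chart.source) (ζ : FormModel d n) :
    e.pretrivialization.symm y ζ = e.fromModel y ζ := by
  rw [Pretrivialization.symm_apply _ hy]; rfl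

end

theorem contMDiffOn_transition [IsManifold (𝓡 (d + 1 + n)) ∞ E] (e' : AdaptedChart B) :
    ContMDiffOn (𝓡 (d + 1 + n))
      𝓘(ℝ, BaseCoord d × FibCoord n →L[ℝ] BaseCoord d × FibCoord n) ∞
      (fun y => (e.dchart y).comp (e'.dchartInv y)) (e.chart.source ∩ e'.chart.source) := by
  set s := (e'.chart.symm.trans e.chart).source with hs
  have hso : IsOpen s := (e'.chart.symm.trans e.chart).open_source
  have h1 : ContDiffOn ℝ ∞ (e.chart ∘ e'.chart.symm) s := by
    rw [← contMDiffOn_iff_contDiffOn]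
    exact e.contMDiffOn_chart.comp (e'.contMDiffOn_symm.mono inter_subset_left) (fun z hz => hz.2)
  have h2 : ContDiffOn ℝ ∞ (fderiv ℝ (e.chart ∘ e'.chart.symm)) s :=
    h1.fderiv_of_isOpen hso (by simp)
  have h3 := (contMDiffOn_iff_contDiffOn.2 h2).comp
    (e'.contMDiffOn_chart.mono (inter_subset_right : e.chart.source ∩ e'.chart.source ⊆ e'.chart.source))
    (fun y (hy : y ∈ e.chart.source ∩ e'.chart.source) => by
      refine ⟨e'.chart.map_source hy.2, ?_⟩
      change e'.chart.symm (e'.chart y) ∈ e.chart.source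
      rw [e'.chart.left_inv hy.2]; exact hy.1)
  refine h3.congr fun y (hy : y ∈ e.chart.source ∩ e'.chart.source) => ?_
  have hz := e'.chart.map_source hy.2
  have hc : MDifferentiableAt (𝓡 (d + 1 + n)) 𝓘(ℝ, BaseCoord d × FibCoord n) e.chart
      (e'.chart.symm (e'.chart y)) := by
    rw [e'.chart.left_inv hy.2]; exact e.mdifferentiableAt_chart hy.1
  have h4 := mfderiv_comp (I := 𝓘(ℝ, BaseCoord d × FibCoord n)) (e'.chart y) hc
    (e'.mdifferentiableAt_symm hz)
  rw [e'.chart.left_inv hy.2, mfderiv_eq_fderiv] at h4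
  rw [e'.dchartInv_eq hy.2]
  exact h4.symm

end AdaptedChart

instance finite_multilinear (V : Type*) [NormedAddCommGroup V] [NormedSpace ℝ V]
    [FiniteDimensional ℝ V] (k : ℕ) :
    FiniteDimensional ℝ (ContinuousMultilinearMap ℝ (fun _ : Fin k => V) ℝ) := by
  let f : (ContinuousMultilinearMap ℝ (fun _ : Fin k => V) ℝ) →ₗ[ℝ]
      MultilinearMap ℝ (fun _ : Fin k => V) ℝ :=
    { toFun := fun a => a.toMultilinearMap
      map_add' := fun _ _ => rfl
      map_smul' := fun _ _ => rfl }
  refine FiniteDimensional.of_injective f fun a b h => ?_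
  ext v
  exact congrArg (fun g : MultilinearMap ℝ (fun _ : Fin k => V) ℝ => g v) h

theorem exists_smooth_pullback (V : Type*) [NormedAddCommGroup V] [NormedSpace ℝ V]
    [FiniteDimensional ℝ V] (k : ℕ) (W : Type*) [NormedAddCommGroup W] [NormedSpace ℝ W]
    [FiniteDimensional ℝ W] (j : W →ₗ[ℝ] V [⋀^Fin k]→L[ℝ] ℝ) (hj : Function.Injective j) :
    ∃ G : (V →L[ℝ] V) → (W →L[ℝ] W), ContDiff ℝ ∞ G ∧
      ∀ (L : V →L[ℝ] V) (a b : W), j b = (j a).compContinuousLinearMap L → G L a = b := by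
  let incl : W →L[ℝ] ContinuousMultilinearMap ℝ (fun _ : Fin k => V) ℝ :=
    (ContinuousAlternatingMap.toContinuousMultilinearMapCLM ℝ).comp (LinearMap.toContinuousLinearMap j)
  have hincl : Function.Injective incl := fun a b h => by
    apply hj
    ext v
    exact congrArg (fun g : ContinuousMultilinearMap ℝ (fun _ : Fin k => V) ℝ => g v) h
  obtain ⟨R, hR⟩ := ContinuousLinearMap.HasLeftInverse.of_injective_of_finiteDimensional hincl
  let C := ContinuousMultilinearMap.compContinuousLinearMapContinuousMultilinear ℝ
    (fun _ : Fin k => V) (fun _ : Fin k => V) ℝ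
  refine ⟨fun L => R.comp ((C fun _ => L).comp incl), ?_, ?_⟩
  · have hC : ContDiff ℝ ∞ C := ContinuousMultilinearMap.contDiff (𝕜 := ℝ)
      (E := fun _ : Fin k => V →L[ℝ] V)
      (F := ContinuousMultilinearMap ℝ (fun _ : Fin k => V) ℝ →L[ℝ]
        ContinuousMultilinearMap ℝ (fun _ : Fin k => V) ℝ) C
    have h1 : ContDiff ℝ ∞ (fun L : V →L[ℝ] V => C fun _ => L) :=
      hC.comp (contDiff_pi.2 fun _ => contDiff_id)
    exact contDiff_const.clm_comp (h1.clm_comp contDiff_const)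
  · intro L a b h
    have : (C fun _ => L) (incl a) = incl b := by
      ext v
      exact (congrArg (fun g : V [⋀^Fin k]→L[ℝ] ℝ => g v) h).symm
    change R ((C fun _ => L) (incl a)) = b
    rw [this, hR]

section
variable [IsManifold (𝓡 (d + 1)) ∞ M]

theorem exists_contMDiff_coordChange [IsManifold (𝓡 (d + 1 + n)) ∞ E]
    {B : SmoothFiberBundle d n M E F} (e e' : AdaptedChart B) :
    ∃ f : E → FormModel d n →L[ℝ] FormModel d n,
      ContMDiffOn (𝓡 (d + 1 + n)) 𝓘(ℝ, FormModel d n →L[ℝ] FormModel d n) ∞ f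
        (e.pretrivialization.baseSet ∩ e'.pretrivialization.baseSet) ∧
      ∀ y ∈ e.pretrivialization.baseSet ∩ e'.pretrivialization.baseSet, ∀ a : FormModel d n,
        f y a = (e'.pretrivialization ⟨y, e.pretrivialization.symm y a⟩).2 := by
  obtain ⟨G, hG, hG'⟩ := exists_smooth_pullback (BaseCoord d × FibCoord n) (d + 1)
    (FormModel d n) (Lambda2Model d n).subtype Subtype.val_injective
  refine ⟨fun y => G ((e.dchart y).comp (e'.dchartInv y)),
    hG.contMDiff.comp_contMDiffOn (e.contMDiffOn_transition e'), ?_⟩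
  rintro y ⟨hy, hy'⟩ a
  rw [e.pretrivialization_symm hy]
  apply hG'
  change (e'.toModel y (e.fromModel y a)).1 = _
  rw [e'.coe_toModel hy', e.coe_fromModel hy]
  rfl

/-- The vector bundle structure of `Λ₂^m T^*E`, given by all adapted charts. -/
def prebundle [IsManifold (𝓡 n) ∞ F] [IsManifold (𝓡 (d + 1 + n)) ∞ E] (B : SmoothFiberBundle d n M E F) :
    VectorPrebundle ℝ (FormModel d n) (FormFiber B) where
  pretrivializationAtlas := {t | ∃ e : AdaptedChart B, t = e.pretrivialization}
  pretrivialization_linear' := by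
    rintro _ ⟨e, rfl⟩
    exact ⟨fun y _ => ⟨fun a b => map_add (e.toModel y) a b, fun c a => map_smul (e.toModel y) c a⟩⟩
  pretrivializationAt y := (exists_adaptedChart B y).choose.pretrivialization
  mem_base_pretrivializationAt y := (exists_adaptedChart B y).choose_spec
  pretrivialization_mem_atlas y := ⟨_, rfl⟩
  exists_coordChange := by
    rintro _ ⟨e, rfl⟩ _ ⟨e', rfl⟩
    obtain ⟨f, hf, hf'⟩ := exists_contMDiff_coordChange e e'
    exact ⟨f, hf.continuousOn, hf'⟩
  totalSpaceMk_isInducing y := by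
    have hy := (exists_adaptedChart B y).choose_spec
    set e := (exists_adaptedChart B y).choose
    let φ : FormFiber B y ≃L[ℝ] FormModel d n := LinearEquiv.toContinuousLinearEquiv
      { e.toModel y with
        invFun := e.fromModel y
        left_inv := e.fromModel_toModel hy
        right_inv := e.toModel_fromModel hy }
    exact (Topology.isInducing_const_prod.mpr φ.toHomeomorph.isInducing :
      Topology.IsInducing fun ζ : FormFiber B y => (y, φ ζ))

end

end

section
variable {d n : ℕ}
  {M : Type*} [TopologicalSpace M] [ChartedSpace (BaseCoord d) M] [IsManifold (𝓡 (d + 1)) ∞ M]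
  {E : Type*} [TopologicalSpace E] [ChartedSpace (TotCoord d n) E] [IsManifold (𝓡 (d + 1 + n)) ∞ E]
  {F : Type*} [TopologicalSpace F] [ChartedSpace (FibCoord n) F] [IsManifold (𝓡 n) ∞ F]
  (B : SmoothFiberBundle d n M E F)

instance instTopologicalSpaceTotal : TopologicalSpace (TotalSpace (FormModel d n) (FormFiber B)) :=
  (prebundle B).totalSpaceTopology

instance instFiberBundleForm : FiberBundle (FormModel d n) (FormFiber B) :=
  (prebundle B).toFiberBundle

instance instVectorBundleForm : VectorBundle ℝ (FormModel d n) (FormFiber B) :=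
  (prebundle B).toVectorBundle

instance instIsContMDiffPrebundle : (prebundle B).IsContMDiff (𝓡 (d + 1 + n)) ∞ where
  exists_contMDiffCoordChange := by
    rintro _ ⟨e, rfl⟩ _ ⟨e', rfl⟩
    exact exists_contMDiff_coordChange e e'

instance instContMDiffVectorBundleForm : ContMDiffVectorBundle ∞ (FormModel d n) (FormFiber B) (𝓡 (d + 1 + n)) :=
  (prebundle B).contMDiffVectorBundle (𝓡 (d + 1 + n))

/-- The extended multimomentum bundle `𝓜π = Λ₂^m T^*E`; its points are the pairs `(y, ζ)`. -/
abbrev ExtMultimomentum : Type _ := TotalSpace (FormModel d n) (FormFiber B)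

variable (d n) in
/-- The model of the manifold `𝓜π`. -/
abbrev extModel := (𝓡 (d + 1 + n)).prod 𝓘(ℝ, FormModel d n)

variable {B} in
/-- The form `ζ` underlying an element of the fibre of `𝓜π` over `y`. -/
def toForm {y : E} (ζ : FormFiber B y) : TangentSpace (𝓡 (d + 1 + n)) y [⋀^Fin (d + 1)]→L[ℝ] ℝ :=
  ζ.1

end

section Forms
variable {V : Type*} [NormedAddCommGroup V] [NormedSpace ℝ V] {H : Type*} [TopologicalSpace H]
  (I : ModelWithCorners ℝ V H) {N : Type*} [TopologicalSpace N] [ChartedSpace H N]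

/-- A differential `k`-form on a manifold (no smoothness is built in). -/
abbrev DiffForm (N : Type*) [TopologicalSpace N] [ChartedSpace H N] (k : ℕ) : Type _ :=
  (p : N) → TangentSpace I p [⋀^Fin k]→L[ℝ] ℝ

/-- A vector field on a manifold (no smoothness is built in). -/
abbrev VecField (N : Type*) [TopologicalSpace N] [ChartedSpace H N] : Type _ :=
  (p : N) → TangentSpace I p

/-- Smoothness of a vector field, as a section of the tangent bundle. -/
def SmoothVecField [IsManifold I 1 N] (X : VecField I N) : Prop :=
  ContMDiff I I.tangent ∞ (fun p : N => (⟨p, X p⟩ : TangentBundle I N))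

/-- The exterior derivative: the form is written in the chart at `p`, differentiated there, and the
result at `p` is pulled back. -/
def mextDeriv {k : ℕ} (α : DiffForm I N k) : DiffForm I N (k + 1) := fun p =>
  ContinuousAlternatingMap.compContinuousLinearMap
    (extDerivWithin
      (fun z : V => ContinuousAlternatingMap.compContinuousLinearMap
        (α ((extChartAt I p).symm z))
        (mfderivWithin 𝓘(ℝ, V) I (extChartAt I p).symm (range I) z))
      (range I) (extChartAt I p p) : V [⋀^Fin (k + 1)]→L[ℝ] ℝ)
    (mfderiv I 𝓘(ℝ, V) (extChartAt I p) p)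

variable {I}
/-- The interior product `i(X)α = α(X, ·, …, ·)`. -/
def interior {k : ℕ} (X : VecField I N) (α : DiffForm I N (k + 1)) : DiffForm I N k := fun p =>
  ContinuousAlternatingMap.curryLeft (E := V) (α p) (X p)

end Forms

section
variable {d n : ℕ}
  {M : Type*} [TopologicalSpace M] [ChartedSpace (BaseCoord d) M] [IsManifold (𝓡 (d + 1)) ∞ M]
  {E : Type*} [TopologicalSpace E] [ChartedSpace (TotCoord d n) E] [IsManifold (𝓡 (d + 1 + n)) ∞ E]
  {F : Type*} [TopologicalSpace F] [ChartedSpace (FibCoord n) F] [IsManifold (𝓡 n) ∞ F]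
  (B : SmoothFiberBundle d n M E F)

/-- The derivative at `p` of the projection `𝓜π → E`. -/
def dproj (p : ExtMultimomentum B) :
    TangentSpace (extModel d n) p →L[ℝ] TangentSpace (𝓡 (d + 1 + n)) p.proj :=
  mfderiv (extModel d n) (𝓡 (d + 1 + n)) (TotalSpace.proj : ExtMultimomentum B → E) p

/-- The tautological form `Θ_{(y,ζ)}(X₀, …) = ζ(Tσ̃ X₀, …)` of degree `m = d + 1`. -/
def tautologicalForm : DiffForm (extModel d n) (ExtMultimomentum B) (d + 1) := fun p =>
  (toForm p.snd).compContinuousLinearMap (dproj B p)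

/-- The multisymplectic form `Ω = -dΘ`. -/
def multisymplecticForm : DiffForm (extModel d n) (ExtMultimomentum B) (d + 1 + 1) := fun p =>
  -(mextDeriv (extModel d n) (tautologicalForm B) p)

/-- The `(m - 1)`-form `Γ_ξ` on `𝓜π`: its value at `(y, ζ)` is the interior product of `ζ` with
`ξ|_y`, pulled back along the projection to `E`. -/
def gammaForm (ξ : VecField (𝓡 (d + 1 + n)) E) :
    DiffForm (extModel d n) (ExtMultimomentum B) d := fun p =>
  ContinuousAlternatingMap.compContinuousLinearMap
    (ContinuousAlternatingMap.curryLeft (E := TotCoord d n) (toForm p.snd) (ξ p.proj))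
    (dproj B p)

/-- `ξ` is projectable: it is related by the projection to a smooth vector field of the base. -/
def IsProjectable (ξ : VecField (𝓡 (d + 1 + n)) E) : Prop :=
  ∃ ξM : VecField (𝓡 (d + 1)) M, SmoothVecField (𝓡 (d + 1)) ξM ∧
    ∀ y : E, mfderiv (𝓡 (d + 1 + n)) (𝓡 (d + 1)) B.proj y (ξ y) = ξM (B.proj y)

/-- `φ` is a smooth local flow of `ξ`, defined for `|t| < ε` on the open set `U`. -/
structure IsLocalFlow (ξ : VecField (𝓡 (d + 1 + n)) E) (ε : ℝ) (U : Set E) (φ : ℝ → E → E) :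
    Prop where
  pos : 0 < ε
  isOpen : IsOpen U
  contMDiffOn : ContMDiffOn (𝓘(ℝ, ℝ).prod (𝓡 (d + 1 + n))) (𝓡 (d + 1 + n)) ∞
    (fun q : ℝ × E => φ q.1 q.2) (Ioo (-ε) ε ×ˢ U)
  map_zero : ∀ y ∈ U, φ 0 y = y
  isIntegralCurve : ∀ y ∈ U,
    IsMIntegralCurveOn (I := 𝓡 (d + 1 + n)) (fun t => φ t y) ξ (Ioo (-ε) ε)

/-- `(Φ⁻¹)^* ζ`, for a local diffeomorphism `Φ` at `y` and a form `ζ` on `T_y E`: the form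
`ζ((T_yΦ)⁻¹ ·, …, (T_yΦ)⁻¹ ·)` on `T_{Φ(y)} E`. -/
def pushForward (Φ : E → E) (y : E)
    (ζ : TangentSpace (𝓡 (d + 1 + n)) y [⋀^Fin (d + 1)]→L[ℝ] ℝ) :
    TangentSpace (𝓡 (d + 1 + n)) (Φ y) [⋀^Fin (d + 1)]→L[ℝ] ℝ :=
  ζ.compContinuousLinearMap (mfderiv (𝓡 (d + 1 + n)) (𝓡 (d + 1 + n)) Φ y).inverse

/-- `Z` is the canonical lift of `ξ` to `𝓜π`: it is smooth, and for every local flow `φ_t` of `ξ`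
the lifted maps `(y, ζ) ↦ (φ_t(y), (φ_t⁻¹)^* ζ)` have values in `𝓜π` and are the local flow
of `Z`. -/
def IsCanonicalLift (ξ : VecField (𝓡 (d + 1 + n)) E)
    (Z : VecField (extModel d n) (ExtMultimomentum B)) : Prop :=
  SmoothVecField (extModel d n) Z ∧
  ∀ (ε : ℝ) (U : Set E) (φ : ℝ → E → E), IsLocalFlow ξ ε U φ →
    ∀ y ∈ U, ∀ ζ : FormFiber B y, ∃ η : (t : ℝ) → FormFiber B (φ t y),
      (∀ t ∈ Ioo (-ε) ε, toForm (η t) = pushForward (φ t) y (toForm ζ)) ∧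
      IsMIntegralCurveOn (I := extModel d n)
        (fun t => (⟨φ t y, η t⟩ : ExtMultimomentum B)) Z (Ioo (-ε) ε)

namespace AdaptedChart
variable {B}
variable (e : AdaptedChart B)

/-- The coordinate vector `∂/∂x^μ` at `y`. -/
def vecX (y : E) (μ : Fin (d + 1)) : TangentSpace (𝓡 (d + 1 + n)) y :=
  e.dchartInv y (EuclideanSpace.single μ 1, 0)

/-- The coordinate vector `∂/∂y^A` at `y`. -/
def vecY (y : E) (A : Fin n) : TangentSpace (𝓡 (d + 1 + n)) y :=
  e.dchartInv y (0, EuclideanSpace.single A 1)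

/-- The coordinate `x^μ` on `𝓜π`. -/
def coordX (μ : Fin (d + 1)) (q : ExtMultimomentum B) : ℝ := (e.chart q.proj).1 μ

/-- The coordinate `y^A` on `𝓜π`. -/
def coordY (A : Fin n) (q : ExtMultimomentum B) : ℝ := (e.chart q.proj).2 A

/-- The coordinate `p_A^μ` on `𝓜π`. For `ζ = p_A^μ dy^A ∧ d^{m-1}x_μ + p d^m x`, where
`d^{m-1}x_μ = i(∂/∂x^μ) d^m x`, it is the value of `ζ` on `(∂/∂x^0, …, ∂/∂x^{m-1})` with
`∂/∂x^μ` replaced by `∂/∂y^A`. -/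
def coordP (A : Fin n) (μ : Fin (d + 1)) (q : ExtMultimomentum B) : ℝ :=
  toForm q.snd (Function.update (e.vecX q.proj) μ (e.vecY q.proj A))

/-- The coordinate `p` on `𝓜π`, that is `ζ(∂/∂x^0, …, ∂/∂x^{m-1})`. -/
def coordP₀ (q : ExtMultimomentum B) : ℝ := toForm q.snd (e.vecX q.proj)

/-- The functions `ξ^μ` of `ξ = -ξ^μ ∂/∂x^μ - ξ^A ∂/∂y^A` in the chart (note the signs). -/
def compX (ξ : VecField (𝓡 (d + 1 + n)) E) (μ : Fin (d + 1)) (z : BaseCoord d × FibCoord n) : ℝ :=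
  -(e.dchart (e.chart.symm z) (ξ (e.chart.symm z))).1 μ

/-- The functions `ξ^A` of `ξ = -ξ^μ ∂/∂x^μ - ξ^A ∂/∂y^A` in the chart (note the signs). -/
def compY (ξ : VecField (𝓡 (d + 1 + n)) E) (A : Fin n) (z : BaseCoord d × FibCoord n) : ℝ :=
  -(e.dchart (e.chart.symm z) (ξ (e.chart.symm z))).2 A

end AdaptedChart

/-- The partial derivative `∂f/∂x^μ` on the coordinate space. -/
def partialX (f : BaseCoord d × FibCoord n → ℝ) (μ : Fin (d + 1))
    (z : BaseCoord d × FibCoord n) : ℝ :=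
  fderiv ℝ f z (EuclideanSpace.single μ 1, 0)

/-- The partial derivative `∂f/∂y^A` on the coordinate space. -/
def partialY (f : BaseCoord d × FibCoord n → ℝ) (A : Fin n)
    (z : BaseCoord d × FibCoord n) : ℝ :=
  fderiv ℝ f z (0, EuclideanSpace.single A 1)

end

end Multimomentum

end

/-! In an adapted chart `𝓜π` is `V × A`, with `V = ℝ^m × ℝ^n` and `A` the space of `m`-forms on `V`
that vanish on two vertical arguments. There `Θ` at `(x, a)` is `a` composed with the projection to
`V`. If `ξ` is read as `f : V → V`, then `Γ_ξ` is `a(f x, ·, …, ·)`. Both are linear in `a`, so the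
equation `i(w)Ω = dΓ_ξ` at a point can be expanded by hand. Its `f`-terms say that `w.1 - f x` is
annihilated by every form of `A`, and its `Df`-terms say that `w.2` is `-∑ᵢ a(…, Df vᵢ, …)`. The
forms in `A` separate vectors, so the only solution is `w = (f x, lieAction (Df x) a)`
(`model_hamiltonian_iff`). Projectability enters through `Df`: it preserves vertical vectors, which
keeps `w.2` inside `A`. Since the equation mentions no chart, these pointwise solutions form one
global smooth field, `canonicalLift`.

That this field generates the lifted flow is the variational equation. In charts the Jacobian `R` of
the flow satisfies `R' = Df R`, so `(R⁻¹)' = -R⁻¹ Df`, and `a = ζ ∘ R⁻¹` has derivative `lieAction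
Df a` (`hasDerivAt_formRetract_comp_inverse`). The same linear equation, continued along the
connected time interval, shows that `Tφ_t` is injective and respects vertical vectors in both
directions. Hence push-forwards stay in `𝓜π`. Conversely, every point of `𝓜π` is the time-zero
position of a lifted flow line, so a canonical lift is determined by the velocities of these lines.
This uses the existence of smooth local flows, obtained from the implicit function theorem on a
space of continuous curves. The coordinate formula is `lieAction` evaluated on coordinate vectors.
-/

noncomputable section

namespace Multimomentum

/-! ### Smooth dependence on initial values: local flows in normed spaces. -/

section Flow

universe u

set_option synthInstance.maxHeartbeats 400000 in
/-- Pointwise evaluation `A, h ↦ (t ↦ A t (h t))` as a continuous bilinear map. -/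
def pointwiseApply (X : Type*) [TopologicalSpace X] [CompactSpace X]
    (W W' : Type*) [NormedAddCommGroup W] [NormedSpace ℝ W]
    [NormedAddCommGroup W'] [NormedSpace ℝ W'] :
    C(X, W →L[ℝ] W') →L[ℝ] C(X, W) →L[ℝ] C(X, W') :=
  LinearMap.mkContinuous₂
    (LinearMap.mk₂ ℝ (fun (A : C(X, W →L[ℝ] W')) (h : C(X, W)) =>
        (⟨fun t => A t (h t), A.continuous.clm_apply h.continuous⟩ : C(X, W')))
      (fun _ _ _ => rfl) (fun _ _ _ => rfl)
      (fun A h k => ContinuousMap.ext fun t => map_add (A t) (h t) (k t))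
      (fun c A h => ContinuousMap.ext fun t => map_smul (A t) c (h t)))
    1 (fun A h => by
      rw [one_mul, ContinuousMap.norm_le _ (by positivity)]
      intro t
      exact (A t).le_of_opNorm_le_of_le (A.norm_coe_le_norm t) (h.norm_coe_le_norm t))

-- Continuity of `γ ↦ f' ∘ γ` in the uniform norm makes `f'` vary by at most `c` on the `δ`-ball
-- about `γ t`, with one `δ` for all `t`. The mean value inequality at each `t` then gives a uniform
-- remainder estimate.
set_option synthInstance.maxHeartbeats 400000 in
theorem hasFDerivAt_postcomp {X : Type*} [TopologicalSpace X] [CompactSpace X]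
    {W W' : Type*} [NormedAddCommGroup W] [NormedSpace ℝ W]
    [NormedAddCommGroup W'] [NormedSpace ℝ W'] {f : C(W, W')} {f' : C(W, W →L[ℝ] W')}
    (hf : ∀ x, HasFDerivAt f (f' x) x) (γ : C(X, W)) :
    HasFDerivAt (fun γ : C(X, W) => f.comp γ) (pointwiseApply X W W' (f'.comp γ)) γ := by
  rw [hasFDerivAt_iff_isLittleO_nhds_zero, Asymptotics.isLittleO_iff]
  intro c hc
  have hcont : Continuous fun γ : C(X, W) => f'.comp γ := ContinuousMap.continuous_postcomp f'
  obtain ⟨δ, hδ, hball⟩ := Metric.mem_nhds_iff.1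
    (hcont.continuousAt.preimage_mem_nhds (Metric.ball_mem_nhds (f'.comp γ) hc))
  filter_upwards [Metric.ball_mem_nhds (0 : C(X, W)) hδ] with h hh
  rw [mem_ball_zero_iff] at hh
  rw [ContinuousMap.norm_le _ (by positivity)]
  intro t
  have key : ∀ z ∈ Metric.ball (γ t) δ, ‖f' z - f' (γ t)‖ ≤ c := by
    intro z hz
    -- The test curve is `γ` translated by a constant so that it passes through `z` at `t`; it stays
    -- within `δ` of `γ`.
    have h1 := @hball (γ + ContinuousMap.const X (z - γ t)) (by
      rw [mem_ball_iff_norm, add_sub_cancel_left, ContinuousMap.norm_lt_iff _ hδ]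
      intro s
      simpa [dist_eq_norm] using hz)
    have h2 := ((ContinuousMap.dist_lt_iff hc).1 h1 t).le
    simpa [dist_eq_norm] using h2
  have hmem : γ t + h t ∈ Metric.ball (γ t) δ := by
    rw [mem_ball_iff_norm, add_sub_cancel_left]
    exact (h.norm_coe_le_norm t).trans_lt hh
  have := (convex_ball (γ t) δ).norm_image_sub_le_of_norm_hasFDerivWithin_le'
    (f := f) (φ := f' (γ t)) (fun z _ => (hf z).hasFDerivWithinAt) key
    (Metric.mem_ball_self hδ) hmem
  rw [add_sub_cancel_left] at this
  exact this.trans (mul_le_mul_of_nonneg_left (h.norm_coe_le_norm t) hc.le)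

-- The derivative of postcomposition with `f` is postcomposition with `fderiv ℝ f` followed by a
-- continuous linear map, so regularity goes up by induction. The target varies in the induction
-- because `fderiv ℝ f` takes values in `W →L[ℝ] W'`; the common universe keeps that space
-- admissible.
set_option synthInstance.maxHeartbeats 400000 in
theorem contDiff_postcomp_nat {X : Type*} [TopologicalSpace X] [CompactSpace X]
    {W : Type u} [NormedAddCommGroup W] [NormedSpace ℝ W] (k : ℕ) :
    ∀ {W' : Type u} [NormedAddCommGroup W'] [NormedSpace ℝ W'] (f : C(W, W')),
      ContDiff ℝ k f → ContDiff ℝ k (fun γ : C(X, W) => f.comp γ) := by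
  induction k with
  | zero =>
    intro W' _ _ f _
    exact contDiff_zero.2 (ContinuousMap.continuous_postcomp f)
  | succ k ih =>
    intro W' _ _ f hf
    rw [Nat.cast_succ] at hf ⊢
    obtain ⟨-, -, hf'⟩ := contDiff_succ_iff_fderiv.1 hf
    let f' : C(W, W →L[ℝ] W') := ⟨fderiv ℝ f, hf'.continuous⟩
    have hd : ∀ x, HasFDerivAt f (f' x) x := fun x =>
      (hf.differentiable (by simp) x).hasFDerivAt
    refine contDiff_succ_iff_hasFDerivAt.2 ⟨_, ?_, hasFDerivAt_postcomp hd⟩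
    exact (pointwiseApply X W W').contDiff.comp (ih f' hf')

theorem contDiff_postcomp {X : Type*} [TopologicalSpace X] [CompactSpace X]
    {W W' : Type u} [NormedAddCommGroup W] [NormedSpace ℝ W]
    [NormedAddCommGroup W'] [NormedSpace ℝ W'] (f : C(W, W')) (hf : ContDiff ℝ ∞ f) :
    ContDiff ℝ ∞ (fun γ : C(X, W) => f.comp γ) :=
  contDiff_infty.2 fun k => contDiff_postcomp_nat k f (hf.of_le (by exact_mod_cast le_top))

/-- The primitive vanishing at `0`, on continuous functions on `[-1, 1]`. -/
def primitive (W : Type*) [NormedAddCommGroup W] [NormedSpace ℝ W] [CompleteSpace W] :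
    C(Icc (-1 : ℝ) 1, W) →L[ℝ] C(Icc (-1 : ℝ) 1, W) :=
  LinearMap.mkContinuous
    -- `projIcc` extends `g` to the line by its end values, so an ordinary interval integral
    -- applies.
    { toFun := fun g => ⟨fun t => ∫ s in (0 : ℝ)..t, g (projIcc (-1) 1 (by norm_num) s), by
        have : Continuous fun s : ℝ => g (projIcc (-1) 1 (by norm_num) s) :=
          g.continuous.comp continuous_projIcc
        exact (intervalIntegral.continuous_primitive
          (fun a b => this.intervalIntegrable a b) 0).comp continuous_subtype_val⟩
      map_add' := fun g h => ContinuousMap.ext fun t =>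
        intervalIntegral.integral_add
          ((g.continuous.comp continuous_projIcc).intervalIntegrable _ _)
          ((h.continuous.comp continuous_projIcc).intervalIntegrable _ _)
      map_smul' := fun c g => ContinuousMap.ext fun t =>
        intervalIntegral.integral_smul c _ }
    1 (fun g => by
      rw [one_mul, ContinuousMap.norm_le _ (by positivity)]
      intro t
      have := intervalIntegral.norm_integral_le_of_norm_le_const (a := (0 : ℝ)) (b := t)
        (C := ‖g‖) (f := fun s => g (projIcc (-1) 1 (by norm_num) s))
        (fun s _ => g.norm_coe_le_norm _)
      refine this.trans ?_
      have ht : |(t : ℝ) - 0| ≤ 1 := by rw [sub_zero, abs_le]; exact t.2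
      exact mul_le_of_le_one_right (norm_nonneg _) ht)

/-- A smooth implicit function, smooth on a neighbourhood. -/
theorem exists_smooth_implicit {P Q : Type*}
    [NormedAddCommGroup P] [NormedSpace ℝ P] [CompleteSpace P]
    [NormedAddCommGroup Q] [NormedSpace ℝ Q] [CompleteSpace Q] {G : P × Q → Q}
    (hG : ContDiff ℝ ∞ G) (p : P) (q : Q)
    (hinv : (fderiv ℝ G (p, q) ∘L .inr ℝ P Q).IsInvertible) :
    ∃ ψ : P → Q, ∀ᶠ x in 𝓝 p, ContDiffAt ℝ ∞ ψ x ∧ G (x, ψ x) = G (p, q) := by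
  have hne : (∞ : WithTop ℕ∞) ≠ 0 := by simp
  let ψ := (hG.contDiffAt (x := (p, q))).implicitFunction hne hinv
  have h0 : ψ p = q := ContDiffAt.implicitFunction_apply_self _ hne hinv
  have h1 : ∀ᶠ x in 𝓝 p, G (x, ψ x) = G (p, q) :=
    ContDiffAt.eventually_apply_implicitFunction _ hne hinv
  have h2 : ContDiffAt ℝ ∞ ψ p := ContDiffAt.contDiffAt_implicitFunction _ hne hinv
  have h3 : ∀ᶠ x in 𝓝 p, ContinuousAt ψ x :=
    ((h2.of_le (m := 1) (by simp)).eventually (by simp)).mono fun x hx => hx.continuousAt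
  -- Smoothness of order `∞` at `p` alone does not spread to a neighbourhood, so the implicit
  -- function theorem is applied afresh at each nearby point; invertibility of the partial
  -- derivative is an open condition.
  have h4 : ∀ᶠ x in 𝓝 p, (fderiv ℝ G (x, ψ x) ∘L .inr ℝ P Q).IsInvertible := by
    have hc : ContinuousAt (fun x => fderiv ℝ G (x, ψ x) ∘L .inr ℝ P Q) p :=
      ((hG.continuous_fderiv hne).continuousAt.comp
        (continuousAt_id.prodMk h2.continuousAt)).clm_comp continuousAt_const
    obtain ⟨L, hL⟩ := hinv
    have := ContinuousLinearEquiv.nhds L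
    rw [hL, ← h0] at this
    exact hc.eventually this
  refine ⟨ψ, ?_⟩
  filter_upwards [h1, h3, h4, h1.eventually_nhds] with x hx1 hx3 hx4 hx5
  refine ⟨?_, hx1⟩
  -- By local uniqueness the implicit function based at `(x, ψ x)` agrees with `ψ` near `x`, and it
  -- is smooth at its own base point.
  have h6 := ContDiffAt.eventually_apply_eq_iff_implicitFunction
    (hG.contDiffAt (x := (x, ψ x))) hne hx4
  have h7 := (continuousAt_id.prodMk hx3).eventually h6
  refine (ContDiffAt.contDiffAt_implicitFunction
    (hG.contDiffAt (x := (x, ψ x))) hne hx4).congr_of_eventuallyEq ?_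
  filter_upwards [h7, hx5] with z hz hz5
  exact (hz.1 (hz5.trans hx1.symm)).symm

/-- A globally Lipschitz smooth vector field on a Banach space has smooth local flows. -/
theorem exists_flow_of_lipschitz {W : Type u} [NormedAddCommGroup W] [NormedSpace ℝ W]
    [CompleteSpace W] {f : W → W} (hf : ContDiff ℝ ∞ f) {K : NNReal} (hK : LipschitzWith K f)
    (x₀ : W) :
    ∃ ε > 0, ∃ U : Set W, IsOpen U ∧ x₀ ∈ U ∧ ∃ φ : ℝ → W → W,
      ContDiffOn ℝ ∞ (fun q : ℝ × W => φ q.1 q.2) (Ioo (-ε) ε ×ˢ U) ∧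
      (∀ x ∈ U, φ 0 x = x) ∧
      ∀ x ∈ U, ∀ t ∈ Ioo (-ε) ε, HasDerivAt (fun s => φ s x) (f (φ t x)) t := by
  let J := Icc (-1 : ℝ) 1
  let fc : C(W, W) := ⟨f, hf.continuous⟩
  -- Zeros of `G` are the curves `γ s = x + τ ∫₀ˢ f (γ)`: integral curves run at speed `τ` on the
  -- fixed interval `[-1, 1]`. Time has become a parameter like `x`, and at `τ = 0` the partial
  -- derivative in `γ` is the identity.
  let G : (ℝ × W) × C(J, W) → C(J, W) := fun z =>
    z.2 - ContinuousMap.const J z.1.2 - z.1.1 • primitive W (fc.comp z.2)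
  have hconst : ContDiff ℝ ∞ (fun x : W => ContinuousMap.const J x) := by
    have : (fun x : W => ContinuousMap.const J x) =
        (LinearMap.mkContinuous (⟨⟨fun x : W => ContinuousMap.const J x, fun _ _ => rfl⟩,
          fun _ _ => rfl⟩ : W →ₗ[ℝ] C(J, W)) 1 (fun x => by
            rw [one_mul, ContinuousMap.norm_le _ (by positivity)]
            exact fun _ => le_rfl) : W →L[ℝ] C(J, W)) := rfl
    rw [this]
    exact ContinuousLinearMap.contDiff _
  have hG : ContDiff ℝ ∞ G :=
    (contDiff_snd.sub (hconst.comp contDiff_fst.snd)).sub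
      (contDiff_fst.fst.smul ((primitive W).contDiff.comp
        ((contDiff_postcomp fc hf).comp contDiff_snd)))
  let γ₀ : C(J, W) := ContinuousMap.const J x₀
  have hinv : (fderiv ℝ G ((0, x₀), γ₀) ∘L .inr ℝ (ℝ × W) C(J, W)).IsInvertible := by
    have h1 : HasFDerivAt (fun γ : C(J, W) => G ((0, x₀), γ))
        (fderiv ℝ G ((0, x₀), γ₀) ∘L .inr ℝ (ℝ × W) C(J, W)) γ₀ :=
      ((hG.differentiable (by simp) _).hasFDerivAt).comp γ₀ (hasFDerivAt_prodMk_right _ _)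
    have h2 : HasFDerivAt (fun γ : C(J, W) => G ((0, x₀), γ))
        (ContinuousLinearMap.id ℝ _) γ₀ := by
      have : (fun γ : C(J, W) => G ((0, x₀), γ)) = fun γ => γ - γ₀ := by
        funext γ
        simp [G, γ₀]
      rw [this]
      exact (hasFDerivAt_id γ₀).sub_const _
    rw [h1.unique h2]
    exact ⟨ContinuousLinearEquiv.refl ℝ _, rfl⟩
  obtain ⟨ψ, hψ⟩ := exists_smooth_implicit hG (0, x₀) γ₀ hinv
  have hG0 : G ((0, x₀), γ₀) = 0 := by simp [G, γ₀]
  rw [hG0] at hψ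
  obtain ⟨S, hS, T, hT, hST⟩ := mem_nhds_prod_iff.1 hψ
  obtain ⟨ε, hε, hεS⟩ := Metric.mem_nhds_iff.1 hS
  obtain ⟨U, hUT, hU, hxU⟩ := mem_nhds_iff.1 hT
  rw [Real.ball_eq_Ioo, zero_sub, zero_add] at hεS
  have hgood : ∀ τ ∈ Ioo (-ε) ε, ∀ x ∈ U, ContDiffAt ℝ ∞ ψ (τ, x) ∧ G ((τ, x), ψ (τ, x)) = 0 :=
    fun τ hτ x hx => hST ⟨hεS hτ, hUT hx⟩
  let pr : ℝ → J := projIcc (-1) 1 (by norm_num)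
  -- `c τ x` extends the solution `ψ (τ, x)` to all real `s`, so that two-sided derivatives exist at
  -- `±1` too.
  let c : ℝ → W → ℝ → W := fun τ x s => x + τ • ∫ σ in (0 : ℝ)..s, f (ψ (τ, x) (pr σ))
  have hc0 : ∀ τ x, c τ x 0 = x := fun τ x => by simp [c]
  have hcψ : ∀ τ ∈ Ioo (-ε) ε, ∀ x ∈ U, ∀ s : J, ψ (τ, x) s = c τ x s := by
    intro τ hτ x hx s
    have h := congrArg (fun g : C(J, W) => g s) (hgood τ hτ x hx).2
    have h' : ψ (τ, x) s - x - τ • primitive W (fc.comp (ψ (τ, x))) s = 0 := h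
    rw [sub_sub, sub_eq_zero] at h'
    exact h'
  have hcd : ∀ τ ∈ Ioo (-ε) ε, ∀ x ∈ U, ∀ s ∈ J, HasDerivAt (c τ x) (τ • f (c τ x s)) s := by
    intro τ hτ x hx s hs
    have hcont : Continuous fun σ : ℝ => f (ψ (τ, x) (pr σ)) :=
      hf.continuous.comp ((ψ (τ, x)).continuous.comp continuous_projIcc)
    have h1 := ((hcont.integral_hasStrictDerivAt 0 s).hasDerivAt.const_smul τ).const_add x
    have h2 : ψ (τ, x) (pr s) = c τ x s := by
      rw [show pr s = ⟨s, hs⟩ from projIcc_of_mem _ hs]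
      exact hcψ τ hτ x hx ⟨s, hs⟩
    rw [h2] at h1
    exact h1
  have h1J : (1 : ℝ) ∈ J := ⟨by norm_num, le_rfl⟩
  let φ : ℝ → W → W := fun t x => ψ (t, x) ⟨1, h1J⟩
  -- Running for time `1` at speed `σ τ` ends where running for time `σ` at speed `τ` does. This is
  -- uniqueness of solutions, and it relies on the global Lipschitz bound.
  have hscale : ∀ τ ∈ Ioo (-ε) ε, ∀ x ∈ U, ∀ σ ∈ J, φ (σ * τ) x = c τ x σ := by
    intro τ hτ x hx σ hσ
    have hστ : σ * τ ∈ Ioo (-ε) ε := by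
      rw [mem_Ioo, ← abs_lt] at hτ ⊢
      rw [abs_mul]
      exact (mul_le_of_le_one_left (abs_nonneg _) (abs_le.2 hσ)).trans_lt hτ
    have hmul : ∀ s ∈ J, σ * s ∈ J := by
      intro s hs
      have h3 : |σ * s| ≤ 1 := by
        rw [abs_mul]
        exact mul_le_one₀ (abs_le.2 hσ) (abs_nonneg _) (abs_le.2 hs)
      exact abs_le.1 h3
    have hu := ODE_solution_unique_of_mem_Icc (v := fun _ y => (σ * τ) • f y)
      (s := fun _ => univ) (K := ‖σ * τ‖₊ * K) (f := c (σ * τ) x) (g := fun s => c τ x (σ * s))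
      (a := -1) (b := 1) (t₀ := 0)
      (fun t _ => ((lipschitzWith_smul (σ * τ)).comp hK).lipschitzOnWith)
      (by norm_num)
      (fun s hs => (hcd _ hστ x hx s hs).continuousAt.continuousWithinAt)
      (fun s hs => hcd _ hστ x hx s (Ioo_subset_Icc_self hs)) (fun _ _ => mem_univ _)
      (fun s hs => by
        have h3 := (hcd τ hτ x hx (σ * s) (hmul s hs)).continuousAt
        exact (ContinuousAt.comp (f := fun s => σ * s) h3
          (continuousAt_const.mul continuousAt_id)).continuousWithinAt)
      (fun s hs => by
        have h3 := (hcd τ hτ x hx (σ * s) (hmul s (Ioo_subset_Icc_self hs))).scomp s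
          ((hasDerivAt_id s).const_mul σ)
        rw [mul_one, smul_smul] at h3
        exact h3)
      (fun _ _ => mem_univ _) (by rw [mul_zero, hc0, hc0])
    have h4 : c (σ * τ) x 1 = c τ x (σ * 1) := hu h1J
    rw [mul_one] at h4
    rw [← h4]
    exact hcψ _ hστ x hx ⟨1, h1J⟩
  have heval : ContDiff ℝ ∞ (fun g : C(J, W) => g ⟨1, h1J⟩) :=
    (ContinuousMap.evalCLM (M := W) ℝ (⟨1, h1J⟩ : J)).contDiff
  refine ⟨ε, hε, U, hU, hxU, φ, ?_, ?_, ?_⟩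
  · rintro ⟨τ, x⟩ ⟨hτ, hx⟩
    exact (heval.contDiffAt.comp (τ, x) (hgood τ hτ x hx).1).contDiffWithinAt
  · intro x hx
    have h0 : (0 : ℝ) ∈ Ioo (-ε) ε := ⟨by linarith, hε⟩
    have h1 := hscale 0 h0 x hx 0 ⟨by norm_num, by norm_num⟩
    rw [mul_zero, hc0] at h1
    exact h1
  · intro x hx t ht
    have ht' : |t| < ε := abs_lt.2 ht
    -- A speed strictly between `|t|` and `ε`: near `t` the flow is then the single curve `c τ x` at
    -- the rescaled time `τ⁻¹ * s`, which can be differentiated.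
    set τ := (|t| + ε) / 2 with hτdef
    have hτ0 : 0 < τ := by have := abs_nonneg t; linarith
    have hτ : τ ∈ Ioo (-ε) ε := ⟨by linarith, by linarith⟩
    have hev : (fun s => φ s x) =ᶠ[𝓝 t] fun s => c τ x (τ⁻¹ * s) := by
      have : ∀ᶠ s in 𝓝 t, |s| < τ :=
        continuous_abs.continuousAt.eventually_lt continuousAt_const (by linarith)
      filter_upwards [this] with s hs
      have h5 : τ⁻¹ * s ∈ J := by
        apply abs_le.1
        rw [abs_mul, abs_inv, abs_of_pos hτ0, inv_mul_le_iff₀ hτ0]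
        linarith
      have h6 := hscale τ hτ x hx _ h5
      rwa [mul_comm τ⁻¹ s, inv_mul_cancel_right₀ hτ0.ne', mul_comm s] at h6
    have h5 : τ⁻¹ * t ∈ J := by
      apply abs_le.1
      rw [abs_mul, abs_inv, abs_of_pos hτ0, inv_mul_le_iff₀ hτ0]
      linarith
    have h7 := (hcd τ hτ x hx _ h5).scomp t ((hasDerivAt_id t).const_mul τ⁻¹)
    rw [mul_one, smul_smul, inv_mul_cancel₀ hτ0.ne', one_smul] at h7
    have h8 := h7.congr_of_eventuallyEq hev
    rwa [← hev.eq_of_nhds] at h8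

/-- A vector field that is smooth on an open subset has smooth local flows there. -/
theorem exists_flow_of_contDiffOn {W : Type u} [NormedAddCommGroup W] [NormedSpace ℝ W]
    [FiniteDimensional ℝ W] {f : W → W} {Ω : Set W} (hΩ : IsOpen Ω) (hf : ContDiffOn ℝ ∞ f Ω)
    {x₀ : W} (hx₀ : x₀ ∈ Ω) :
    ∃ ε > 0, ∃ U ⊆ Ω, IsOpen U ∧ x₀ ∈ U ∧ ∃ φ : ℝ → W → W,
      ContDiffOn ℝ ∞ (fun q : ℝ × W => φ q.1 q.2) (Ioo (-ε) ε ×ˢ U) ∧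
      (∀ x ∈ U, φ 0 x = x) ∧
      ∀ x ∈ U, ∀ t ∈ Ioo (-ε) ε,
        φ t x ∈ Ω ∧ HasDerivAt (fun s => φ s x) (f (φ t x)) t := by
  have : CompleteSpace W := FiniteDimensional.complete ℝ W
  obtain ⟨R, hR, hball⟩ := Metric.nhds_basis_closedBall.mem_iff.1 (hΩ.mem_nhds hx₀)
  -- The cut-off field is compactly supported, hence globally Lipschitz, and equals `f` on the ball
  -- of radius `R / 2`.
  let χ : ContDiffBump x₀ := ⟨R / 2, R, half_pos hR, half_lt_self hR⟩
  have hχd : ContDiff ℝ ∞ χ := χ.contDiff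
  have hχs : tsupport χ ⊆ Ω := by rw [χ.tsupport_eq]; exact hball
  have hg : ContDiff ℝ ∞ fun z => χ z • f z := by
    rw [contDiff_iff_contDiffAt]
    intro z
    by_cases hz : z ∈ tsupport χ
    · exact hχd.contDiffAt.smul (hf.contDiffAt (hΩ.mem_nhds (hχs hz)))
    · have : (fun z => χ z • f z) =ᶠ[𝓝 z] fun _ => 0 := by
        filter_upwards [(isClosed_tsupport χ).isOpen_compl.mem_nhds hz] with w hw
        rw [image_eq_zero_of_notMem_tsupport hw, zero_smul]
      exact contDiffAt_const.congr_of_eventuallyEq this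
  have hgc : HasCompactSupport fun z => χ z • f z := χ.hasCompactSupport.smul_right
  obtain ⟨K, hK⟩ := ContDiff.lipschitzWith_of_hasCompactSupport hgc hg (by simp)
  obtain ⟨ε, hε, U, hU, hxU, φ, h1, h2, h3⟩ := exists_flow_of_lipschitz hg hK x₀
  have hcont : ContinuousAt (fun q : ℝ × W => φ q.1 q.2) (0, x₀) :=
    (h1.contDiffAt ((isOpen_Ioo.prod hU).mem_nhds
      ⟨⟨neg_lt_zero.2 hε, hε⟩, hxU⟩)).continuousAt
  -- For short times the flow stays where the cut-off is `1`, so it is a flow of `f` itself.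
  have hnear : ∀ᶠ q : ℝ × W in 𝓝 (0, x₀), φ q.1 q.2 ∈ Metric.closedBall x₀ (R / 2) := by
    refine hcont.preimage_mem_nhds ?_
    change Metric.closedBall x₀ (R / 2) ∈ 𝓝 (φ 0 x₀)
    rw [h2 x₀ hxU]
    exact Metric.closedBall_mem_nhds _ (half_pos hR)
  obtain ⟨S, hS, T, hT, hST⟩ := mem_nhds_prod_iff.1 hnear
  obtain ⟨δ, hδ, hδS⟩ := Metric.mem_nhds_iff.1 hS
  obtain ⟨U', hU'T, hU', hxU'⟩ := mem_nhds_iff.1 hT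
  rw [Real.ball_eq_Ioo, zero_sub, zero_add] at hδS
  refine ⟨min ε δ, lt_min hε hδ, Ω ∩ (U ∩ U'), inter_subset_left, hΩ.inter (hU.inter hU'),
    ⟨hx₀, hxU, hxU'⟩, φ, h1.mono ?_, fun x hx => h2 x hx.2.1, ?_⟩
  · rintro ⟨t, x⟩ ⟨ht, hx⟩
    rw [mem_Ioo, ← abs_lt, lt_min_iff] at ht
    exact ⟨abs_lt.1 ht.1, hx.2.1⟩
  · intro x hx t ht
    rw [mem_Ioo, ← abs_lt, lt_min_iff] at ht
    have hm : φ t x ∈ Metric.closedBall x₀ (R / 2) :=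
      hST (mk_mem_prod (hδS (abs_lt.1 ht.2)) (hU'T hx.2.2))
    refine ⟨hball (Metric.closedBall_subset_closedBall (half_le_self hR.le) hm), ?_⟩
    have h4 := h3 x hx.2.1 t (abs_lt.1 ht.1)
    rwa [χ.one_of_mem_closedBall hm, one_smul] at h4

end Flow

/-! ### Vector fields, curves and exterior derivatives in normed-space-valued charts. -/

section SmoothCharts

variable {V : Type*} [NormedAddCommGroup V] [NormedSpace ℝ V] {H : Type*} [TopologicalSpace H]
  (I : ModelWithCorners ℝ V H) {N : Type*} [TopologicalSpace N] [ChartedSpace H N]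
  {W : Type*} [NormedAddCommGroup W] [NormedSpace ℝ W]

/-- A smooth chart of a manifold with values in an arbitrary normed space. -/
structure IsSmoothChart (c : OpenPartialHomeomorph N W) : Prop where
  contMDiffOn_toFun : ContMDiffOn I 𝓘(ℝ, W) ∞ c c.source
  contMDiffOn_symm : ContMDiffOn 𝓘(ℝ, W) I ∞ c.symm c.target

/-- The derivative of a chart, with values in the normed space. -/
def chartDeriv (c : OpenPartialHomeomorph N W) (p : N) : TangentSpace I p →L[ℝ] W :=
  mfderiv I 𝓘(ℝ, W) c p

/-- The inverse of the derivative of a chart. -/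
def chartDerivInv (c : OpenPartialHomeomorph N W) (p : N) : W →L[ℝ] TangentSpace I p :=
  (chartDeriv I c p).inverse

/-- A vector field read in a chart. -/
def chartField (c : OpenPartialHomeomorph N W) (X : VecField I N) (z : W) : W :=
  chartDeriv I c (c.symm z) (X (c.symm z))

namespace IsSmoothChart
variable {I} {c : OpenPartialHomeomorph N W} (hc : IsSmoothChart I c)
include hc

theorem mdifferentiable : c.MDifferentiable I 𝓘(ℝ, W) :=
  ⟨hc.contMDiffOn_toFun.mdifferentiableOn (by simp), hc.contMDiffOn_symm.mdifferentiableOn (by simp)⟩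

theorem contMDiffAt {p : N} (hp : p ∈ c.source) : ContMDiffAt I 𝓘(ℝ, W) ∞ c p :=
  hc.contMDiffOn_toFun.contMDiffAt (c.open_source.mem_nhds hp)

theorem contMDiffAt_symm {z : W} (hz : z ∈ c.target) : ContMDiffAt 𝓘(ℝ, W) I ∞ c.symm z :=
  hc.contMDiffOn_symm.contMDiffAt (c.open_target.mem_nhds hz)

theorem isInvertible_chartDeriv {p : N} (hp : p ∈ c.source) : (chartDeriv I c p).IsInvertible :=
  ⟨hc.mdifferentiable.mfderiv hp, rfl⟩

theorem chartDeriv_chartDerivInv {p : N} (hp : p ∈ c.source) (w : W) :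
    chartDeriv I c p (chartDerivInv I c p w) = w :=
  congrArg (fun L : W →L[ℝ] W => L w) (hc.isInvertible_chartDeriv hp).self_comp_inverse

theorem chartDerivInv_chartDeriv {p : N} (hp : p ∈ c.source) (v : TangentSpace I p) :
    chartDerivInv I c p (chartDeriv I c p v) = v :=
  congrArg (fun L : TangentSpace I p →L[ℝ] TangentSpace I p => L v)
    (hc.isInvertible_chartDeriv hp).inverse_comp_self

theorem isInvertible_mfderiv_symm {z : W} (hz : z ∈ c.target) :
    (mfderiv 𝓘(ℝ, W) I c.symm z).IsInvertible :=
  ⟨hc.mdifferentiable.symm.mfderiv hz, rfl⟩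

theorem inverse_mfderiv_symm {z : W} (hz : z ∈ c.target) :
    (mfderiv 𝓘(ℝ, W) I c.symm z).inverse = mfderiv I 𝓘(ℝ, W) c (c.symm z) := by
  have h := ContinuousLinearMap.inverse_equiv (hc.mdifferentiable.symm.mfderiv hz)
  exact h

/-- The chart expression is the pull-back of the field along `c.symm`, and pull-back along a local
diffeomorphism preserves smoothness. -/
theorem contDiffOn_chartField [CompleteSpace W] [IsManifold I 1 N] {X : VecField I N}
    (hX : SmoothVecField I X) : ContDiffOn ℝ ∞ (chartField I c X) c.target := by
  intro z hz
  refine ContDiffAt.contDiffWithinAt ?_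
  have h1 := ContMDiffAt.mpullback_vectorField_preimage (hX (c.symm z)) (hc.contMDiffAt_symm hz)
    (hc.isInvertible_mfderiv_symm hz) (by simp)
  have h2 := contMDiffAt_vectorSpace_iff_contDiffAt.1 h1
  refine h2.congr_of_eventuallyEq ?_
  filter_upwards [c.open_target.mem_nhds hz] with w hw
  rw [VectorField.mpullback_apply, hc.inverse_mfderiv_symm hw]
  rfl

theorem contMDiffAt_of_chartField [CompleteSpace V] [IsManifold I 1 N] {X : VecField I N}
    {f : W → W} (hf : ContDiffOn ℝ ∞ f c.target)
    (h : ∀ p ∈ c.source, chartDeriv I c p (X p) = f (c p)) {p : N} (hp : p ∈ c.source) :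
    ContMDiffAt I I.tangent ∞ (fun q : N => (⟨q, X q⟩ : TangentBundle I N)) p := by
  have h0 : ContMDiffAt 𝓘(ℝ, W) 𝓘(ℝ, W).tangent ∞
      (fun z : W => (⟨z, f z⟩ : TangentBundle 𝓘(ℝ, W) W)) (c p) :=
    contMDiffAt_vectorSpace_iff_contDiffAt.2
      (hf.contDiffAt (c.open_target.mem_nhds (c.map_source hp)))
  have h1 := ContMDiffAt.mpullback_vectorField_preimage (f := c) h0 (hc.contMDiffAt hp)
    (hc.isInvertible_chartDeriv hp) (by simp)
  refine h1.congr_of_eventuallyEq ?_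
  filter_upwards [c.open_source.mem_nhds hp] with q hq
  have h2 : X q = VectorField.mpullback I 𝓘(ℝ, W) c f q := by
    change X q = chartDerivInv I c q (f (c q))
    rw [← h q hq, hc.chartDerivInv_chartDeriv hq]
  rw [h2]

theorem hasDerivAt_comp {γ : ℝ → N} {t : ℝ} {v : TangentSpace I (γ t)} (ht : γ t ∈ c.source)
    (hγ : HasMFDerivAt 𝓘(ℝ, ℝ) I γ t ((1 : ℝ →L[ℝ] ℝ).smulRight v)) :
    HasDerivAt (fun s => c (γ s)) (chartDeriv I c (γ t) v) t := by
  have h1 := (hc.mdifferentiable.mdifferentiableAt ht).hasMFDerivAt.comp t hγ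
  have h2 : HasFDerivAt (fun s => c (γ s))
      ((chartDeriv I c (γ t)).comp ((1 : ℝ →L[ℝ] ℝ).smulRight v)) t :=
    hasMFDerivAt_iff_hasFDerivAt.1 h1
  refine h2.hasDerivAt.congr_deriv ?_
  change chartDeriv I c (γ t) ((1 : ℝ) • v) = _
  rw [one_smul]

theorem hasMFDerivAt_of_hasDerivAt {γ : ℝ → N} {t : ℝ} {v : TangentSpace I (γ t)}
    (hγ : ∀ᶠ s in 𝓝 t, γ s ∈ c.source)
    (h : HasDerivAt (fun s => c (γ s)) (chartDeriv I c (γ t) v) t) :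
    HasMFDerivAt 𝓘(ℝ, ℝ) I γ t ((1 : ℝ →L[ℝ] ℝ).smulRight v) := by
  have ht := hγ.self_of_nhds
  have h1 : HasMFDerivAt 𝓘(ℝ, ℝ) 𝓘(ℝ, W) (fun s => c (γ s)) t
      ((1 : ℝ →L[ℝ] ℝ).smulRight (chartDeriv I c (γ t) v)) :=
    hasMFDerivAt_iff_hasFDerivAt.2 h.hasFDerivAt
  have h2 := (hc.mdifferentiable.mdifferentiableAt_symm (c.map_source ht)).hasMFDerivAt.comp t h1
  have h3 : (c.symm ∘ fun s => c (γ s)) =ᶠ[𝓝 t] γ := hγ.mono fun s hs => c.left_inv hs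
  have h4 := h2.congr_of_eventuallyEq h3.symm
  refine h4.congr_mfderiv ?_
  refine ContinuousLinearMap.ext fun r => ?_
  have h5 := hc.mdifferentiable.symm_comp_deriv ht
  have h6 := congrArg (fun L : TangentSpace I (γ t) →L[ℝ] TangentSpace I (γ t) => L ((show ℝ from r) • v)) h5
  refine Eq.trans ?_ h6
  change mfderiv 𝓘(ℝ, W) I c.symm (c (γ t)) ((show ℝ from r) • chartDeriv I c (γ t) v) =
    mfderiv 𝓘(ℝ, W) I c.symm (c (γ t)) (chartDeriv I c (γ t) ((show ℝ from r) • v))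
  rw [map_smul (chartDeriv I c (γ t))]

/-- The exterior derivative can be computed in any smooth chart. -/
theorem mextDeriv_eq [I.Boundaryless] [IsManifold I ∞ N] {k : ℕ} {α : DiffForm I N k}
    {τ : W → W [⋀^Fin k]→L[ℝ] ℝ} {p : N} (hp : p ∈ c.source) (hτ : DifferentiableAt ℝ τ (c p))
    (hα : ∀ᶠ q in 𝓝 p, α q = (τ (c q)).compContinuousLinearMap (chartDeriv I c q)) :
    mextDeriv I α p = (extDeriv τ (c p)).compContinuousLinearMap (chartDeriv I c p) := by
  set x := extChartAt I p with hx
  have hxt : x.target ∈ 𝓝 (x p) := extChartAt_target_mem_nhds p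
  have hxs : ∀ z ∈ x.target, ContMDiffAt 𝓘(ℝ, V) I ∞ x.symm z := fun z hz =>
    (contMDiffOn_extChartAt_symm p).contMDiffAt ((isOpen_extChartAt_target p).mem_nhds hz)
  have hx0 : x.symm (x p) = p := extChartAt_to_inv p
  have hcont : ContinuousAt x.symm (x p) := (hxs _ (mem_of_mem_nhds hxt)).continuousAt
  have hsrc : ∀ᶠ z in 𝓝 (x p), x.symm z ∈ c.source :=
    hcont.preimage_mem_nhds (by rw [hx0]; exact c.open_source.mem_nhds hp)
  have hα' : ∀ᶠ z in 𝓝 (x p), α (x.symm z) =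
      (τ (c (x.symm z))).compContinuousLinearMap (chartDeriv I c (x.symm z)) := by
    have h : Filter.Tendsto x.symm (𝓝 (x p)) (𝓝 p) := by
      have := hcont.tendsto
      rwa [hx0] at this
    exact h.eventually hα
  -- `g` is the transition from the preferred chart at `p`, used by `mextDeriv`, to `c`. The form in
  -- the preferred chart is the pull-back of `τ` by `g`, and the exterior derivative commutes with
  -- pull-backs.
  let g : V → W := fun z => c (x.symm z)
  have hg : ContDiffAt ℝ ∞ g (x p) := by
    rw [← contMDiffAt_iff_contDiffAt]
    refine ContMDiffAt.comp (x p) (g := c) ?_ (hxs _ (mem_of_mem_nhds hxt))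
    rw [hx0]; exact hc.contMDiffAt hp
  have hfd : ∀ z ∈ x.target, x.symm z ∈ c.source → ∀ v : V,
      chartDeriv I c (x.symm z) (mfderiv 𝓘(ℝ, V) I x.symm z v) = fderiv ℝ g z v := by
    intro z hz hzc v
    have h1 := mfderiv_comp (I := 𝓘(ℝ, V)) z (hc.mdifferentiable.mdifferentiableAt hzc)
      ((hxs z hz).mdifferentiableAt (by simp))
    rw [mfderiv_eq_fderiv] at h1
    exact (congrArg (fun L : V →L[ℝ] W => L v) h1).symm
  have hform : (fun z : V => ContinuousAlternatingMap.compContinuousLinearMap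
        (α (x.symm z)) (mfderivWithin 𝓘(ℝ, V) I x.symm (range I) z) : V → V [⋀^Fin k]→L[ℝ] ℝ)
      =ᶠ[𝓝 (x p)] fun z => (τ (g z)).compContinuousLinearMap (fderiv ℝ g z) := by
    filter_upwards [hxt, hsrc, hα'] with z hz hzc hza
    rw [ModelWithCorners.range_eq_univ, mfderivWithin_univ, hza]
    ext v
    change τ (g z) (fun i => chartDeriv I c (x.symm z) (mfderiv 𝓘(ℝ, V) I x.symm z (v i))) =
      τ (g z) (fun i => fderiv ℝ g z (v i))
    simp only [hfd z hz hzc]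
  have hgx : g (x p) = c p := congrArg c hx0
  have hpull := extDeriv_pullback (f := g) (x := x p) (r := 2)
    (by rw [hgx]; exact hτ) (hg.of_le ENat.LEInfty.out) (by simp)
  have hmain : (extDerivWithin (fun z : V => ContinuousAlternatingMap.compContinuousLinearMap
        (α (x.symm z)) (mfderivWithin 𝓘(ℝ, V) I x.symm (range I) z)) (range I) (x p) :
        V [⋀^Fin (k + 1)]→L[ℝ] ℝ) =
      (extDeriv τ (c p)).compContinuousLinearMap (fderiv ℝ g (x p)) := by
    rw [hform.extDerivWithin_eq_nhds, ModelWithCorners.range_eq_univ, extDerivWithin_univ, hpull,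
      hgx]
  have hchain : ∀ v : TangentSpace I p,
      fderiv ℝ g (x p) (mfderiv I 𝓘(ℝ, V) x p v) = chartDeriv I c p v := by
    intro v
    have hxd : MDifferentiableAt I 𝓘(ℝ, V) x p :=
      mdifferentiableAt_extChartAt (mem_chart_source H p)
    have hgd : MDifferentiableAt 𝓘(ℝ, V) 𝓘(ℝ, W) g (x p) :=
      mdifferentiableAt_iff_differentiableAt.2 (hg.differentiableAt (by simp))
    have h1 := mfderiv_comp (I := I) p hgd hxd
    have h2 : (g ∘ x) =ᶠ[𝓝 p] c := by
      filter_upwards [extChartAt_source_mem_nhds (I := I) p] with q hq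
      exact congrArg c (x.left_inv hq)
    rw [h2.mfderiv_eq, mfderiv_eq_fderiv] at h1
    exact (congrArg (fun L : TangentSpace I p →L[ℝ] W => L v) h1).symm
  ext v
  have h3 := congrArg (fun β : V [⋀^Fin (k + 1)]→L[ℝ] ℝ =>
    β (fun i => mfderiv I 𝓘(ℝ, V) x p (v i))) hmain
  refine Eq.trans h3 ?_
  change extDeriv τ (c p) (fun i => fderiv ℝ g (x p) (mfderiv I 𝓘(ℝ, V) x p (v i))) =
    extDeriv τ (c p) (fun i => chartDeriv I c p (v i))
  simp only [hchain]

end IsSmoothChart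
end SmoothCharts

/-! ### The Hamiltonian equation on the model space. -/

section ModelForms
variable {d n : ℕ}

/-- The form underlying an element of the model fibre. -/
def formVal : FormModel d n →L[ℝ] (BaseCoord d × FibCoord n) [⋀^Fin (d + 1)]→L[ℝ] ℝ :=
  (Lambda2Model d n).subtypeL

/-- The retraction of the space of all forms onto the model fibre. -/
def formRetract : ((BaseCoord d × FibCoord n) [⋀^Fin (d + 1)]→L[ℝ] ℝ) →L[ℝ] FormModel d n :=
  LinearMap.toContinuousLinearMap (retract (Lambda2Model d n))

theorem formVal_injective : Function.Injective (formVal (d := d) (n := n)) :=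
  Subtype.val_injective

theorem formVal_vertical (a : FormModel d n) {v : Fin (d + 1) → BaseCoord d × FibCoord n}
    {i j : Fin (d + 1)} (hij : i ≠ j) (hi : (v i).1 = 0) (hj : (v j).1 = 0) : formVal a v = 0 :=
  a.2 v i j hij hi hj

theorem formVal_formRetract {ζ : (BaseCoord d × FibCoord n) [⋀^Fin (d + 1)]→L[ℝ] ℝ}
    (h : ∀ v : Fin (d + 1) → BaseCoord d × FibCoord n, ∀ i j, i ≠ j →
      (v i).1 = 0 → (v j).1 = 0 → ζ v = 0) : formVal (formRetract ζ) = ζ :=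
  retract_of_mem (Lambda2Model d n) h

/-- Minus the derivation of the model forms induced by an endomorphism `L`:
`a ↦ -∑ i, a(…, L vᵢ, …)`. -/
def lieAction : ((BaseCoord d × FibCoord n) →L[ℝ] (BaseCoord d × FibCoord n)) →ₗ[ℝ]
    FormModel d n →ₗ[ℝ] FormModel d n :=
  -- For a general `L` the derivation may leave the model fibre. The linear retraction makes the
  -- expression bilinear in all `L` and `a`, and it changes nothing when `L` preserves vertical
  -- vectors.
  LinearMap.mk₂ ℝ (fun L a => -formRetract
      ((formVal a).fderivCompContinuousLinearMap (.id ℝ (BaseCoord d × FibCoord n)) L))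
    (fun L L' a => by simp only [map_add, neg_add])
    (fun c L a => by simp only [map_smul, smul_neg])
    (fun L a b => by
      rw [← neg_add, ← map_add]
      congr 2
      ext v
      simp [ContinuousAlternatingMap.fderivCompContinuousLinearMap_apply, Finset.sum_add_distrib])
    (fun c L a => by
      rw [smul_neg, ← map_smul]
      congr 2
      ext v
      simp [ContinuousAlternatingMap.fderivCompContinuousLinearMap_apply, Finset.mul_sum])

theorem fderivComp_id_apply (ζ : (BaseCoord d × FibCoord n) [⋀^Fin (d + 1)]→L[ℝ] ℝ)
    (L : (BaseCoord d × FibCoord n) →L[ℝ] (BaseCoord d × FibCoord n))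
    (v : Fin (d + 1) → BaseCoord d × FibCoord n) :
    ζ.fderivCompContinuousLinearMap (.id ℝ (BaseCoord d × FibCoord n)) L v =
      ∑ i, ζ (Function.update v i (L (v i))) := by
  rw [ContinuousAlternatingMap.fderivCompContinuousLinearMap_apply]
  refine Finset.sum_congr rfl fun i _ => congrArg ζ (funext fun j => ?_)
  rcases eq_or_ne j i with rfl | h
  · simp
  · simp [h]

/-- Replacing `vᵢ` by `L vᵢ` keeps vertical arguments vertical, so every term of the derivation
still vanishes on two vertical vectors and the retraction is the identity on it. -/
theorem formVal_lieAction {L : (BaseCoord d × FibCoord n) →L[ℝ] (BaseCoord d × FibCoord n)}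
    (hL : ∀ v, v.1 = 0 → (L v).1 = 0) (a : FormModel d n)
    (v : Fin (d + 1) → BaseCoord d × FibCoord n) :
    formVal (lieAction L a) v = -∑ i, formVal a (Function.update v i (L (v i))) := by
  have h : formVal (lieAction L a) =
      -((formVal a).fderivCompContinuousLinearMap (.id ℝ (BaseCoord d × FibCoord n)) L) := by
    change formVal (-formRetract _) = _
    rw [map_neg, formVal_formRetract]
    intro v i j hij hi hj
    rw [fderivComp_id_apply]
    refine Finset.sum_eq_zero fun k _ => formVal_vertical a hij ?_ ?_
    · rcases eq_or_ne i k with rfl | h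
      · rw [Function.update_self]; exact hL _ hi
      · rw [Function.update_of_ne h]; exact hi
    · rcases eq_or_ne j k with rfl | h
      · rw [Function.update_self]; exact hL _ hj
      · rw [Function.update_of_ne h]; exact hj
  rw [h, ContinuousAlternatingMap.neg_apply, fderivComp_id_apply]

theorem contDiff_lieAction : ContDiff ℝ ∞
    (fun q : ((BaseCoord d × FibCoord n) →L[ℝ] (BaseCoord d × FibCoord n)) × FormModel d n =>
      lieAction q.1 q.2) := by
  let Φ := (lieAction (d := d) (n := n)).toContinuousBilinearMap
  exact (Φ.contDiff.comp contDiff_fst).clm_apply contDiff_snd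

/-- The form `v ↦ det (vᵢ.1 + l vᵢ.2 e₀)`. -/
def shearedDet (l : FibCoord n →L[ℝ] ℝ) :
    (BaseCoord d × FibCoord n) [⋀^Fin (d + 1)]→L[ℝ] ℝ :=
  let L : (BaseCoord d × FibCoord n) →L[ℝ] (Fin (d + 1) → ℝ) :=
    ContinuousLinearMap.pi fun μ => (EuclideanSpace.proj μ).comp (ContinuousLinearMap.fst ℝ _ _) +
      (Pi.single (0 : Fin (d + 1)) (1 : ℝ) : Fin (d + 1) → ℝ) μ •
        l.comp (ContinuousLinearMap.snd ℝ _ _)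
  { (Matrix.detRowAlternating (R := ℝ) (n := Fin (d + 1))).compLinearMap L.toLinearMap with
    cont := by
      change Continuous fun v : Fin (d + 1) → BaseCoord d × FibCoord n =>
        Matrix.det (Matrix.of fun i => L (v i))
      exact Continuous.matrix_det (continuous_pi fun i => L.continuous.comp (continuous_apply i)) }

theorem shearedDet_apply (l : FibCoord n →L[ℝ] ℝ) (v : Fin (d + 1) → BaseCoord d × FibCoord n) :
    shearedDet l v = Matrix.det (Matrix.of fun i μ =>
      (v i).1 μ + (Pi.single (0 : Fin (d + 1)) (1 : ℝ) : Fin (d + 1) → ℝ) μ * l (v i).2) := rfl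

/-- The rows of two vertical arguments are both multiples of `e₀`, hence dependent. The explicit
relation has coefficients `l (v j).2` and `-l (v i).2`; if both vanish, row `i` is already zero. -/
theorem shearedDet_vertical (l : FibCoord n →L[ℝ] ℝ)
    (v : Fin (d + 1) → BaseCoord d × FibCoord n) (i j : Fin (d + 1)) (hij : i ≠ j)
    (hi : (v i).1 = 0) (hj : (v j).1 = 0) : shearedDet l v = 0 := by
  rw [shearedDet_apply]
  by_cases h : l (v i).2 = 0 ∧ l (v j).2 = 0
  · exact Matrix.det_eq_zero_of_row_eq_zero i fun μ => by simp [hi, h.1]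
  · refine Matrix.exists_vecMul_eq_zero_iff.1
      ⟨Pi.single i (l (v j).2) - Pi.single j (l (v i).2), fun h0 => h ?_, ?_⟩
    · have h1 := congrFun h0 i
      have h2 := congrFun h0 j
      simp [hij, hij.symm] at h1 h2
      exact ⟨h2, h1⟩
    · rw [Matrix.sub_vecMul, Matrix.single_vecMul, Matrix.single_vecMul]
      ext μ
      simp [hi, hj]
      ring

/-- The model forms separate vectors. -/
theorem eq_zero_of_forall_formVal (w : BaseCoord d × FibCoord n)
    (h : ∀ (a : FormModel d n) (v : Fin (d + 1) → BaseCoord d × FibCoord n) (i : Fin (d + 1)),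
      v i = w → formVal a v = 0) : w = 0 := by
  have key : ∀ (l : FibCoord n →L[ℝ] ℝ) (μ : Fin (d + 1)),
      w.1 μ + (Pi.single (0 : Fin (d + 1)) (1 : ℝ) : Fin (d + 1) → ℝ) μ * l w.2 = 0 := by
    intro l μ
    -- With `w` in slot `μ` of the standard horizontal frame, the matrix is the identity with row
    -- `μ` replaced, so its determinant is the `μ`-th entry of that row. Taking `l = 0` then kills
    -- `w.1`; taking `l` a coordinate and `μ = 0` kills `w.2`.
    have h1 := h (formRetract (shearedDet l))
      (Function.update (fun ν => (EuclideanSpace.single ν 1, 0)) μ w) μ (by simp)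
    rw [formVal_formRetract (shearedDet_vertical l), shearedDet_apply] at h1
    have h2 : (Matrix.of fun i ν =>
        (Function.update (fun ν : Fin (d + 1) =>
          ((EuclideanSpace.single ν 1, 0) : BaseCoord d × FibCoord n)) μ w i).1 ν +
        (Pi.single (0 : Fin (d + 1)) (1 : ℝ) : Fin (d + 1) → ℝ) ν *
        l (Function.update (fun ν : Fin (d + 1) =>
          ((EuclideanSpace.single ν 1, 0) : BaseCoord d × FibCoord n)) μ w i).2) =
        (1 : Matrix (Fin (d + 1)) (Fin (d + 1)) ℝ).updateRow μ (fun ν => w.1 ν +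
          (Pi.single (0 : Fin (d + 1)) (1 : ℝ) : Fin (d + 1) → ℝ) ν * l w.2) := by
      ext i ν
      rcases eq_or_ne i μ with rfl | hi
      · simp
      · simp [hi, Matrix.one_apply, Pi.single_apply, eq_comm]
    rw [h2, ← Matrix.cramer_transpose_apply, Matrix.transpose_one, Matrix.cramer_one] at h1
    exact h1
  have h1 : w.1 = 0 := by
    ext μ
    simpa using key 0 μ
  refine Prod.ext h1 ?_
  ext A
  simpa [h1] using key (EuclideanSpace.proj A) 0

/-- Replacing an argument of an alternating form, in terms of its first argument. -/
theorem neg_one_pow_mul_cons_removeNth {U : Type*} [NormedAddCommGroup U] [NormedSpace ℝ U] {k : ℕ}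
    (ζ : U [⋀^Fin (k + 1)]→L[ℝ] ℝ) (v : Fin (k + 1) → U) (i : Fin (k + 1)) (u : U) :
    (-1 : ℝ) ^ (i : ℕ) * ζ (Fin.cons u (i.removeNth v)) = ζ (Function.update v i u) := by
  have h := ζ.map_insertNth i u (i.removeNth v)
  rw [Fin.insertNth_removeNth, zsmul_eq_mul, Int.cast_pow, Int.cast_neg, Int.cast_one] at h
  rw [h]
  rfl

/-- The tautological form in coordinates. -/
def modelTheta (p : (BaseCoord d × FibCoord n) × FormModel d n) :
    ((BaseCoord d × FibCoord n) × FormModel d n) [⋀^Fin (d + 1)]→L[ℝ] ℝ :=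
  (formVal p.2).compContinuousLinearMap (ContinuousLinearMap.fst ℝ _ _)

/-- The form `ζ ↦ ζ(f, ·, …, ·)` in coordinates. -/
def modelGamma (f : BaseCoord d × FibCoord n → BaseCoord d × FibCoord n)
    (p : (BaseCoord d × FibCoord n) × FormModel d n) :
    ((BaseCoord d × FibCoord n) × FormModel d n) [⋀^Fin d]→L[ℝ] ℝ :=
  ((formVal p.2).curryLeft (f p.1)).compContinuousLinearMap (ContinuousLinearMap.fst ℝ _ _)

theorem hasFDerivAt_modelTheta (p : (BaseCoord d × FibCoord n) × FormModel d n) :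
    HasFDerivAt modelTheta
      ((ContinuousAlternatingMap.compContinuousLinearMapCLM (ContinuousLinearMap.fst ℝ
        (BaseCoord d × FibCoord n) (FormModel d n))).comp
          (formVal.comp (ContinuousLinearMap.snd ℝ _ _))) p :=
by
  let P : ((BaseCoord d × FibCoord n) [⋀^Fin (d + 1)]→L[ℝ] ℝ) →L[ℝ]
      ((BaseCoord d × FibCoord n) × FormModel d n) [⋀^Fin (d + 1)]→L[ℝ] ℝ :=
    ContinuousAlternatingMap.compContinuousLinearMapCLM (F := ℝ) (ι := Fin (d + 1))
      (ContinuousLinearMap.fst ℝ (BaseCoord d × FibCoord n) (FormModel d n))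
  have h : HasFDerivAt (fun q : (BaseCoord d × FibCoord n) × FormModel d n => formVal q.2)
      (formVal.comp (ContinuousLinearMap.snd ℝ _ _)) p :=
    HasFDerivAt.comp p formVal.hasFDerivAt hasFDerivAt_snd
  exact P.hasFDerivAt.comp p h

/-- `modelTheta` is linear in the form component and independent of the base point, so
differentiating along `u i` just substitutes the form part of `u i`. -/
theorem extDeriv_modelTheta_apply (p : (BaseCoord d × FibCoord n) × FormModel d n)
    (u : Fin (d + 2) → (BaseCoord d × FibCoord n) × FormModel d n) :
    extDeriv modelTheta p u =
      ∑ i : Fin (d + 2), (-1 : ℝ) ^ (i : ℕ) * formVal (u i).2 (i.removeNth fun j => (u j).1) := by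
  rw [extDeriv_apply (hasFDerivAt_modelTheta p).differentiableAt]
  refine Finset.sum_congr rfl fun i _ => ?_
  have h := ((ContinuousAlternatingMap.apply ℝ ((BaseCoord d × FibCoord n) × FormModel d n) ℝ
    (i.removeNth u)).hasFDerivAt.comp p (hasFDerivAt_modelTheta p)).fderiv
  rw [zsmul_eq_mul, Int.cast_pow, Int.cast_neg, Int.cast_one]
  refine congrArg ((-1 : ℝ) ^ (i : ℕ) * ·) ?_
  exact congrArg (fun L : ((BaseCoord d × FibCoord n) × FormModel d n) →L[ℝ] ℝ => L (u i)) h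

theorem hasFDerivAt_clm_apply_comp {A U Z : Type*} [NormedAddCommGroup A] [NormedSpace ℝ A]
    [NormedAddCommGroup U] [NormedSpace ℝ U] [NormedAddCommGroup Z] [NormedSpace ℝ Z]
    (C : A →L[ℝ] U →L[ℝ] Z) {f : U → U} {p : U × A} (hf : DifferentiableAt ℝ f p.1) :
    HasFDerivAt (fun q : U × A => C q.2 (f q.1))
      ((C p.2).comp ((fderiv ℝ f p.1).comp (ContinuousLinearMap.fst ℝ U A)) +
        (C.comp (ContinuousLinearMap.snd ℝ U A)).flip (f p.1)) p :=
  (HasFDerivAt.comp p C.hasFDerivAt hasFDerivAt_snd).clm_apply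
    (hf.hasFDerivAt.comp p hasFDerivAt_fst)

theorem hasFDerivAt_modelGamma {f : BaseCoord d × FibCoord n → BaseCoord d × FibCoord n}
    {p : (BaseCoord d × FibCoord n) × FormModel d n} (hf : DifferentiableAt ℝ f p.1) :
    ∃ D : (BaseCoord d × FibCoord n) × FormModel d n →L[ℝ]
        ((BaseCoord d × FibCoord n) × FormModel d n) [⋀^Fin d]→L[ℝ] ℝ, HasFDerivAt (modelGamma f) D p ∧ ∀ u v, D u v =
      formVal u.2 (Fin.cons (f p.1) fun j => (v j).1) +
        formVal p.2 (Fin.cons (fderiv ℝ f p.1 u.1) fun j => (v j).1) := by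
  let C : FormModel d n →L[ℝ] (BaseCoord d × FibCoord n) →L[ℝ]
      (BaseCoord d × FibCoord n) [⋀^Fin d]→L[ℝ] ℝ :=
    (ContinuousAlternatingMap.curryLeftLI (𝕜 := ℝ)).toContinuousLinearMap.comp formVal
  let P : ((BaseCoord d × FibCoord n) [⋀^Fin d]→L[ℝ] ℝ) →L[ℝ]
      ((BaseCoord d × FibCoord n) × FormModel d n) [⋀^Fin d]→L[ℝ] ℝ :=
    ContinuousAlternatingMap.compContinuousLinearMapCLM (F := ℝ) (ι := Fin d)
      (ContinuousLinearMap.fst ℝ (BaseCoord d × FibCoord n) (FormModel d n))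
  have h2 := hasFDerivAt_clm_apply_comp C hf
  have h3 := P.hasFDerivAt.comp p h2
  refine ⟨_, h3, fun u v => ?_⟩
  rw [add_comm (formVal u.2 _)]
  rfl

theorem extDeriv_modelGamma_apply {f : BaseCoord d × FibCoord n → BaseCoord d × FibCoord n}
    {p : (BaseCoord d × FibCoord n) × FormModel d n} (hf : DifferentiableAt ℝ f p.1)
    (u : Fin (d + 1) → (BaseCoord d × FibCoord n) × FormModel d n) :
    extDeriv (modelGamma f) p u =
      ∑ i : Fin (d + 1), (-1 : ℝ) ^ (i : ℕ) * (formVal (u i).2 (Fin.cons (f p.1) (i.removeNth fun j => (u j).1)) +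
        formVal p.2 (Fin.cons (fderiv ℝ f p.1 (u i).1) (i.removeNth fun j => (u j).1))) := by
  obtain ⟨D, hD, hDv⟩ := hasFDerivAt_modelGamma hf
  rw [extDeriv_apply hD.differentiableAt]
  refine Finset.sum_congr rfl fun i _ => ?_
  have h := ((ContinuousAlternatingMap.apply ℝ ((BaseCoord d × FibCoord n) × FormModel d n) ℝ
    (i.removeNth u)).hasFDerivAt.comp p hD).fderiv
  rw [zsmul_eq_mul, Int.cast_pow, Int.cast_neg, Int.cast_one]
  refine congrArg ((-1 : ℝ) ^ (i : ℕ) * ·) ?_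
  refine Eq.trans (congrArg
    (fun L : ((BaseCoord d × FibCoord n) × FormModel d n) →L[ℝ] ℝ => L (u i)) h) ?_
  exact hDv (u i) (i.removeNth u)

/-- The Hamiltonian equation in coordinates. -/
theorem model_hamiltonian_iff {f : BaseCoord d × FibCoord n → BaseCoord d × FibCoord n}
    {p : (BaseCoord d × FibCoord n) × FormModel d n} (hf : DifferentiableAt ℝ f p.1)
    (hv : ∀ v : BaseCoord d × FibCoord n, v.1 = 0 → (fderiv ℝ f p.1 v).1 = 0)
    (w : (BaseCoord d × FibCoord n) × FormModel d n) :
    (∀ u : Fin (d + 1) → (BaseCoord d × FibCoord n) × FormModel d n,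
      -extDeriv modelTheta p (Fin.cons w u) = extDeriv (modelGamma f) p u) ↔
    w = (f p.1, lieAction (fderiv ℝ f p.1) p.2) := by
  -- Collecting terms separates the unknowns: the error in `w.2` meets only the base parts of `u`,
  -- and the error in `w.1` is fed into their form parts. The alternating sum of the `Df` terms is
  -- `-lieAction`.
  have hexp : ∀ u : Fin (d + 1) → (BaseCoord d × FibCoord n) × FormModel d n,
      (-extDeriv modelTheta p (Fin.cons w u) = extDeriv (modelGamma f) p u) ↔
      formVal (w.2 - lieAction (fderiv ℝ f p.1) p.2) (fun j => (u j).1) =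
        ∑ i : Fin (d + 1), (-1 : ℝ) ^ (i : ℕ) *
          formVal (u i).2 (Fin.cons (w.1 - f p.1) (i.removeNth fun j => (u j).1)) := by
    intro u
    have hrem : ∀ i : Fin (d + 1), (i.succ.removeNth fun j =>
        ((Fin.cons w u : Fin (d + 2) → (BaseCoord d × FibCoord n) × FormModel d n) j).1) =
        Fin.cons w.1 (i.removeNth fun j => (u j).1) := by
      intro i
      funext j
      refine Fin.cases ?_ (fun k => ?_) j
      · simp [Fin.removeNth]
      · simp [Fin.removeNth]
    have hsub : ∀ i : Fin (d + 1),
        formVal (u i).2 (Fin.cons (w.1 - f p.1) (i.removeNth fun j => (u j).1)) =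
        formVal (u i).2 (Fin.cons w.1 (i.removeNth fun j => (u j).1)) -
        formVal (u i).2 (Fin.cons (f p.1) (i.removeNth fun j => (u j).1)) := by
      intro i
      exact congrArg (fun ζ : (BaseCoord d × FibCoord n) [⋀^Fin d]→L[ℝ] ℝ =>
        ζ (i.removeNth fun j => (u j).1)) (map_sub ((formVal (u i).2).curryLeft) w.1 (f p.1))
    rw [extDeriv_modelTheta_apply, extDeriv_modelGamma_apply hf, Fin.sum_univ_succ, map_sub,
      ContinuousAlternatingMap.sub_apply, formVal_lieAction hv]
    simp only [hrem, hsub, mul_add, mul_sub, Finset.sum_add_distrib, Finset.sum_sub_distrib,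
      neg_one_pow_mul_cons_removeNth, Fin.val_succ, pow_succ, Fin.cons_succ, Fin.cons_zero,
      Fin.val_zero, pow_zero, one_mul, mul_neg, mul_one, neg_mul, Finset.sum_neg_distrib]
    have h0 : ((0 : Fin (d + 2)).removeNth fun j =>
        ((Fin.cons w u : Fin (d + 2) → (BaseCoord d × FibCoord n) × FormModel d n) j).1) =
        fun j => (u j).1 := by
      funext j
      simp [Fin.removeNth]
    rw [h0]
    constructor <;> intro h <;> linarith
  simp only [hexp]
  constructor
  · intro h
    -- Vectors without form part make the right-hand side vanish.
    have h2 : w.2 - lieAction (fderiv ℝ f p.1) p.2 = 0 := by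
      apply formVal_injective
      rw [map_zero]
      ext v
      have := h fun i => (v i, 0)
      simpa using this
    -- Giving a form part `a` to the `i`-th vector only leaves one term, `a` with `w.1 - f p.1` in
    -- slot `i`; model forms separate vectors.
    have h1 : w.1 - f p.1 = 0 := by
      refine eq_zero_of_forall_formVal _ fun a v i hi => ?_
      have := h (Function.update (fun j => (v j, 0)) i (v i, a))
      rw [h2, map_zero, ContinuousAlternatingMap.coe_zero, Pi.zero_apply,
        Finset.sum_eq_single i (fun j _ hj => by simp [hj]) (by simp),
        neg_one_pow_mul_cons_removeNth, Function.update_self, ← hi] at this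
      rw [this]
      congr 1
      funext j
      rcases eq_or_ne j i with rfl | hj
      · simp
      · simp [hj]
    exact Prod.ext (sub_eq_zero.1 h1) (sub_eq_zero.1 h2)
  · rintro rfl u
    have : ∀ v : Fin d → BaseCoord d × FibCoord n, ∀ a : FormModel d n,
        formVal a (Fin.cons 0 v) = 0 := fun v a => (formVal a).map_coord_zero 0 rfl
    simp [this]

end ModelForms

section ModelLift
variable {d n : ℕ}

/-- The canonical lift to `V × A` of a vector field of the model space `V`. -/
def modelLift (f : BaseCoord d × FibCoord n → BaseCoord d × FibCoord n)
    (z : (BaseCoord d × FibCoord n) × FormModel d n) :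
    (BaseCoord d × FibCoord n) × FormModel d n :=
  (f z.1, lieAction (fderiv ℝ f z.1) z.2)

theorem contDiffOn_modelLift {f : BaseCoord d × FibCoord n → BaseCoord d × FibCoord n}
    {Ω : Set (BaseCoord d × FibCoord n)} (hΩ : IsOpen Ω) (hf : ContDiffOn ℝ ∞ f Ω)
    {S : Set ((BaseCoord d × FibCoord n) × FormModel d n)} (hS : MapsTo Prod.fst S Ω) :
    ContDiffOn ℝ ∞ (modelLift f) S := by
  have h2 : ContDiffOn ℝ ∞ (fderiv ℝ f) Ω := hf.fderiv_of_isOpen hΩ (by simp)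
  have h3 : ContDiffOn ℝ ∞ (fun z : (BaseCoord d × FibCoord n) × FormModel d n =>
      fderiv ℝ f z.1) S := h2.comp contDiff_fst.contDiffOn hS
  have h4 : ContDiffOn ℝ ∞ (fun z : (BaseCoord d × FibCoord n) × FormModel d n => f z.1) S :=
    hf.comp contDiff_fst.contDiffOn hS
  have h5 : ContDiffOn ℝ ∞ (fun z : (BaseCoord d × FibCoord n) × FormModel d n =>
      (fderiv ℝ f z.1, z.2)) S := h3.prodMk contDiff_snd.contDiffOn
  have h6 := contDiff_lieAction.comp_contDiffOn h5
  exact h4.prodMk h6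

end ModelLift

/-! ### The Hamiltonian equation on the multimomentum bundle, read in adapted charts. -/

section TotalCharts
variable {d n : ℕ}
  {M : Type*} [TopologicalSpace M] [ChartedSpace (BaseCoord d) M]
  {E : Type*} [TopologicalSpace E] [ChartedSpace (TotCoord d n) E]
  {F : Type*} [TopologicalSpace F] [ChartedSpace (FibCoord n) F]
  {B : SmoothFiberBundle d n M E F}

namespace AdaptedChart
variable (e : AdaptedChart B)

theorem isSmoothChart : IsSmoothChart (𝓡 (d + 1 + n)) e.chart :=
  ⟨e.contMDiffOn_chart, e.contMDiffOn_symm⟩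

theorem fst_dchart {y : E} (hy : y ∈ e.chart.source) (v : TangentSpace (𝓡 (d + 1 + n)) y) :
    (e.dchart y v).1 = chartDeriv (𝓡 (d + 1)) e.base (B.proj y)
      (mfderiv (𝓡 (d + 1 + n)) (𝓡 (d + 1)) B.proj y v) := by
  have hb := e.proj_mem y hy
  have hbd : MDifferentiableAt (𝓡 (d + 1)) (𝓡 (d + 1)) e.base (B.proj y) :=
    ((contMDiffOn_of_mem_maximalAtlas e.base_mem _ hb).contMDiffAt
      (e.base.open_source.mem_nhds hb)).mdifferentiableAt (by simp)
  have hp : MDifferentiableAt (𝓡 (d + 1 + n)) (𝓡 (d + 1)) B.proj y :=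
    B.contMDiff_proj.mdifferentiableAt (by simp)
  have hfst : MDifferentiableAt 𝓘(ℝ, BaseCoord d × FibCoord n) (𝓡 (d + 1))
      (Prod.fst : BaseCoord d × FibCoord n → BaseCoord d) (e.chart y) :=
    (differentiable_fst _).mdifferentiableAt
  have h1 := mfderiv_comp (I := 𝓡 (d + 1 + n)) y hbd hp
  have h2 := mfderiv_comp (I := 𝓡 (d + 1 + n)) y hfst (e.mdifferentiableAt_chart hy)
  have e1 : (e.base ∘ B.proj) =ᶠ[𝓝 y] (Prod.fst ∘ e.chart) := by
    filter_upwards [e.chart.open_source.mem_nhds hy] with w hw using (e.fst_chart w hw).symm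
  rw [e1.mfderiv_eq, h2, mfderiv_eq_fderiv, fderiv_fst] at h1
  exact congrArg (fun L : TangentSpace (𝓡 (d + 1 + n)) y →L[ℝ] BaseCoord d => L v) h1

end AdaptedChart
end TotalCharts

section TotalCharts
variable {d n : ℕ}
  {M : Type*} [TopologicalSpace M] [ChartedSpace (BaseCoord d) M] [IsManifold (𝓡 (d + 1)) ∞ M]
  {E : Type*} [TopologicalSpace E] [ChartedSpace (TotCoord d n) E] [IsManifold (𝓡 (d + 1 + n)) ∞ E]
  {F : Type*} [TopologicalSpace F] [ChartedSpace (FibCoord n) F] [IsManifold (𝓡 n) ∞ F]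
  {B : SmoothFiberBundle d n M E F}

namespace AdaptedChart

section
variable (e : AdaptedChart B)

/-- The bundle trivialisation of `𝓜π` induced by an adapted chart. -/
def trivialization : Trivialization (FormModel d n) (π (FormModel d n) (FormFiber B)) :=
  (prebundle B).trivializationOfMemPretrivializationAtlas ⟨e, rfl⟩

instance : MemTrivializationAtlas e.trivialization where
  out := ⟨e.pretrivialization, ⟨e, rfl⟩, rfl⟩

/-- The chart of `𝓜π` induced by an adapted chart. -/
def totalChart : OpenPartialHomeomorph (ExtMultimomentum B)
    ((BaseCoord d × FibCoord n) × FormModel d n) :=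
  e.trivialization.toOpenPartialHomeomorph.trans
    (e.chart.prod (OpenPartialHomeomorph.refl (FormModel d n)))

theorem mem_totalChart_source {q : ExtMultimomentum B} :
    q ∈ e.totalChart.source ↔ q.proj ∈ e.chart.source := by
  constructor
  · rintro ⟨h, -⟩
    exact h
  · intro h
    exact ⟨h, h, mem_univ _⟩

theorem mem_totalChart_target {z : (BaseCoord d × FibCoord n) × FormModel d n}
    (hz : z ∈ e.totalChart.target) : z.1 ∈ e.chart.target := by
  have h := e.totalChart.map_target hz
  have h1 := e.totalChart.right_inv hz
  rw [mem_totalChart_source] at h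
  rw [← h1]
  exact e.chart.map_source h

theorem isSmoothChart_totalChart : IsSmoothChart (extModel d n) e.totalChart where
  contMDiffOn_toFun := by
    have h1 : ContMDiffOn (extModel d n) (extModel d n) ∞ e.trivialization e.trivialization.source :=
      e.trivialization.contMDiffOn
    have h2 : ContMDiffOn (extModel d n)
        𝓘(ℝ, (BaseCoord d × FibCoord n) × FormModel d n) ∞
        (e.chart.prod (OpenPartialHomeomorph.refl (FormModel d n)))
        (e.chart.prod (OpenPartialHomeomorph.refl (FormModel d n))).source := by
      rw [modelWithCornersSelf_prod, ← chartedSpaceSelf_prod]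
      exact e.contMDiffOn_chart.prodMap contMDiffOn_id
    exact h2.comp (h1.mono inter_subset_left) fun q hq => hq.2
  contMDiffOn_symm := by
    have h1 : ContMDiffOn (extModel d n) (extModel d n) ∞
        e.trivialization.toOpenPartialHomeomorph.symm e.trivialization.target :=
      e.trivialization.contMDiffOn_symm
    have h2 : ContMDiffOn 𝓘(ℝ, (BaseCoord d × FibCoord n) × FormModel d n) (extModel d n) ∞
        (e.chart.prod (OpenPartialHomeomorph.refl (FormModel d n))).symm
        (e.chart.prod (OpenPartialHomeomorph.refl (FormModel d n))).target := by
      rw [modelWithCornersSelf_prod, ← chartedSpaceSelf_prod]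
      exact e.contMDiffOn_symm.prodMap contMDiffOn_id
    exact h1.comp (h2.mono inter_subset_left) fun q hq => hq.2

theorem fst_chartDeriv_totalChart {q : ExtMultimomentum B} (hq : q.proj ∈ e.chart.source)
    (v : TangentSpace (extModel d n) q) :
    (chartDeriv (extModel d n) e.totalChart q v).1 = e.dchart q.proj (dproj B q v) := by
  have h0 := (e.isSmoothChart_totalChart.contMDiffAt
    (e.mem_totalChart_source.2 hq)).mdifferentiableAt (by simp)
  have hfst : MDifferentiableAt 𝓘(ℝ, (BaseCoord d × FibCoord n) × FormModel d n)
      𝓘(ℝ, BaseCoord d × FibCoord n)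
      (Prod.fst : (BaseCoord d × FibCoord n) × FormModel d n → _) (e.totalChart q) :=
    (differentiable_fst _).mdifferentiableAt
  have h1 := mfderiv_comp (I := extModel d n) q hfst h0
  have hpr : MDifferentiableAt (extModel d n) (𝓡 (d + 1 + n))
      (TotalSpace.proj : ExtMultimomentum B → E) q :=
    (Bundle.contMDiff_proj (n := ∞) (FormFiber B)).mdifferentiableAt (by simp)
  have h2 := mfderiv_comp (I := extModel d n) q (e.mdifferentiableAt_chart hq) hpr
  have h3 : (Prod.fst ∘ e.totalChart : ExtMultimomentum B → BaseCoord d × FibCoord n) =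
      e.chart ∘ TotalSpace.proj := rfl
  rw [h3, h2, mfderiv_eq_fderiv, fderiv_fst] at h1
  exact (congrArg (fun L : TangentSpace (extModel d n) q →L[ℝ] BaseCoord d × FibCoord n => L v)
    h1).symm

/-- The fibre coordinate of `ζ` is `ζ` precomposed with the inverse chart derivative, which cancels
the chart derivative applied to the projected vectors. -/
theorem tautologicalForm_eq {q : ExtMultimomentum B} (hq : q.proj ∈ e.chart.source) :
    tautologicalForm B q = (modelTheta (e.totalChart q)).compContinuousLinearMap
      (chartDeriv (extModel d n) e.totalChart q) := by
  ext v
  change toForm q.snd (fun i => dproj B q (v i)) = (e.toModel q.proj q.snd).1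
    (fun i => (chartDeriv (extModel d n) e.totalChart q (v i)).1)
  simp only [e.fst_chartDeriv_totalChart hq]
  rw [e.coe_toModel hq]
  change toForm q.snd _ = toForm q.snd (fun i => e.dchartInv q.proj (e.dchart q.proj _))
  simp only [e.dchartInv_dchart hq]

theorem gammaForm_eq (ξ : VecField (𝓡 (d + 1 + n)) E) {q : ExtMultimomentum B}
    (hq : q.proj ∈ e.chart.source) :
    gammaForm B ξ q = (modelGamma (chartField (𝓡 (d + 1 + n)) e.chart ξ)
      (e.totalChart q)).compContinuousLinearMap (chartDeriv (extModel d n) e.totalChart q) := by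
  ext v
  change toForm q.snd (Fin.cons (ξ q.proj) fun i => dproj B q (v i)) =
    (e.toModel q.proj q.snd).1
      (Fin.cons (e.dchart (e.chart.symm (e.chart q.proj)) (ξ (e.chart.symm (e.chart q.proj))))
        fun i => (chartDeriv (extModel d n) e.totalChart q (v i)).1)
  simp only [e.fst_chartDeriv_totalChart hq]
  rw [e.coe_toModel hq, e.chart.left_inv hq]
  refine congrArg (toForm q.snd) (funext fun i => ?_)
  refine Fin.cases ?_ (fun j => ?_) i
  · exact (e.dchartInv_dchart hq (ξ q.proj)).symm
  · exact (e.dchartInv_dchart hq (dproj B q (v j))).symm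

omit [IsManifold (𝓡 (d + 1 + n)) ∞ E] [IsManifold (𝓡 n) ∞ F] in
/-- The base components of a projectable vector field do not depend on the fibre coordinates. -/
theorem fst_chartField_eq {ξ : VecField (𝓡 (d + 1 + n)) E} (hξ : IsProjectable B ξ)
    {z z' : BaseCoord d × FibCoord n} (hz : z ∈ e.chart.target) (hz' : z' ∈ e.chart.target)
    (h : z.1 = z'.1) :
    (chartField (𝓡 (d + 1 + n)) e.chart ξ z).1 = (chartField (𝓡 (d + 1 + n)) e.chart ξ z').1 := by
  obtain ⟨ξM, -, hM⟩ := hξ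
  have key : ∀ w ∈ e.chart.target, (chartField (𝓡 (d + 1 + n)) e.chart ξ w).1 =
      (fun x => chartDeriv (𝓡 (d + 1)) e.base x (ξM x)) (B.proj (e.chart.symm w)) := by
    intro w hw
    refine (e.fst_dchart (e.chart.map_target hw) _).trans ?_
    rw [hM]
  -- Equal base coordinates mean the same fibre, because `e.base` is injective on its source.
  have hpr : B.proj (e.chart.symm z) = B.proj (e.chart.symm z') := by
    have hs := e.chart.map_target hz
    have hs' := e.chart.map_target hz'
    apply e.base.injOn (e.proj_mem _ hs) (e.proj_mem _ hs')
    rw [← e.fst_chart _ hs, ← e.fst_chart _ hs', e.chart.right_inv hz, e.chart.right_inv hz', h]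
  rw [key z hz, key z' hz', hpr]

omit [IsManifold (𝓡 (d + 1)) ∞ M] [IsManifold (𝓡 n) ∞ F] in
theorem differentiableAt_chartField {ξ : VecField (𝓡 (d + 1 + n)) E}
    (hξ : SmoothVecField (𝓡 (d + 1 + n)) ξ) {z : BaseCoord d × FibCoord n}
    (hz : z ∈ e.chart.target) : DifferentiableAt ℝ (chartField (𝓡 (d + 1 + n)) e.chart ξ) z :=
  ((e.isSmoothChart.contDiffOn_chartField hξ).contDiffAt
    (e.chart.open_target.mem_nhds hz)).differentiableAt (by simp)

-- Infinitesimal projectability: the base component of the field is constant along short vertical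
-- segments. It supplies the hypothesis of `formVal_lieAction` for `L = Df`.
omit [IsManifold (𝓡 n) ∞ F] in
theorem fst_fderiv_chartField_eq_zero {ξ : VecField (𝓡 (d + 1 + n)) E}
    (hξ : SmoothVecField (𝓡 (d + 1 + n)) ξ) (hproj : IsProjectable B ξ)
    {z : BaseCoord d × FibCoord n} (hz : z ∈ e.chart.target) (v : BaseCoord d × FibCoord n)
    (hv : v.1 = 0) : (fderiv ℝ (chartField (𝓡 (d + 1 + n)) e.chart ξ) z v).1 = 0 := by
  have hl : HasDerivAt (fun s : ℝ => z + s • v) v 0 := by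
    simpa using ((hasDerivAt_id (0 : ℝ)).smul_const v).const_add z
  have h0 : z + (0 : ℝ) • v = z := by simp
  have hf : HasFDerivAt (chartField (𝓡 (d + 1 + n)) e.chart ξ)
      (fderiv ℝ (chartField (𝓡 (d + 1 + n)) e.chart ξ) z) (z + (0 : ℝ) • v) := by
    rw [h0]
    exact (e.differentiableAt_chartField hξ hz).hasFDerivAt
  have h1 := (ContinuousLinearMap.fst ℝ (BaseCoord d) (FibCoord n)).hasFDerivAt.comp_hasDerivAt
    (0 : ℝ) (hf.comp_hasDerivAt (0 : ℝ) hl)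
  have h2 : (fun s : ℝ => (chartField (𝓡 (d + 1 + n)) e.chart ξ (z + s • v)).1) =ᶠ[𝓝 0]
      fun _ => (chartField (𝓡 (d + 1 + n)) e.chart ξ z).1 := by
    have : ∀ᶠ s : ℝ in 𝓝 0, z + s • v ∈ e.chart.target :=
      hl.continuousAt.preimage_mem_nhds (by rw [h0]; exact e.chart.open_target.mem_nhds hz)
    filter_upwards [this] with s hs
    exact e.fst_chartField_eq hproj hs hz (by simp [hv])
  exact h1.unique ((hasDerivAt_const _ _).congr_of_eventuallyEq h2)

/-- The canonical lift in the chart induced by an adapted chart. -/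
def liftField (ξ : VecField (𝓡 (d + 1 + n)) E) (z : (BaseCoord d × FibCoord n) × FormModel d n) :
    (BaseCoord d × FibCoord n) × FormModel d n :=
  modelLift (chartField (𝓡 (d + 1 + n)) e.chart ξ) z

theorem contDiffOn_liftField {ξ : VecField (𝓡 (d + 1 + n)) E}
    (hξ : SmoothVecField (𝓡 (d + 1 + n)) ξ) :
    ContDiffOn ℝ ∞ (e.liftField ξ) e.totalChart.target :=
  contDiffOn_modelLift e.chart.open_target (e.isSmoothChart.contDiffOn_chartField hξ)
    fun _ hz => e.mem_totalChart_target hz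

/-- The Hamiltonian equation for `Γ_ξ` determines the components of a tangent vector. -/
theorem hamiltonian_iff {ξ : VecField (𝓡 (d + 1 + n)) E}
    (hξ : SmoothVecField (𝓡 (d + 1 + n)) ξ) (hproj : IsProjectable B ξ)
    {q : ExtMultimomentum B} (hq : q.proj ∈ e.chart.source)
    (W : VecField (extModel d n) (ExtMultimomentum B)) :
    interior W (multisymplecticForm B) q = mextDeriv (extModel d n) (gammaForm B ξ) q ↔
      chartDeriv (extModel d n) e.totalChart q (W q) = e.liftField ξ (e.totalChart q) := by
  have hqt := e.mem_totalChart_source.2 hq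
  have hz : (e.totalChart q).1 ∈ e.chart.target := e.chart.map_source hq
  have hev : ∀ᶠ r : ExtMultimomentum B in 𝓝 q, r.proj ∈ e.chart.source := by
    filter_upwards [e.totalChart.open_source.mem_nhds hqt] with r hr
    exact e.mem_totalChart_source.1 hr
  have hd := e.differentiableAt_chartField hξ hz
  obtain ⟨D, hD, -⟩ := hasFDerivAt_modelGamma (p := e.totalChart q) hd
  have h1 := e.isSmoothChart_totalChart.mextDeriv_eq hqt
    (hasFDerivAt_modelTheta (e.totalChart q)).differentiableAt
    (hev.mono fun r hr => e.tautologicalForm_eq hr)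
  have h2 := e.isSmoothChart_totalChart.mextDeriv_eq hqt hD.differentiableAt
    (hev.mono fun r hr => e.gammaForm_eq ξ hr)
  have hv := e.fst_fderiv_chartField_eq_zero hξ hproj hz
  refine Iff.trans ?_ (model_hamiltonian_iff (p := e.totalChart q) hd hv _)
  have hL : ∀ v : Fin (d + 1) → TangentSpace (extModel d n) q,
      interior W (multisymplecticForm B) q v = -extDeriv modelTheta (e.totalChart q)
        (Fin.cons (chartDeriv (extModel d n) e.totalChart q (W q))
          fun i => chartDeriv (extModel d n) e.totalChart q (v i)) := by
    intro v
    change -(mextDeriv (extModel d n) (tautologicalForm B) q) (Fin.cons (W q) v) = _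
    rw [h1]
    change -(extDeriv modelTheta (e.totalChart q)) _ = _
    congr 2
    funext i
    refine Fin.cases ?_ (fun j => ?_) i
    · rfl
    · rfl
  have hR : ∀ v : Fin (d + 1) → TangentSpace (extModel d n) q,
      mextDeriv (extModel d n) (gammaForm B ξ) q v =
        extDeriv (modelGamma (chartField (𝓡 (d + 1 + n)) e.chart ξ)) (e.totalChart q)
          fun i => chartDeriv (extModel d n) e.totalChart q (v i) := by
    intro v
    rw [h2]
    rfl
  constructor
  -- The chart derivative is onto, so model vectors are tested through their preimages.
  · intro h u
    have h3 := congrArg (fun α : TangentSpace (extModel d n) q [⋀^Fin (d + 1)]→L[ℝ] ℝ =>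
      α (fun i => chartDerivInv (extModel d n) e.totalChart q (u i))) h
    have h4 := (hL _).symm.trans (h3.trans (hR _))
    simpa only [e.isSmoothChart_totalChart.chartDeriv_chartDerivInv hqt] using h4
  · intro h
    ext v
    rw [hL, hR]
    exact h _

end

end AdaptedChart
end TotalCharts

/-! ### Existence of local flows on the total space. -/

section LocalFlow
variable {d n : ℕ}
  {M : Type*} [TopologicalSpace M] [ChartedSpace (BaseCoord d) M] [IsManifold (𝓡 (d + 1)) ∞ M]
  {E : Type*} [TopologicalSpace E] [ChartedSpace (TotCoord d n) E] [IsManifold (𝓡 (d + 1 + n)) ∞ E]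
  {F : Type*} [TopologicalSpace F] [ChartedSpace (FibCoord n) F] [IsManifold (𝓡 n) ∞ F]
  (B : SmoothFiberBundle d n M E F)

include B in
/-- A smooth vector field has a local flow around each point. -/
theorem exists_isLocalFlow {ξ : VecField (𝓡 (d + 1 + n)) E}
    (hξ : SmoothVecField (𝓡 (d + 1 + n)) ξ) (y : E) :
    ∃ (ε : ℝ) (U : Set E) (φ : ℝ → E → E), IsLocalFlow ξ ε U φ ∧ y ∈ U := by
  obtain ⟨e, hy⟩ := exists_adaptedChart B y
  have hc := e.isSmoothChart
  obtain ⟨ε, hε, U, hUt, hUo, hyU, φ, hφ, hφ0, hφd⟩ :=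
    exists_flow_of_contDiffOn e.chart.open_target (hc.contDiffOn_chartField hξ)
      (e.chart.map_source hy)
  have h0 : (0 : ℝ) ∈ Ioo (-ε) ε := ⟨by linarith, hε⟩
  refine ⟨ε, e.chart.source ∩ e.chart ⁻¹' U, fun t y' => e.chart.symm (φ t (e.chart y')),
    ⟨hε, e.chart.isOpen_inter_preimage hUo, ?_, ?_, ?_⟩, hy, hyU⟩
  · have h1 : ContMDiffOn (𝓘(ℝ, ℝ).prod (𝓡 (d + 1 + n))) 𝓘(ℝ, BaseCoord d × FibCoord n) ∞
        (fun q : ℝ × E => e.chart q.2) (Ioo (-ε) ε ×ˢ (e.chart.source ∩ e.chart ⁻¹' U)) :=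
      e.contMDiffOn_chart.comp contMDiffOn_snd fun q hq => hq.2.1
    have h2 : ContMDiffOn (𝓘(ℝ, ℝ).prod (𝓡 (d + 1 + n))) 𝓘(ℝ, ℝ × (BaseCoord d × FibCoord n)) ∞
        (fun q : ℝ × E => (q.1, e.chart q.2))
        (Ioo (-ε) ε ×ˢ (e.chart.source ∩ e.chart ⁻¹' U)) :=
      contMDiffOn_fst.prodMk_space h1
    have h3 : ContMDiffOn (𝓘(ℝ, ℝ).prod (𝓡 (d + 1 + n))) 𝓘(ℝ, BaseCoord d × FibCoord n) ∞
        (fun q : ℝ × E => φ q.1 (e.chart q.2))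
        (Ioo (-ε) ε ×ˢ (e.chart.source ∩ e.chart ⁻¹' U)) :=
      hφ.contMDiffOn.comp h2 fun q hq => ⟨hq.1, hq.2.2⟩
    exact e.contMDiffOn_symm.comp h3 fun q hq => (hφd _ hq.2.2 _ hq.1).1
  · rintro y' ⟨hy', hU'⟩
    rw [hφ0 _ hU', e.chart.left_inv hy']
  · rintro y' ⟨hy', hU'⟩ t ht
    refine HasMFDerivAt.hasMFDerivWithinAt ?_
    refine hc.hasMFDerivAt_of_hasDerivAt ?_ ?_
    · filter_upwards [isOpen_Ioo.mem_nhds ht] with s hs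
      exact e.chart.map_target (hφd _ hU' s hs).1
    · refine (hφd _ hU' t ht).2.congr_of_eventuallyEq ?_
      filter_upwards [isOpen_Ioo.mem_nhds ht] with s hs
      exact e.chart.right_inv (hφd _ hU' s hs).1

end LocalFlow

/-! ### The global lift and uniqueness in the Hamiltonian equation. -/

section CanonicalLift
variable {d n : ℕ}
  {M : Type*} [TopologicalSpace M] [ChartedSpace (BaseCoord d) M] [IsManifold (𝓡 (d + 1)) ∞ M]
  {E : Type*} [TopologicalSpace E] [ChartedSpace (TotCoord d n) E] [IsManifold (𝓡 (d + 1 + n)) ∞ E]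
  {F : Type*} [TopologicalSpace F] [ChartedSpace (FibCoord n) F] [IsManifold (𝓡 n) ∞ F]
  (B : SmoothFiberBundle d n M E F)

/-- The canonical lift of a projectable vector field to `𝓜π`. -/
def canonicalLift (ξ : VecField (𝓡 (d + 1 + n)) E) :
    VecField (extModel d n) (ExtMultimomentum B) := fun q =>
  chartDerivInv (extModel d n) (exists_adaptedChart B q.proj).choose.totalChart q
    ((exists_adaptedChart B q.proj).choose.liftField ξ
      ((exists_adaptedChart B q.proj).choose.totalChart q))

variable {B} {ξ : VecField (𝓡 (d + 1 + n)) E}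
  (hξ : SmoothVecField (𝓡 (d + 1 + n)) ξ) (hproj : IsProjectable B ξ)
include hξ hproj

/-- At each point the equation holds by construction in the chart chosen there. Being free of
charts, it then yields the components in every adapted chart, so no transformation law for
`liftField` has to be computed. -/
theorem interior_canonicalLift : interior (canonicalLift B ξ) (multisymplecticForm B) =
    mextDeriv (extModel d n) (gammaForm B ξ) := by
  funext q
  have hq := (exists_adaptedChart B q.proj).choose_spec
  rw [(exists_adaptedChart B q.proj).choose.hamiltonian_iff hξ hproj hq]
  exact (AdaptedChart.isSmoothChart_totalChart _).chartDeriv_chartDerivInv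
    ((AdaptedChart.mem_totalChart_source _).2 hq) _

/-- The canonical lift in an arbitrary adapted chart. -/
theorem chartDeriv_canonicalLift (e : AdaptedChart B) {q : ExtMultimomentum B}
    (hq : q.proj ∈ e.chart.source) :
    chartDeriv (extModel d n) e.totalChart q (canonicalLift B ξ q) =
      e.liftField ξ (e.totalChart q) :=
  (e.hamiltonian_iff hξ hproj hq _).1 (congrFun (interior_canonicalLift hξ hproj) q)

theorem eq_canonicalLift_of_chartDeriv (e : AdaptedChart B) {q : ExtMultimomentum B}
    (hq : q.proj ∈ e.chart.source) {w : TangentSpace (extModel d n) q}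
    (hw : chartDeriv (extModel d n) e.totalChart q w = e.liftField ξ (e.totalChart q)) :
    w = canonicalLift B ξ q := by
  have hqt := e.mem_totalChart_source.2 hq
  rw [← e.isSmoothChart_totalChart.chartDerivInv_chartDeriv hqt w, hw,
    ← chartDeriv_canonicalLift hξ hproj e hq,
    e.isSmoothChart_totalChart.chartDerivInv_chartDeriv hqt]

theorem interior_eq_iff (W : VecField (extModel d n) (ExtMultimomentum B)) :
    interior W (multisymplecticForm B) = mextDeriv (extModel d n) (gammaForm B ξ) ↔
      W = canonicalLift B ξ := by
  constructor
  · intro h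
    funext q
    obtain ⟨e, hq⟩ := exists_adaptedChart B q.proj
    exact eq_canonicalLift_of_chartDeriv hξ hproj e hq
      ((e.hamiltonian_iff hξ hproj hq W).1 (congrFun h q))
  · rintro rfl
    exact interior_canonicalLift hξ hproj

theorem smoothVecField_canonicalLift :
    SmoothVecField (extModel d n) (canonicalLift B ξ) := by
  intro q
  obtain ⟨e, hq⟩ := exists_adaptedChart B q.proj
  exact e.isSmoothChart_totalChart.contMDiffAt_of_chartField (e.contDiffOn_liftField hξ)
    (fun r hr => chartDeriv_canonicalLift hξ hproj e (e.mem_totalChart_source.1 hr))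
    (e.mem_totalChart_source.2 hq)

end CanonicalLift

/-! ### The variational equation and transport of forms. -/

section Variational
variable {W : Type*} [NormedAddCommGroup W] [NormedSpace ℝ W]

/-- The variational equation: the derivative of a flow with respect to the initial value satisfies
the linearised differential equation. -/
theorem hasDerivAt_fderiv_of_flow {W' : Type*} [NormedAddCommGroup W'] [NormedSpace ℝ W']
    {G : ℝ × W' → W} {X : W → W} {t₀ : ℝ} {w₀ : W'}
    (hG : ContDiffAt ℝ 2 G (t₀, w₀)) (hX : DifferentiableAt ℝ X (G (t₀, w₀)))
    (hflow : ∀ᶠ q : ℝ × W' in 𝓝 (t₀, w₀), HasDerivAt (fun s => G (s, q.2)) (X (G q)) q.1) :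
    HasDerivAt (fun t => fderiv ℝ (fun w => G (t, w)) w₀)
      ((fderiv ℝ X (G (t₀, w₀))).comp (fderiv ℝ (fun w => G (t₀, w)) w₀)) t₀ := by
  have hdiff : ∀ᶠ q : ℝ × W' in 𝓝 (t₀, w₀), DifferentiableAt ℝ G q :=
    (hG.eventually (by simp)).mono fun q hq => hq.differentiableAt (by simp)
  have hpart : ∀ q : ℝ × W', DifferentiableAt ℝ G q →
      HasFDerivAt (fun w => G (q.1, w)) ((fderiv ℝ G q).comp (.inr ℝ ℝ W')) q.2 := fun q hq =>
    HasFDerivAt.comp (f := fun w : W' => (q.1, w)) q.2 hq.hasFDerivAt (hasFDerivAt_prodMk_right _ _)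
  have hD : DifferentiableAt ℝ (fderiv ℝ G) (t₀, w₀) :=
    (hG.fderiv_right (m := 1) (by norm_num)).differentiableAt (by simp)
  have hline : HasDerivAt (fun t : ℝ => (t, w₀)) ((1 : ℝ), (0 : W')) t₀ :=
    (hasDerivAt_id t₀).prodMk (hasDerivAt_const t₀ w₀)
  have h1 : HasDerivAt (fun t => fderiv ℝ G (t, w₀)) (fderiv ℝ (fderiv ℝ G) (t₀, w₀) (1, 0)) t₀ :=
    HasFDerivAt.comp_hasDerivAt (f := fun t : ℝ => (t, w₀)) t₀ hD.hasFDerivAt hline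
  have h2 : HasDerivAt (fun t => (fderiv ℝ G (t, w₀)).comp (.inr ℝ ℝ W'))
      ((fderiv ℝ (fderiv ℝ G) (t₀, w₀) (1, 0)).comp (.inr ℝ ℝ W')) t₀ := by
    simpa using h1.clm_comp (hasDerivAt_const t₀ (ContinuousLinearMap.inr ℝ ℝ W'))
  have h3 : (fun t => fderiv ℝ (fun w => G (t, w)) w₀) =ᶠ[𝓝 t₀]
      fun t => (fderiv ℝ G (t, w₀)).comp (.inr ℝ ℝ W') := by
    filter_upwards [hline.continuousAt.eventually hdiff] with t ht
    exact (hpart (t, w₀) ht).fderiv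
  refine (h2.congr_of_eventuallyEq h3).congr_deriv (ContinuousLinearMap.ext fun v => ?_)
  -- Symmetry of the second derivative exchanges `∂ₜ∂_w G` for `∂_w∂ₜ G`, and `∂ₜ G = X ∘ G` holds
  -- on a neighbourhood, so it may be differentiated in `w`.
  have hsymm : IsSymmSndFDerivAt ℝ G (t₀, w₀) := hG.isSymmSndFDerivAt (by simp)
  have h4 : HasFDerivAt (fun q => fderiv ℝ G q (1, 0))
      ((fderiv ℝ (fderiv ℝ G) (t₀, w₀)).flip (1, 0)) (t₀, w₀) := by
    simpa using hD.hasFDerivAt.clm_apply (hasFDerivAt_const ((1 : ℝ), (0 : W')) (t₀, w₀))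
  have h5 : HasFDerivAt (fun q => X (G q)) ((fderiv ℝ X (G (t₀, w₀))).comp (fderiv ℝ G (t₀, w₀)))
      (t₀, w₀) := hX.hasFDerivAt.comp (t₀, w₀) hdiff.self_of_nhds.hasFDerivAt
  have h6 : (fun q => fderiv ℝ G q (1, 0)) =ᶠ[𝓝 (t₀, w₀)] fun q => X (G q) := by
    filter_upwards [hdiff, hflow] with q hq hf
    exact (HasFDerivAt.comp_hasDerivAt (f := fun t : ℝ => (t, q.2)) q.1 hq.hasFDerivAt
      ((hasDerivAt_id q.1).prodMk (hasDerivAt_const q.1 q.2))).unique hf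
  have h7 := congrArg (fun L : ℝ × W' →L[ℝ] W => L (0, v)) (h4.unique (h5.congr_of_eventuallyEq h6))
  rw [(hpart (t₀, w₀) hdiff.self_of_nhds).fderiv]
  exact (hsymm _ _).trans h7

/-- A solution of a linear differential equation that vanishes at one time vanishes at all nearby
times. -/
theorem eventually_linear_ode_eq_zero {u : ℝ → W} {A : ℝ → W →L[ℝ] W} {t₀ : ℝ}
    (hA : ContinuousAt A t₀) (hu : ∀ᶠ t in 𝓝 t₀, HasDerivAt u (A t (u t)) t) :
    ∀ᶠ t in 𝓝 t₀, (u t₀ = 0 → u t = 0) ∧ (u t = 0 → u t₀ = 0) := by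
  -- A local bound on `A` is a uniform Lipschitz constant, which allows comparison with the zero
  -- solution from any nearby time.
  have hb : ∀ᶠ t in 𝓝 t₀, ‖A t‖₊ < ‖A t₀‖₊ + 1 :=
    hA.nnnorm.eventually_lt continuousAt_const (by simp)
  obtain ⟨δ, hδ, hball⟩ := Metric.eventually_nhds_iff_ball.1 (hu.and hb)
  rw [Real.ball_eq_Ioo] at hball
  have key : ∀ t₁ ∈ Ioo (t₀ - δ) (t₀ + δ), u t₁ = 0 → ∀ t ∈ Ioo (t₀ - δ) (t₀ + δ), u t = 0 := by
    intro t₁ ht₁ h0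
    refine ODE_solution_unique_of_mem_Ioo (v := fun t w => A t w) (s := fun _ => univ)
      (K := ‖A t₀‖₊ + 1) (g := fun _ => 0) (fun t ht => ?_) ht₁
      (fun t ht => ⟨(hball t ht).1, mem_univ _⟩) (fun t ht => ⟨?_, mem_univ _⟩) h0
    · exact ((A t).lipschitz.weaken (hball t ht).2.le).lipschitzOnWith
    · simpa using hasDerivAt_const t (0 : W)
  have h0 : t₀ ∈ Ioo (t₀ - δ) (t₀ + δ) := ⟨by linarith, by linarith⟩
  filter_upwards [isOpen_Ioo.mem_nhds h0] with t ht
  exact ⟨fun h => key t₀ h0 h t ht, fun h => key t ht h t₀ h0⟩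

/-- In `(R⁻¹)' = -R⁻¹ R' R⁻¹` with `R' = L R`, the factor `R` cancels against the last inverse. -/
theorem hasDerivAt_inverse_of_linear_ode [CompleteSpace W] {R : ℝ → W →L[ℝ] W} {L : W →L[ℝ] W}
    {t₀ : ℝ} (hR : HasDerivAt R (L.comp (R t₀)) t₀) (hinv : (R t₀).IsInvertible) :
    HasDerivAt (fun t => (R t).inverse) (-((R t₀).inverse.comp L)) t₀ := by
  obtain ⟨T, hT⟩ := hinv
  let x : (W →L[ℝ] W)ˣ := (ContinuousLinearEquiv.unitsEquiv ℝ W).symm T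
  have hx : (x : W →L[ℝ] W) = R t₀ := hT
  have h1 := hasFDerivAt_ringInverse (𝕜 := ℝ) x
  rw [hx] at h1
  have h2 := h1.comp_hasDerivAt t₀ hR
  have h3 : (R t₀).inverse = ((x⁻¹ : (W →L[ℝ] W)ˣ) : W →L[ℝ] W) := by
    rw [← hT, ContinuousLinearMap.inverse_equiv]
    rfl
  rw [ContinuousLinearMap.ringInverse_eq_inverse] at h2
  refine h2.congr_deriv ?_
  rw [h3, ← hx]
  change -((x⁻¹ : (W →L[ℝ] W)ˣ) * (L * x) * (x⁻¹ : (W →L[ℝ] W)ˣ) : W →L[ℝ] W) =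
    -((x⁻¹ : (W →L[ℝ] W)ˣ) * L : W →L[ℝ] W)
  rw [mul_assoc, mul_assoc, Units.mul_inv, mul_one]

theorem hasDerivAt_compContinuousLinearMap {W' : Type*} [NormedAddCommGroup W'] [NormedSpace ℝ W']
    {k : ℕ} (ζ : W [⋀^Fin k]→L[ℝ] ℝ) {S : ℝ → W' →L[ℝ] W} {S' : W' →L[ℝ] W} {t : ℝ}
    (hS : HasDerivAt S S' t) :
    HasDerivAt (fun s => ζ.compContinuousLinearMap (S s))
      (ζ.fderivCompContinuousLinearMap (S t) S') t := by
  have h := (HasFDerivAt.continuousAlternatingMapCompContinuousLinearMap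
    (hasFDerivAt_const ζ t) hS.hasFDerivAt).hasDerivAt
  simpa using h

end Variational

section
variable {d n : ℕ}

/-- The transport of a form by a solution of a linear differential equation. -/
theorem hasDerivAt_formRetract_comp_inverse
    (ζ : (BaseCoord d × FibCoord n) [⋀^Fin (d + 1)]→L[ℝ] ℝ)
    {R : ℝ → (BaseCoord d × FibCoord n) →L[ℝ] (BaseCoord d × FibCoord n)}
    {L : (BaseCoord d × FibCoord n) →L[ℝ] (BaseCoord d × FibCoord n)} {t₀ : ℝ}
    (hR : HasDerivAt R (L.comp (R t₀)) t₀) (hinv : (R t₀).IsInvertible)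
    {a : FormModel d n} (ha : formVal a = ζ.compContinuousLinearMap (R t₀).inverse) :
    HasDerivAt (fun t => formRetract (ζ.compContinuousLinearMap (R t).inverse))
      (lieAction L a) t₀ := by
  have h1 := hasDerivAt_inverse_of_linear_ode hR hinv
  have h2 : HasDerivAt (fun t => ζ.compContinuousLinearMap (R t).inverse)
      (ζ.fderivCompContinuousLinearMap (R t₀).inverse (-((R t₀).inverse.comp L))) t₀ :=
    hasDerivAt_compContinuousLinearMap ζ h1
  have h3 := (formRetract (d := d) (n := n)).hasFDerivAt.comp_hasDerivAt t₀ h2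
  -- The derivative is `∑ᵢ ζ(…, -R⁻¹ L vᵢ, …)` with `R⁻¹ vⱼ` in the other slots. By `ha` this is
  -- `-∑ᵢ a(…, L vᵢ, …)`.
  refine h3.congr_deriv ?_
  change _ = -formRetract _
  rw [← map_neg, ha]
  congr 1
  ext v
  rw [ContinuousAlternatingMap.neg_apply, fderivComp_id_apply,
    ContinuousAlternatingMap.fderivCompContinuousLinearMap_apply, ← Finset.sum_neg_distrib]
  refine Finset.sum_congr rfl fun i _ => ?_
  have h4 : (fun j => Function.update (fun _ : Fin (d + 1) => (R t₀).inverse) i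
      (-((R t₀).inverse.comp L)) j (v j)) =
      Function.update (fun j => (R t₀).inverse (v j)) i (-((R t₀).inverse (L (v i)))) := by
    funext j
    rcases eq_or_ne j i with rfl | h
    · simp
    · simp [h]
  have h5 : (fun j => (R t₀).inverse (Function.update v i (L (v i)) j)) =
      Function.update (fun j => (R t₀).inverse (v j)) i ((R t₀).inverse (L (v i))) := by
    funext j
    rcases eq_or_ne j i with rfl | h
    · simp
    · simp [h]
  rw [h4]
  change _ = -ζ (fun j => (R t₀).inverse (Function.update v i (L (v i)) j))
  rw [h5]
  exact ζ.toMultilinearMap.map_update_neg _ i _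

end

/-! ### Derivatives of local flows: invertibility and preservation of vertical vectors. -/

section Flow
variable {d n : ℕ}
  {M : Type*} [TopologicalSpace M] [ChartedSpace (BaseCoord d) M]
  {E : Type*} [TopologicalSpace E] [ChartedSpace (TotCoord d n) E]
  {F : Type*} [TopologicalSpace F] [ChartedSpace (FibCoord n) F]
  {B : SmoothFiberBundle d n M E F}
  {ξ : VecField (𝓡 (d + 1 + n)) E} {ε : ℝ} {U : Set E} {φ : ℝ → E → E}

/-- The derivative of a map of `E` at `y`, read in adapted charts. -/
def jacobian (e₀ e : AdaptedChart B) (y : E) (Φ : E → E) :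
    BaseCoord d × FibCoord n →L[ℝ] BaseCoord d × FibCoord n :=
  (e.dchart (Φ y)).comp
    ((mfderiv (𝓡 (d + 1 + n)) (𝓡 (d + 1 + n)) Φ y).comp (e₀.dchartInv y))

theorem jacobian_eq_fderiv {e₀ e : AdaptedChart B} {y : E} {Φ : E → E}
    (hΦ : MDifferentiableAt (𝓡 (d + 1 + n)) (𝓡 (d + 1 + n)) Φ y)
    (hy : y ∈ e₀.chart.source) (he : Φ y ∈ e.chart.source) :
    jacobian e₀ e y Φ = fderiv ℝ (fun w => e.chart (Φ (e₀.chart.symm w))) (e₀.chart y) := by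
  have h0 := e₀.chart.left_inv hy
  have h1 := e₀.mdifferentiableAt_symm (e₀.chart.map_source hy)
  have h2 : MDifferentiableAt 𝓘(ℝ, BaseCoord d × FibCoord n) (𝓡 (d + 1 + n))
      (Φ ∘ e₀.chart.symm) (e₀.chart y) :=
    MDifferentiableAt.comp_of_eq (I' := 𝓡 (d + 1 + n)) (x := e₀.chart y) (y := y) hΦ h1 h0
  have h3 := mfderiv_comp_of_eq (I' := 𝓡 (d + 1 + n)) (x := e₀.chart y) hΦ h1 h0
  have h4 := mfderiv_comp_of_eq (I' := 𝓡 (d + 1 + n)) (I := 𝓘(ℝ, BaseCoord d × FibCoord n))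
    (x := e₀.chart y) (y := Φ y) (e.mdifferentiableAt_chart he) h2 (by simp [h0])
  rw [h3, ← e₀.dchartInv_eq hy, mfderiv_eq_fderiv] at h4
  -- The chain rule speaks of the point `e₀.chart.symm (e₀.chart y)`, equal to `y` only
  -- propositionally; tangent spaces depend on the point, so the equality is eliminated on a
  -- variable `y'`.
  have h5 : ∀ y' : E, y' = y → ∀ v, jacobian e₀ e y Φ v =
      mfderiv (𝓡 (d + 1 + n)) 𝓘(ℝ, BaseCoord d × FibCoord n) e.chart (Φ y')
        (mfderiv (𝓡 (d + 1 + n)) (𝓡 (d + 1 + n)) Φ y' (e₀.dchartInv y v)) := by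
    rintro _ rfl v
    rfl
  refine ContinuousLinearMap.ext fun v => (h5 _ h0 v).trans ?_
  exact (congrArg (fun L : BaseCoord d × FibCoord n →L[ℝ] BaseCoord d × FibCoord n => L v)
    h4).symm

theorem IsLocalFlow.contMDiffAt (hφ : IsLocalFlow ξ ε U φ) {y : E} (hy : y ∈ U) {t : ℝ}
    (ht : t ∈ Ioo (-ε) ε) : ContMDiffAt (𝓘(ℝ, ℝ).prod (𝓡 (d + 1 + n))) (𝓡 (d + 1 + n)) ∞
      (fun q : ℝ × E => φ q.1 q.2) (t, y) :=
  hφ.contMDiffOn.contMDiffAt ((isOpen_Ioo.prod hφ.isOpen).mem_nhds ⟨ht, hy⟩)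

theorem IsLocalFlow.mdifferentiableAt (hφ : IsLocalFlow ξ ε U φ) {y : E} (hy : y ∈ U) {t : ℝ}
    (ht : t ∈ Ioo (-ε) ε) :
    MDifferentiableAt (𝓡 (d + 1 + n)) (𝓡 (d + 1 + n)) (φ t) y :=
  ((hφ.contMDiffAt hy ht).comp y (contMDiffAt_const.prodMk contMDiffAt_id)).mdifferentiableAt
    (by simp)

theorem IsLocalFlow.continuousAt (hφ : IsLocalFlow ξ ε U φ) {y : E} (hy : y ∈ U) {t : ℝ}
    (ht : t ∈ Ioo (-ε) ε) : ContinuousAt (fun s => φ s y) t :=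
  (hφ.contMDiffAt hy ht).continuousAt.comp (f := fun s : ℝ => (s, y))
    (continuousAt_id.prodMk continuousAt_const)

theorem IsLocalFlow.hasDerivAt_chart (hφ : IsLocalFlow ξ ε U φ) {e : AdaptedChart B} {y : E}
    (hy : y ∈ U) {t : ℝ} (ht : t ∈ Ioo (-ε) ε) (he : φ t y ∈ e.chart.source) :
    HasDerivAt (fun s => e.chart (φ s y))
      (chartField (𝓡 (d + 1 + n)) e.chart ξ (e.chart (φ t y))) t := by
  have h := e.isSmoothChart.hasDerivAt_comp (γ := fun s => φ s y) he
    ((hφ.isIntegralCurve y hy t ht).hasMFDerivAt (isOpen_Ioo.mem_nhds ht))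
  have h2 : chartField (𝓡 (d + 1 + n)) e.chart ξ (e.chart (φ t y)) =
      chartDeriv (𝓡 (d + 1 + n)) e.chart (φ t y) (ξ (φ t y)) := by
    rw [chartField, e.chart.left_inv he]
  rw [h2]
  exact h

/-- The variational equation for `(t, w) ↦ e(φ_t(e₀⁻¹ w))`. Two charts are used because the flow
line may leave the chart of its starting point. -/
theorem IsLocalFlow.hasDerivAt_jacobian [IsManifold (𝓡 (d + 1 + n)) ∞ E]
    (hξ : SmoothVecField (𝓡 (d + 1 + n)) ξ)
    (hφ : IsLocalFlow ξ ε U φ) {e₀ e : AdaptedChart B} {y : E} (hy : y ∈ U)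
    (hy₀ : y ∈ e₀.chart.source) {t : ℝ} (ht : t ∈ Ioo (-ε) ε) (he : φ t y ∈ e.chart.source) :
    HasDerivAt (fun s => jacobian e₀ e y (φ s))
      ((fderiv ℝ (chartField (𝓡 (d + 1 + n)) e.chart ξ) (e.chart (φ t y))).comp
        (jacobian e₀ e y (φ t))) t := by
  have h0 := e₀.chart.left_inv hy₀
  have hw := e₀.chart.map_source hy₀
  have hsymm : ContMDiffAt 𝓘(ℝ, ℝ × (BaseCoord d × FibCoord n)) (𝓡 (d + 1 + n)) ∞
      (fun q : ℝ × (BaseCoord d × FibCoord n) => e₀.chart.symm q.2) (t, e₀.chart y) :=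
    ContMDiffAt.comp (t, e₀.chart y) (e₀.isSmoothChart.contMDiffAt_symm hw)
      contDiffAt_snd.contMDiffAt
  have hφs : ContMDiffAt 𝓘(ℝ, ℝ × (BaseCoord d × FibCoord n)) (𝓡 (d + 1 + n)) ∞
      (fun q : ℝ × (BaseCoord d × FibCoord n) => φ q.1 (e₀.chart.symm q.2)) (t, e₀.chart y) :=
    ContMDiffAt.comp_of_eq (y := (t, y)) (hφ.contMDiffAt hy ht)
      (contDiffAt_fst.contMDiffAt.prodMk hsymm) (by simp [h0])
  have hG : ContDiffAt ℝ ∞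
      (fun q : ℝ × (BaseCoord d × FibCoord n) => e.chart (φ q.1 (e₀.chart.symm q.2)))
      (t, e₀.chart y) := by
    rw [← contMDiffAt_iff_contDiffAt]
    exact ContMDiffAt.comp_of_eq (y := φ t y) (e.isSmoothChart.contMDiffAt he) hφs (by simp [h0])
  have hf : DifferentiableAt ℝ (chartField (𝓡 (d + 1 + n)) e.chart ξ)
      (e.chart (φ t (e₀.chart.symm (e₀.chart y)))) := by
    rw [h0]
    exact ((e.isSmoothChart.contDiffOn_chartField hξ).contDiffAt
      (e.chart.open_target.mem_nhds (e.chart.map_source he))).differentiableAt (by simp)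
  have hev : ∀ᶠ q : ℝ × (BaseCoord d × FibCoord n) in 𝓝 (t, e₀.chart y),
      HasDerivAt (fun s => e.chart (φ s (e₀.chart.symm q.2)))
        (chartField (𝓡 (d + 1 + n)) e.chart ξ (e.chart (φ q.1 (e₀.chart.symm q.2)))) q.1 := by
    have h1 : ∀ᶠ q : ℝ × (BaseCoord d × FibCoord n) in 𝓝 (t, e₀.chart y),
        φ q.1 (e₀.chart.symm q.2) ∈ e.chart.source :=
      hφs.continuousAt.eventually (e.chart.open_source.mem_nhds (by simpa [h0] using he))
    have h2 : ∀ᶠ q : ℝ × (BaseCoord d × FibCoord n) in 𝓝 (t, e₀.chart y),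
        e₀.chart.symm q.2 ∈ U :=
      hsymm.continuousAt.eventually (hφ.isOpen.mem_nhds (by simpa [h0] using hy))
    have h3 : ∀ᶠ q : ℝ × (BaseCoord d × FibCoord n) in 𝓝 (t, e₀.chart y), q.1 ∈ Ioo (-ε) ε :=
      continuousAt_fst.eventually (isOpen_Ioo.mem_nhds ht)
    filter_upwards [h1, h2, h3] with q hq1 hq2 hq3
    exact hφ.hasDerivAt_chart hq2 hq3 hq1
  have h4 := hasDerivAt_fderiv_of_flow
    (G := fun q : ℝ × (BaseCoord d × FibCoord n) => e.chart (φ q.1 (e₀.chart.symm q.2)))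
    (hG.of_le ENat.LEInfty.out) hf hev
  have h5 : (fun s => jacobian e₀ e y (φ s)) =ᶠ[𝓝 t]
      fun s => fderiv ℝ (fun w => e.chart (φ s (e₀.chart.symm w))) (e₀.chart y) := by
    filter_upwards [isOpen_Ioo.mem_nhds ht,
      (hφ.continuousAt hy ht).eventually (e.chart.open_source.mem_nhds he)] with s hs hse
    exact jacobian_eq_fderiv (hφ.mdifferentiableAt hy hs) hy₀ hse
  rw [jacobian_eq_fderiv (hφ.mdifferentiableAt hy ht) hy₀ he]
  have h6 := h4.congr_of_eventuallyEq h5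
  simp only [h0] at h6
  exact h6

end Flow

section FlowDerivative
variable {d n : ℕ}
  {M : Type*} [TopologicalSpace M] [ChartedSpace (BaseCoord d) M] [IsManifold (𝓡 (d + 1)) ∞ M]
  {E : Type*} [TopologicalSpace E] [ChartedSpace (TotCoord d n) E] [IsManifold (𝓡 (d + 1 + n)) ∞ E]
  {F : Type*} [TopologicalSpace F] [ChartedSpace (FibCoord n) F] [IsManifold (𝓡 n) ∞ F]
  {B : SmoothFiberBundle d n M E F}
  {ξ : VecField (𝓡 (d + 1 + n)) E} (hξ : SmoothVecField (𝓡 (d + 1 + n)) ξ)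
  {ε : ℝ} {U : Set E} {φ : ℝ → E → E} (hφ : IsLocalFlow ξ ε U φ)
  {y : E} (hy : y ∈ U) {t : ℝ} (ht : t ∈ Ioo (-ε) ε)
include hξ hφ hy ht

omit [IsManifold (𝓡 (d + 1)) ∞ M] [IsManifold (𝓡 n) ∞ F] in
theorem IsLocalFlow.continuousAt_fderiv_chartField {e : AdaptedChart B}
    (he : φ t y ∈ e.chart.source) :
    ContinuousAt (fun s => fderiv ℝ (chartField (𝓡 (d + 1 + n)) e.chart ξ) (e.chart (φ s y)))
      t := by
  have h1 : ContDiffOn ℝ ∞ (fderiv ℝ (chartField (𝓡 (d + 1 + n)) e.chart ξ)) e.chart.target :=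
    (e.isSmoothChart.contDiffOn_chartField hξ).fderiv_of_isOpen e.chart.open_target (by simp)
  have h2 := h1.continuousOn.continuousAt (e.chart.open_target.mem_nhds (e.chart.map_source he))
  exact ContinuousAt.comp (f := fun s => e.chart (φ s y)) h2
    (hφ.hasDerivAt_chart hy ht he).continuousAt

omit [IsManifold (𝓡 (d + 1)) ∞ M] [IsManifold (𝓡 n) ∞ F] in
theorem IsLocalFlow.eventually_hasDerivAt_jacobian {e₀ e : AdaptedChart B}
    (hy₀ : y ∈ e₀.chart.source) (he : φ t y ∈ e.chart.source) :
    ∀ᶠ s in 𝓝 t, φ s y ∈ e.chart.source ∧ HasDerivAt (fun s => jacobian e₀ e y (φ s))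
      ((fderiv ℝ (chartField (𝓡 (d + 1 + n)) e.chart ξ) (e.chart (φ s y))).comp
        (jacobian e₀ e y (φ s))) s := by
  filter_upwards [isOpen_Ioo.mem_nhds ht,
    (hφ.continuousAt hy ht).eventually (e.chart.open_source.mem_nhds he)] with s hs hse
  exact ⟨hse, hφ.hasDerivAt_jacobian hξ hy hy₀ hs hse⟩

-- The vector `jacobian e₀ e y (φ s) v` solves a linear equation in `s`. Both implications are
-- recorded so that vanishing can be continued along the whole time interval.
omit [IsManifold (𝓡 (d + 1)) ∞ M] [IsManifold (𝓡 n) ∞ F] in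
theorem IsLocalFlow.eventually_jacobian_eq_zero {e₀ e : AdaptedChart B}
    (hy₀ : y ∈ e₀.chart.source) (he : φ t y ∈ e.chart.source) (v : BaseCoord d × FibCoord n) :
    ∀ᶠ s in 𝓝 t, (jacobian e₀ e y (φ t) v = 0 → jacobian e₀ e y (φ s) v = 0) ∧
      (jacobian e₀ e y (φ s) v = 0 → jacobian e₀ e y (φ t) v = 0) := by
  refine eventually_linear_ode_eq_zero (u := fun s => jacobian e₀ e y (φ s) v)
    (hφ.continuousAt_fderiv_chartField hξ hy ht he) ?_
  filter_upwards [hφ.eventually_hasDerivAt_jacobian hξ hy ht hy₀ he] with s hs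
  simpa using hs.2.clm_apply (hasDerivAt_const s v)

-- By projectability `(Df w).1` depends on `w.1` only, so the base component of the transported
-- vector satisfies a linear equation of its own.
omit [IsManifold (𝓡 n) ∞ F] in
theorem IsLocalFlow.eventually_fst_jacobian_eq_zero (hproj : IsProjectable B ξ)
    {e₀ e : AdaptedChart B}
    (hy₀ : y ∈ e₀.chart.source) (he : φ t y ∈ e.chart.source) (v : BaseCoord d × FibCoord n) :
    ∀ᶠ s in 𝓝 t, ((jacobian e₀ e y (φ t) v).1 = 0 → (jacobian e₀ e y (φ s) v).1 = 0) ∧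
      ((jacobian e₀ e y (φ s) v).1 = 0 → (jacobian e₀ e y (φ t) v).1 = 0) := by
  refine eventually_linear_ode_eq_zero (u := fun s => (jacobian e₀ e y (φ s) v).1)
    (A := fun s => (ContinuousLinearMap.fst ℝ (BaseCoord d) (FibCoord n)).comp
      ((fderiv ℝ (chartField (𝓡 (d + 1 + n)) e.chart ξ) (e.chart (φ s y))).comp
        (ContinuousLinearMap.inl ℝ (BaseCoord d) (FibCoord n))))
    (continuousAt_const.clm_comp
      ((hφ.continuousAt_fderiv_chartField hξ hy ht he).clm_comp continuousAt_const)) ?_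
  filter_upwards [hφ.eventually_hasDerivAt_jacobian hξ hy ht hy₀ he] with s hs
  have h1 : HasDerivAt (fun s => jacobian e₀ e y (φ s) v)
      (fderiv ℝ (chartField (𝓡 (d + 1 + n)) e.chart ξ) (e.chart (φ s y))
        (jacobian e₀ e y (φ s) v)) s := by
    simpa using hs.2.clm_apply (hasDerivAt_const s v)
  refine ((ContinuousLinearMap.fst ℝ (BaseCoord d) (FibCoord n)).hasFDerivAt.comp_hasDerivAt
    s h1).congr_deriv ?_
  set w := jacobian e₀ e y (φ s) v
  have h2 : w = (w.1, 0) + (0, w.2) := by simp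
  have h3 := e.fst_fderiv_chartField_eq_zero hξ hproj (e.chart.map_source hs.1) (0, w.2) rfl
  change (fderiv ℝ (chartField (𝓡 (d + 1 + n)) e.chart ξ) (e.chart (φ s y)) w).1 =
    (fderiv ℝ (chartField (𝓡 (d + 1 + n)) e.chart ξ) (e.chart (φ s y)) (w.1, 0)).1
  conv_lhs => rw [h2, map_add, Prod.fst_add, h3, add_zero]

end FlowDerivative

section FlowDerivative
variable {d n : ℕ}
  {M : Type*} [TopologicalSpace M] [ChartedSpace (BaseCoord d) M] [IsManifold (𝓡 (d + 1)) ∞ M]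
  {E : Type*} [TopologicalSpace E] [ChartedSpace (TotCoord d n) E] [IsManifold (𝓡 (d + 1 + n)) ∞ E]
  {F : Type*} [TopologicalSpace F] [ChartedSpace (FibCoord n) F] [IsManifold (𝓡 n) ∞ F]
  (B : SmoothFiberBundle d n M E F)
  {ξ : VecField (𝓡 (d + 1 + n)) E} (hξ : SmoothVecField (𝓡 (d + 1 + n)) ξ)
  {ε : ℝ} {U : Set E} {φ : ℝ → E → E} (hφ : IsLocalFlow ξ ε U φ)
  {y : E} (hy : y ∈ U) {t : ℝ} (ht : t ∈ Ioo (-ε) ε)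

omit [IsManifold (𝓡 (d + 1)) ∞ M] [IsManifold (𝓡 (d + 1 + n)) ∞ E] [IsManifold (𝓡 n) ∞ F] in
theorem AdaptedChart.jacobian_dchart {B : SmoothFiberBundle d n M E F} {e₀ e : AdaptedChart B}
    {y : E} (hy₀ : y ∈ e₀.chart.source) (Φ : E → E) (v : TangentSpace (𝓡 (d + 1 + n)) y) :
    jacobian e₀ e y Φ (e₀.dchart y v) =
      e.dchart (Φ y) (mfderiv (𝓡 (d + 1 + n)) (𝓡 (d + 1 + n)) Φ y v) :=
  congrArg (fun w => e.dchart (Φ y) (mfderiv (𝓡 (d + 1 + n)) (𝓡 (d + 1 + n)) Φ y w))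
    (e₀.dchartInv_dchart hy₀ v)

omit [IsManifold (𝓡 (d + 1)) ∞ M] [IsManifold (𝓡 (d + 1 + n)) ∞ E] [IsManifold (𝓡 n) ∞ F] in
theorem AdaptedChart.dchart_eq_zero_iff {B : SmoothFiberBundle d n M E F} {e : AdaptedChart B}
    {y : E} (hy : y ∈ e.chart.source) (v : TangentSpace (𝓡 (d + 1 + n)) y) :
    e.dchart y v = 0 ↔ v = 0 := by
  constructor
  · intro h
    rw [← e.dchartInv_dchart hy v, h, map_zero]
  · rintro rfl
    exact map_zero _

omit [IsManifold (𝓡 (d + 1 + n)) ∞ E] in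
include hφ hy in
theorem IsLocalFlow.mfderiv_zero (v : TangentSpace (𝓡 (d + 1 + n)) y) :
    mfderiv (𝓡 (d + 1 + n)) (𝓡 (d + 1 + n)) (φ 0) y v = v := by
  have h : φ 0 =ᶠ[𝓝 y] id := by
    filter_upwards [hφ.isOpen.mem_nhds hy] with x hx using hφ.map_zero x hx
  have h1 := h.mfderiv_eq (I := 𝓡 (d + 1 + n)) (I' := 𝓡 (d + 1 + n))
  rw [mfderiv_id] at h1
  exact congrArg (fun L : TangentSpace (𝓡 (d + 1 + n)) y →L[ℝ] TangentSpace (𝓡 (d + 1 + n)) y =>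
    L v) h1

-- The local statements in charts chain together over the connected interval and carry vanishing
-- from time `t` to time `0`, where the derivative is the identity.
include B hξ hφ hy ht in
theorem IsLocalFlow.mfderiv_eq_zero_imp (v : TangentSpace (𝓡 (d + 1 + n)) y)
    (h : mfderiv (𝓡 (d + 1 + n)) (𝓡 (d + 1 + n)) (φ t) y v = 0) : v = 0 := by
  obtain ⟨e₀, hy₀⟩ := exists_adaptedChart B y
  have h0 : (0 : ℝ) ∈ Ioo (-ε) ε := ⟨by linarith [hφ.pos], hφ.pos⟩
  have key := isPreconnected_Ioo.induction₂' (s := Ioo (-ε) ε)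
    (fun s s' => mfderiv (𝓡 (d + 1 + n)) (𝓡 (d + 1 + n)) (φ s) y v = 0 →
      mfderiv (𝓡 (d + 1 + n)) (𝓡 (d + 1 + n)) (φ s') y v = 0) ?_
      (fun _ _ _ _ _ _ h1 h2 h => h2 (h1 h)) ht h0 h
  · exact (hφ.mfderiv_zero hy v).symm.trans key
  · intro s hs
    obtain ⟨e, he⟩ := exists_adaptedChart B (φ s y)
    filter_upwards [nhdsWithin_le_nhds (hφ.eventually_jacobian_eq_zero hξ hy hs hy₀ he
      (e₀.dchart y v)), nhdsWithin_le_nhds ((hφ.continuousAt hy hs).eventually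
        (e.chart.open_source.mem_nhds he))] with s' h1 h2
    simp only [AdaptedChart.jacobian_dchart hy₀] at h1
    rwa [AdaptedChart.dchart_eq_zero_iff he, AdaptedChart.dchart_eq_zero_iff h2] at h1

-- Injectivity suffices in finite dimension; no group law or inverse flow is invoked.
include B hξ hφ hy ht in
theorem IsLocalFlow.isInvertible_mfderiv :
    (mfderiv (𝓡 (d + 1 + n)) (𝓡 (d + 1 + n)) (φ t) y).IsInvertible := by
  let T : TotCoord d n →L[ℝ] TotCoord d n := mfderiv (𝓡 (d + 1 + n)) (𝓡 (d + 1 + n)) (φ t) y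
  have hT : Function.Injective T := (injective_iff_map_eq_zero T).2
    fun v hv => hφ.mfderiv_eq_zero_imp B hξ hy ht v hv
  let T' : TotCoord d n ≃L[ℝ] TotCoord d n :=
    (LinearEquiv.ofInjectiveEndo (T : TotCoord d n →ₗ[ℝ] TotCoord d n) hT).toContinuousLinearEquiv
  have hT' : (T' : TotCoord d n →L[ℝ] TotCoord d n) = T := ContinuousLinearMap.ext fun v => rfl
  exact ⟨T', hT'⟩

-- The same continuation in time, applied to the base component.
include hξ hφ hy in
theorem IsLocalFlow.vertical_mfderiv_imp (hproj : IsProjectable B ξ) {s s' : ℝ}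
    (hs : s ∈ Ioo (-ε) ε) (hs' : s' ∈ Ioo (-ε) ε) (v : TangentSpace (𝓡 (d + 1 + n)) y)
    (h : mfderiv (𝓡 (d + 1 + n)) (𝓡 (d + 1)) B.proj (φ s y)
      (mfderiv (𝓡 (d + 1 + n)) (𝓡 (d + 1 + n)) (φ s) y v) = 0) :
    mfderiv (𝓡 (d + 1 + n)) (𝓡 (d + 1)) B.proj (φ s' y)
      (mfderiv (𝓡 (d + 1 + n)) (𝓡 (d + 1 + n)) (φ s') y v) = 0 := by
  obtain ⟨e₀, hy₀⟩ := exists_adaptedChart B y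
  refine isPreconnected_Ioo.induction₂' (s := Ioo (-ε) ε)
    (fun s s' => mfderiv (𝓡 (d + 1 + n)) (𝓡 (d + 1)) B.proj (φ s y)
        (mfderiv (𝓡 (d + 1 + n)) (𝓡 (d + 1 + n)) (φ s) y v) = 0 →
      mfderiv (𝓡 (d + 1 + n)) (𝓡 (d + 1)) B.proj (φ s' y)
        (mfderiv (𝓡 (d + 1 + n)) (𝓡 (d + 1 + n)) (φ s') y v) = 0) ?_
      (fun _ _ _ _ _ _ h1 h2 h => h2 (h1 h)) hs hs' h
  intro s hs
  obtain ⟨e, he⟩ := exists_adaptedChart B (φ s y)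
  filter_upwards [nhdsWithin_le_nhds (hφ.eventually_fst_jacobian_eq_zero hξ hy hs hproj hy₀ he
    (e₀.dchart y v)), nhdsWithin_le_nhds ((hφ.continuousAt hy hs).eventually
      (e.chart.open_source.mem_nhds he))] with s' h1 h2
  simp only [AdaptedChart.jacobian_dchart hy₀] at h1
  rwa [← e.vertical_iff he, ← e.vertical_iff h2] at h1

-- Verticality passes from time `t` to time `0`, so the inverse of `Tφ_t` maps vertical vectors to
-- vertical vectors, and `ζ` vanishes on two of them.
include hξ hφ hy ht in
theorem IsLocalFlow.pushForward_mem (hproj : IsProjectable B ξ) (ζ : FormFiber B y) :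
    pushForward (φ t) y (toForm ζ) ∈ Lambda2 B (φ t y) := by
  have h0 : (0 : ℝ) ∈ Ioo (-ε) ε := ⟨by linarith [hφ.pos], hφ.pos⟩
  have hinv := hφ.isInvertible_mfderiv B hξ hy ht
  have hvert : ∀ w : TangentSpace (𝓡 (d + 1 + n)) (φ t y),
      mfderiv (𝓡 (d + 1 + n)) (𝓡 (d + 1)) B.proj (φ t y) w = 0 →
      mfderiv (𝓡 (d + 1 + n)) (𝓡 (d + 1)) B.proj y
        ((mfderiv (𝓡 (d + 1 + n)) (𝓡 (d + 1 + n)) (φ t) y).inverse w) = 0 := by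
    intro w hw
    set u := (mfderiv (𝓡 (d + 1 + n)) (𝓡 (d + 1 + n)) (φ t) y).inverse w with hu
    have h1 : mfderiv (𝓡 (d + 1 + n)) (𝓡 (d + 1 + n)) (φ t) y u = w :=
      congrArg (fun L : TangentSpace (𝓡 (d + 1 + n)) (φ t y) →L[ℝ]
        TangentSpace (𝓡 (d + 1 + n)) (φ t y) => L w) hinv.self_comp_inverse
    have h2 := hφ.vertical_mfderiv_imp B hξ hy hproj ht h0 u (by rw [h1]; exact hw)
    rw [hφ.mfderiv_zero hy u] at h2
    have h3 : ∀ y' : E, y' = y → mfderiv (𝓡 (d + 1 + n)) (𝓡 (d + 1)) B.proj y' u = 0 →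
        mfderiv (𝓡 (d + 1 + n)) (𝓡 (d + 1)) B.proj y u = 0 := by
      rintro _ rfl h
      exact h
    exact h3 _ (hφ.map_zero y hy) h2
  intro v i j hij hi hj
  exact ζ.2 (fun k => (mfderiv (𝓡 (d + 1 + n)) (𝓡 (d + 1 + n)) (φ t) y).inverse (v k)) i j hij
    (hvert _ hi) (hvert _ hj)

end FlowDerivative

theorem formRetract_formVal {d n : ℕ} (a : FormModel d n) : formRetract (formVal a) = a :=
  formVal_injective (formVal_formRetract fun _ _ _ hij hi hj => formVal_vertical a hij hi hj)

/-! ### The lifted flow and uniqueness of the canonical lift. -/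

section LiftedFlow
variable {d n : ℕ}
  {M : Type*} [TopologicalSpace M] [ChartedSpace (BaseCoord d) M] [IsManifold (𝓡 (d + 1)) ∞ M]
  {E : Type*} [TopologicalSpace E] [ChartedSpace (TotCoord d n) E] [IsManifold (𝓡 (d + 1 + n)) ∞ E]
  {F : Type*} [TopologicalSpace F] [ChartedSpace (FibCoord n) F] [IsManifold (𝓡 n) ∞ F]
  {B : SmoothFiberBundle d n M E F}

omit [IsManifold (𝓡 (d + 1)) ∞ M] [IsManifold (𝓡 (d + 1 + n)) ∞ E] [IsManifold (𝓡 n) ∞ F] in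
theorem isInvertible_jacobian {e₀ e : AdaptedChart B} {y : E} {Φ : E → E}
    (hΦ : (mfderiv (𝓡 (d + 1 + n)) (𝓡 (d + 1 + n)) Φ y).IsInvertible)
    (hy : y ∈ e₀.chart.source) (he : Φ y ∈ e.chart.source) :
    (jacobian e₀ e y Φ).IsInvertible :=
  (e.isInvertible_dchart he).comp (hΦ.comp (e₀.isInvertible_dchart hy).inverse)

omit [IsManifold (𝓡 (d + 1 + n)) ∞ E] [IsManifold (𝓡 n) ∞ F] in
/-- The push-forward of a form, read in adapted charts. -/
theorem toModel_pushForward {e₀ e : AdaptedChart B} {y : E} {Φ : E → E}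
    (hΦ : (mfderiv (𝓡 (d + 1 + n)) (𝓡 (d + 1 + n)) Φ y).IsInvertible)
    (hy : y ∈ e₀.chart.source) (he : Φ y ∈ e.chart.source) {ζ : FormFiber B y}
    {η : FormFiber B (Φ y)} (hη : toForm η = pushForward Φ y (toForm ζ)) :
    formVal (e.toModel (Φ y) η) =
      (formVal (e₀.toModel y ζ)).compContinuousLinearMap (jacobian e₀ e y Φ).inverse := by
  have h1 : formVal (e.toModel (Φ y) η) =
      (toForm η).compContinuousLinearMap (e.dchartInv (Φ y)) := e.coe_toModel he η
  have h2 : formVal (e₀.toModel y ζ) =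
      (toForm ζ).compContinuousLinearMap (e₀.dchartInv y) := e₀.coe_toModel hy ζ
  rw [h1, h2, hη]
  refine ContinuousAlternatingMap.ext fun v => congrArg (toForm ζ) (funext fun i => ?_)
  set u := (mfderiv (𝓡 (d + 1 + n)) (𝓡 (d + 1 + n)) Φ y).inverse (e.dchartInv (Φ y) (v i))
    with hu
  have h3 : mfderiv (𝓡 (d + 1 + n)) (𝓡 (d + 1 + n)) Φ y u = e.dchartInv (Φ y) (v i) :=
    hΦ.self_apply_inverse _
  have h4 : (jacobian e₀ e y Φ).inverse (v i) = e₀.dchart y u := by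
    rw [(isInvertible_jacobian hΦ hy he).inverse_apply_eq, AdaptedChart.jacobian_dchart hy, h3,
      e.dchart_dchartInv he]
  change u = e₀.dchartInv y ((jacobian e₀ e y Φ).inverse (v i))
  rw [h4, e₀.dchartInv_dchart hy]

variable {ξ : VecField (𝓡 (d + 1 + n)) E} (hξ : SmoothVecField (𝓡 (d + 1 + n)) ξ)
  (hproj : IsProjectable B ξ)
  {ε : ℝ} {U : Set E} {φ : ℝ → E → E} (hφ : IsLocalFlow ξ ε U φ)
  {y : E} (hy : y ∈ U)

include hξ hproj hφ hy in
/-- The lifted flow consists of integral curves of the canonical lift. -/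
theorem IsLocalFlow.hasMFDerivAt_lift {ζ : FormFiber B y} {η : (t : ℝ) → FormFiber B (φ t y)}
    (hη : ∀ t ∈ Ioo (-ε) ε, toForm (η t) = pushForward (φ t) y (toForm ζ)) {t : ℝ}
    (ht : t ∈ Ioo (-ε) ε) :
    HasMFDerivAt 𝓘(ℝ, ℝ) (extModel d n) (fun s => (⟨φ s y, η s⟩ : ExtMultimomentum B)) t
      ((1 : ℝ →L[ℝ] ℝ).smulRight (canonicalLift B ξ ⟨φ t y, η t⟩)) := by
  obtain ⟨e₀, hy₀⟩ := exists_adaptedChart B y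
  obtain ⟨e, he⟩ := exists_adaptedChart B (φ t y)
  have hsrc : ∀ᶠ s in 𝓝 t, φ s y ∈ e.chart.source :=
    (hφ.continuousAt hy ht).eventually (e.chart.open_source.mem_nhds he)
  refine e.isSmoothChart_totalChart.hasMFDerivAt_of_hasDerivAt
    (γ := fun s => (⟨φ s y, η s⟩ : ExtMultimomentum B))
    (hsrc.mono fun s hs => e.mem_totalChart_source.2 hs) ?_
  rw [chartDeriv_canonicalLift hξ hproj e he]
  have hinv := hφ.isInvertible_mfderiv B hξ hy ht
  have h1 := hφ.hasDerivAt_chart hy ht he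
  have h2 := hasDerivAt_formRetract_comp_inverse (formVal (e₀.toModel y ζ))
    (hφ.hasDerivAt_jacobian hξ hy hy₀ ht he) (isInvertible_jacobian hinv hy₀ he)
    (toModel_pushForward hinv hy₀ he (hη t ht))
  have h3 : (fun s => e.toModel (φ s y) (η s)) =ᶠ[𝓝 t] fun s =>
      formRetract ((formVal (e₀.toModel y ζ)).compContinuousLinearMap
        (jacobian e₀ e y (φ s)).inverse) := by
    filter_upwards [isOpen_Ioo.mem_nhds ht, hsrc] with s hs hse
    rw [← toModel_pushForward (hφ.isInvertible_mfderiv B hξ hy hs) hy₀ hse (hη s hs),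
      formRetract_formVal]
  exact h1.prodMk (h2.congr_of_eventuallyEq h3)

include hξ hproj in
theorem isCanonicalLift_canonicalLift : IsCanonicalLift B ξ (canonicalLift B ξ) := by
  classical
  refine ⟨smoothVecField_canonicalLift hξ hproj, fun ε U φ hφ y hy ζ => ?_⟩
  -- Outside the time interval nothing is required of `η`, and it is set to `0`.
  let η : (t : ℝ) → FormFiber B (φ t y) := fun t =>
    if ht : t ∈ Ioo (-ε) ε then ⟨_, hφ.pushForward_mem B hξ hy ht hproj ζ⟩ else 0
  have hη : ∀ t ∈ Ioo (-ε) ε, toForm (η t) = pushForward (φ t) y (toForm ζ) := by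
    intro t ht
    have h : η t = (⟨_, hφ.pushForward_mem B hξ hy ht hproj ζ⟩ : Lambda2 B (φ t y)) := dif_pos ht
    exact congrArg toForm h
  exact ⟨η, hη, fun t ht => (hφ.hasMFDerivAt_lift hξ hproj hy hη ht).hasMFDerivWithinAt⟩

-- Each `(y, ζ)` is the time-zero position of a lifted flow line, which is an integral curve of both
-- fields; the velocity of a curve is unique.
include hξ hproj in
theorem IsCanonicalLift.eq_canonicalLift {W : VecField (extModel d n) (ExtMultimomentum B)}
    (hW : IsCanonicalLift B ξ W) : W = canonicalLift B ξ := by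
  funext q
  obtain ⟨y, ζ⟩ := q
  obtain ⟨ε, U, φ, hφ, hy⟩ := exists_isLocalFlow B hξ y
  have h0 : (0 : ℝ) ∈ Ioo (-ε) ε := ⟨by linarith [hφ.pos], hφ.pos⟩
  obtain ⟨η, hη, hcurve⟩ := hW.2 ε U φ hφ y hy ζ
  have h1 := (hcurve 0 h0).hasMFDerivAt (isOpen_Ioo.mem_nhds h0)
  have h2 := hasMFDerivAt_unique h1 (hφ.hasMFDerivAt_lift hξ hproj hy hη h0)
  have h3 : W ⟨φ 0 y, η 0⟩ = canonicalLift B ξ ⟨φ 0 y, η 0⟩ := by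
    have h4 := congrArg (fun L : ℝ →L[ℝ] TangentSpace (extModel d n)
      (⟨φ 0 y, η 0⟩ : ExtMultimomentum B) => L 1) h2
    have h5 : (1 : ℝ) • W ⟨φ 0 y, η 0⟩ = (1 : ℝ) • canonicalLift B ξ ⟨φ 0 y, η 0⟩ := h4
    rwa [one_smul, one_smul] at h5
  -- `φ 0 y = y` is only propositional, so equality in the total space is proved for a variable base
  -- point.
  have h6 : ∀ (y' : E) (_ : y' = y) (η' : FormFiber B y'),
      (∀ v : Fin (d + 1) → TangentSpace (𝓡 (d + 1 + n)) y, toForm η' v = toForm ζ v) →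
      (⟨y', η'⟩ : ExtMultimomentum B) = ⟨y, ζ⟩ := by
    rintro _ rfl η' h
    have : η' = ζ := Subtype.ext (ContinuousAlternatingMap.ext h)
    rw [this]
  have h7 : (⟨φ 0 y, η 0⟩ : ExtMultimomentum B) = ⟨y, ζ⟩ := by
    refine h6 _ (hφ.map_zero y hy) _ fun v => ?_
    have hinv := hφ.isInvertible_mfderiv B hξ hy h0
    have h8 : toForm (η 0) v = toForm ζ fun i =>
        (mfderiv (𝓡 (d + 1 + n)) (𝓡 (d + 1 + n)) (φ 0) y).inverse (v i) :=
      congrArg (fun α : TangentSpace (𝓡 (d + 1 + n)) (φ 0 y) [⋀^Fin (d + 1)]→L[ℝ] ℝ => α v)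
        (hη 0 h0)
    rw [h8]
    refine congrArg (toForm ζ) (funext fun i => ?_)
    exact hinv.inverse_apply_eq.2 (hφ.mfderiv_zero hy (v i)).symm
  rwa [h7] at h3

include hξ hproj in
theorem isCanonicalLift_iff (W : VecField (extModel d n) (ExtMultimomentum B)) :
    IsCanonicalLift B ξ W ↔ W = canonicalLift B ξ :=
  ⟨fun h => h.eq_canonicalLift hξ hproj, by
    rintro rfl
    exact isCanonicalLift_canonicalLift hξ hproj⟩

end LiftedFlow

/-! ### The coordinate formula. -/

section ModelCoordinates
variable {d n : ℕ}

/-- The coordinate vector `∂/∂x^μ` of the model space. -/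
def modelVecX (n : ℕ) (μ : Fin (d + 1)) : BaseCoord d × FibCoord n := (EuclideanSpace.single μ 1, 0)

/-- The coordinate vector `∂/∂y^A` of the model space. -/
def modelVecY (d : ℕ) (A : Fin n) : BaseCoord d × FibCoord n := (0, EuclideanSpace.single A 1)

/-- Evaluation of the model forms. -/
def evalForm (v : Fin (d + 1) → BaseCoord d × FibCoord n) : FormModel d n →L[ℝ] ℝ :=
  LinearMap.toContinuousLinearMap
    { toFun := fun a => formVal a v
      map_add' := fun a b => by rw [map_add]; rfl
      map_smul' := fun c a => by rw [map_smul]; rfl }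

theorem sum_smul_modelVecX (x : BaseCoord d) :
    ∑ μ, x μ • modelVecX n μ = (x, 0) := by
  refine Prod.ext ?_ ?_
  · rw [Prod.fst_sum]
    ext ν
    simp [modelVecX, Finset.sum_apply, Pi.single_apply]
  · rw [Prod.snd_sum]
    simp [modelVecX]

theorem sum_smul_modelVecY (x : FibCoord n) :
    ∑ A, x A • modelVecY d A = (0, x) := by
  refine Prod.ext ?_ ?_
  · rw [Prod.fst_sum]
    simp [modelVecY]
  · rw [Prod.snd_sum]
    ext ν
    simp [modelVecY, Finset.sum_apply, Pi.single_apply]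

theorem formVal_update_add (a : FormModel d n) (v : Fin (d + 1) → BaseCoord d × FibCoord n)
    (i : Fin (d + 1)) (w w' : BaseCoord d × FibCoord n) :
    formVal a (Function.update v i (w + w')) =
      formVal a (Function.update v i w) + formVal a (Function.update v i w') :=
  (formVal a).toMultilinearMap.map_update_add v i w w'

theorem formVal_update_sum_smul (a : FormModel d n) (v : Fin (d + 1) → BaseCoord d × FibCoord n)
    (i : Fin (d + 1)) {κ : Type*} (s : Finset κ) (c : κ → ℝ) (w : κ → BaseCoord d × FibCoord n) :
    formVal a (Function.update v i (∑ k ∈ s, c k • w k)) =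
      ∑ k ∈ s, c k * formVal a (Function.update v i (w k)) := by
  have h := map_sum ((formVal a).toMultilinearMap.toLinearMap v i) (fun k => c k • w k) s
  simp only [map_smul] at h
  exact h

theorem formVal_update_vertical (a : FormModel d n) (v : Fin (d + 1) → BaseCoord d × FibCoord n)
    (i : Fin (d + 1)) (x : FibCoord n) :
    formVal a (Function.update v i (0, x)) =
      ∑ A, x A * formVal a (Function.update v i (modelVecY d A)) := by
  rw [← sum_smul_modelVecY, formVal_update_sum_smul]

theorem formVal_update_horizontal (a : FormModel d n) (v : Fin (d + 1) → BaseCoord d × FibCoord n)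
    (i : Fin (d + 1)) (x : BaseCoord d) :
    formVal a (Function.update v i (x, 0)) =
      ∑ μ, x μ * formVal a (Function.update v i (modelVecX n μ)) := by
  rw [← sum_smul_modelVecX, formVal_update_sum_smul]

/-- Of the horizontal part of `w`, every frame vector other than the `i`-th repeats an argument and
contributes nothing. -/
theorem formVal_update_modelVecX (a : FormModel d n) (i : Fin (d + 1))
    (w : BaseCoord d × FibCoord n) :
    formVal a (Function.update (modelVecX n) i w) = w.1 i * formVal a (modelVecX n) +
      ∑ A, w.2 A * formVal a (Function.update (modelVecX n) i (modelVecY d A)) := by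
  have hw : w = (w.1, 0) + (0, w.2) := by simp
  conv_lhs => rw [hw]
  rw [formVal_update_add, formVal_update_vertical, formVal_update_horizontal]
  congr 1
  rw [Finset.sum_eq_single i, Function.update_eq_self]
  · intro ν _ hν
    rw [(formVal a).map_eq_zero_of_eq _ (i := i) (j := ν) (by simp [hν]) hν.symm, mul_zero]
  · simp

/-- Slot `μ` is already vertical, so the vertical part of `w` drops out. Horizontally only two
directions avoid a repetition: `∂/∂x^i` restores the frame, and `∂/∂x^μ` gives, after a swap, the
minus sign. -/
theorem formVal_update_update_modelVecX (a : FormModel d n) {i μ : Fin (d + 1)} (hi : i ≠ μ)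
    (A : Fin n) (w : BaseCoord d × FibCoord n) :
    formVal a (Function.update (Function.update (modelVecX n) μ (modelVecY d A)) i w) =
      w.1 i * formVal a (Function.update (modelVecX n) μ (modelVecY d A)) -
        w.1 μ * formVal a (Function.update (modelVecX n) i (modelVecY d A)) := by
  have hw : w = (w.1, 0) + (0, w.2) := by simp
  conv_lhs => rw [hw]
  rw [formVal_update_add, formVal_vertical a hi (v := Function.update _ i (0, w.2)) (by simp)
    (by simp [hi.symm, modelVecY]), add_zero, formVal_update_horizontal,
    Finset.sum_eq_add i μ hi]
  · have h1 : Function.update (Function.update (modelVecX n) μ (modelVecY d A)) i (modelVecX n i) =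
        Function.update (modelVecX n) μ (modelVecY d A) := by
      rw [Function.update_eq_self_iff, Function.update_of_ne hi]
    have h2 : Function.update (Function.update (modelVecX n) μ (modelVecY d A)) i (modelVecX n μ) =
        Function.update (modelVecX n) i (modelVecY d A) ∘ Equiv.swap i μ := by
      funext j
      rcases eq_or_ne j i with rfl | h
      · simp [hi.symm]
      · rcases eq_or_ne j μ with rfl | h'
        · simp [h]
        · simp [h, h', Equiv.swap_apply_of_ne_of_ne h h']
    have h3 : formVal a (Function.update (modelVecX n) i (modelVecY d A) ∘ Equiv.swap i μ) =
        -formVal a (Function.update (modelVecX n) i (modelVecY d A)) :=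
      (formVal a).toAlternatingMap.map_swap _ hi
    rw [h1, h2, h3]
    ring
  · intro ν _ hν
    rw [(formVal a).map_eq_zero_of_eq _ (i := i) (j := ν)
      (by simp [hν.1, hν.2]) hν.1.symm, mul_zero]
  · simp
  · simp

variable {L : (BaseCoord d × FibCoord n) →L[ℝ] (BaseCoord d × FibCoord n)}
  (hL : ∀ v, v.1 = 0 → (L v).1 = 0) (a : FormModel d n)
include hL

theorem formVal_lieAction_modelVecX :
    formVal (lieAction L a) (modelVecX n) =
      -(∑ A, ∑ μ, (L (modelVecX n μ)).2 A *
          formVal a (Function.update (modelVecX n) μ (modelVecY d A))) -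
        (∑ μ, (L (modelVecX n μ)).1 μ) * formVal a (modelVecX n) := by
  rw [formVal_lieAction hL,
    Finset.sum_congr rfl fun i _ => formVal_update_modelVecX a i (L (modelVecX n i))]
  rw [Finset.sum_add_distrib, ← Finset.sum_mul, Finset.sum_comm]
  ring

theorem formVal_lieAction_update_modelVecX (A : Fin n) (μ : Fin (d + 1)) :
    formVal (lieAction L a) (Function.update (modelVecX n) μ (modelVecY d A)) =
      (∑ ν, (L (modelVecX n ν)).1 μ *
          formVal a (Function.update (modelVecX n) ν (modelVecY d A))) -
        (∑ ν, (L (modelVecX n ν)).1 ν) *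
          formVal a (Function.update (modelVecX n) μ (modelVecY d A)) -
        ∑ C, (L (modelVecY d A)).2 C *
          formVal a (Function.update (modelVecX n) μ (modelVecY d C)) := by
  rw [formVal_lieAction hL]
  -- At `i = μ` the difference in parentheses cancels, so it may be included for every `i`; its sum
  -- then contains the full divergence. The true `i = μ` term is the vertical one.
  have h : ∀ i, formVal a (Function.update (Function.update (modelVecX n) μ (modelVecY d A)) i
      (L (Function.update (modelVecX n) μ (modelVecY d A) i))) =
      ((L (modelVecX n i)).1 i * formVal a (Function.update (modelVecX n) μ (modelVecY d A)) -
        (L (modelVecX n i)).1 μ * formVal a (Function.update (modelVecX n) i (modelVecY d A))) +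
      if i = μ then ∑ C, (L (modelVecY d A)).2 C *
        formVal a (Function.update (modelVecX n) μ (modelVecY d C)) else 0 := by
    intro i
    rcases eq_or_ne i μ with rfl | hi
    · have h1 : L (modelVecY d A) = (0, (L (modelVecY d A)).2) :=
        Prod.ext (hL _ rfl) rfl
      rw [Function.update_self, Function.update_idem, if_pos rfl, sub_self, zero_add]
      conv_lhs => rw [h1]
      exact formVal_update_vertical a _ i _
    · rw [Function.update_of_ne hi, formVal_update_update_modelVecX a hi, if_neg hi, add_zero]
  simp only [h]
  rw [Finset.sum_add_distrib, Finset.sum_sub_distrib, ← Finset.sum_mul, Finset.sum_ite_eq']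
  simp only [Finset.mem_univ, if_true]
  ring

end ModelCoordinates

section Coordinates
variable {d n : ℕ}
  {M : Type*} [TopologicalSpace M] [ChartedSpace (BaseCoord d) M] [IsManifold (𝓡 (d + 1)) ∞ M]
  {E : Type*} [TopologicalSpace E] [ChartedSpace (TotCoord d n) E] [IsManifold (𝓡 (d + 1 + n)) ∞ E]
  {F : Type*} [TopologicalSpace F] [ChartedSpace (FibCoord n) F] [IsManifold (𝓡 n) ∞ F]
  {B : SmoothFiberBundle d n M E F}

namespace AdaptedChart
variable (e : AdaptedChart B) {q : ExtMultimomentum B} (hq : q.proj ∈ e.chart.source)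
include hq

/-- Every induced coordinate is a linear functional of `totalChart`, so its derivative along the
lift is that functional applied to `liftField`. -/
theorem mfderiv_of_eqOn_linear {g : ExtMultimomentum B → ℝ}
    (ℓ : (BaseCoord d × FibCoord n) × FormModel d n →L[ℝ] ℝ)
    (hg : ∀ r : ExtMultimomentum B, r.proj ∈ e.chart.source → g r = ℓ (e.totalChart r))
    (w : TangentSpace (extModel d n) q) :
    mfderiv (extModel d n) 𝓘(ℝ, ℝ) g q w = ℓ (chartDeriv (extModel d n) e.totalChart q w) := by
  have hqt := e.mem_totalChart_source.2 hq
  have h1 : g =ᶠ[𝓝 q] ℓ ∘ e.totalChart := by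
    filter_upwards [e.totalChart.open_source.mem_nhds hqt] with r hr
    exact hg r (e.mem_totalChart_source.1 hr)
  have h2 : MDifferentiableAt 𝓘(ℝ, (BaseCoord d × FibCoord n) × FormModel d n) 𝓘(ℝ, ℝ) ℓ
      (e.totalChart q) := ℓ.differentiableAt.mdifferentiableAt
  have h3 := mfderiv_comp (I := extModel d n) q h2
    ((e.isSmoothChart_totalChart.contMDiffAt hqt).mdifferentiableAt (by simp))
  have h4 := h1.mfderiv_eq (I := extModel d n) (I' := 𝓘(ℝ, ℝ))
  rw [h3, mfderiv_eq_fderiv, ContinuousLinearMap.fderiv] at h4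
  exact congrArg (fun L : TangentSpace (extModel d n) q →L[ℝ] ℝ => L w) h4

theorem coordP_eq (A : Fin n) (μ : Fin (d + 1)) :
    e.coordP A μ q =
      formVal (e.totalChart q).2 (Function.update (modelVecX n) μ (modelVecY d A)) := by
  have h1 : formVal (e.toModel q.proj q.snd) =
      (toForm q.snd).compContinuousLinearMap (e.dchartInv q.proj) := e.coe_toModel hq q.snd
  change _ = formVal (e.toModel q.proj q.snd) _
  rw [h1]
  refine congrArg (toForm q.snd) (funext fun i => ?_)
  exact (Function.apply_update (fun _ => e.dchartInv q.proj) (modelVecX n) μ (modelVecY d A) i).symm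

theorem coordP₀_eq : e.coordP₀ q = formVal (e.totalChart q).2 (modelVecX n) := by
  have h1 : formVal (e.toModel q.proj q.snd) =
      (toForm q.snd).compContinuousLinearMap (e.dchartInv q.proj) := e.coe_toModel hq q.snd
  change _ = formVal (e.toModel q.proj q.snd) _
  rw [h1]
  rfl

end AdaptedChart

namespace AdaptedChart
variable (e : AdaptedChart B) {ξ : VecField (𝓡 (d + 1 + n)) E}
  (hξ : SmoothVecField (𝓡 (d + 1 + n)) ξ)
include hξ

-- The convention `ξ = -ξ^μ ∂/∂x^μ - ξ^A ∂/∂y^A` makes the partial derivatives the negatives of the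
-- entries of `Df`, which accounts for the signs of the final formula.
omit [IsManifold (𝓡 (d + 1)) ∞ M] [IsManifold (𝓡 n) ∞ F] in
theorem partialX_compX {z : BaseCoord d × FibCoord n} (hz : z ∈ e.chart.target)
    (μ ν : Fin (d + 1)) : partialX (e.compX ξ μ) ν z =
      -(fderiv ℝ (chartField (𝓡 (d + 1 + n)) e.chart ξ) z (modelVecX n ν)).1 μ := by
  let ℓ : BaseCoord d × FibCoord n →L[ℝ] ℝ :=
    -((EuclideanSpace.proj μ).comp (ContinuousLinearMap.fst ℝ (BaseCoord d) (FibCoord n)))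
  have h := ℓ.hasFDerivAt.comp z (e.differentiableAt_chartField hξ hz).hasFDerivAt
  have h1 : fderiv ℝ (e.compX ξ μ) z =
      ℓ.comp (fderiv ℝ (chartField (𝓡 (d + 1 + n)) e.chart ξ) z) := HasFDerivAt.fderiv h
  rw [partialX, h1]
  rfl

omit [IsManifold (𝓡 (d + 1)) ∞ M] [IsManifold (𝓡 n) ∞ F] in
theorem hasFDerivAt_compY {z : BaseCoord d × FibCoord n} (hz : z ∈ e.chart.target) (A : Fin n) :
    HasFDerivAt (e.compY ξ A)
      ((-((EuclideanSpace.proj A).comp (ContinuousLinearMap.snd ℝ (BaseCoord d) (FibCoord n))) :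
        BaseCoord d × FibCoord n →L[ℝ] ℝ).comp
          (fderiv ℝ (chartField (𝓡 (d + 1 + n)) e.chart ξ) z)) z := by
  let ℓ : BaseCoord d × FibCoord n →L[ℝ] ℝ :=
    -((EuclideanSpace.proj A).comp (ContinuousLinearMap.snd ℝ (BaseCoord d) (FibCoord n)))
  have h := ℓ.hasFDerivAt.comp z (e.differentiableAt_chartField hξ hz).hasFDerivAt
  exact h

omit [IsManifold (𝓡 (d + 1)) ∞ M] [IsManifold (𝓡 n) ∞ F] in
theorem partialX_compY {z : BaseCoord d × FibCoord n} (hz : z ∈ e.chart.target) (A : Fin n)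
    (ν : Fin (d + 1)) : partialX (e.compY ξ A) ν z =
      -(fderiv ℝ (chartField (𝓡 (d + 1 + n)) e.chart ξ) z (modelVecX n ν)).2 A := by
  rw [partialX, (e.hasFDerivAt_compY hξ hz A).fderiv]
  rfl

omit [IsManifold (𝓡 (d + 1)) ∞ M] [IsManifold (𝓡 n) ∞ F] in
theorem partialY_compY {z : BaseCoord d × FibCoord n} (hz : z ∈ e.chart.target) (A C : Fin n) :
    partialY (e.compY ξ A) C z =
      -(fderiv ℝ (chartField (𝓡 (d + 1 + n)) e.chart ξ) z (modelVecY d C)).2 A := by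
  rw [partialY, (e.hasFDerivAt_compY hξ hz A).fderiv]
  rfl

variable (hproj : IsProjectable B ξ) {q : ExtMultimomentum B} (hq : q.proj ∈ e.chart.source)
include hproj hq

theorem mfderiv_coordX_canonicalLift (μ : Fin (d + 1)) :
    mfderiv (extModel d n) 𝓘(ℝ, ℝ) (e.coordX μ) q (canonicalLift B ξ q) =
      -e.compX ξ μ (e.chart q.proj) := by
  refine (e.mfderiv_of_eqOn_linear hq ((EuclideanSpace.proj μ).comp
      ((ContinuousLinearMap.fst ℝ (BaseCoord d) (FibCoord n)).comp
        (ContinuousLinearMap.fst ℝ (BaseCoord d × FibCoord n) (FormModel d n))))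
      (fun r _ => rfl) _).trans ?_
  rw [chartDeriv_canonicalLift hξ hproj e hq]
  exact (neg_neg _).symm

theorem mfderiv_coordY_canonicalLift (A : Fin n) :
    mfderiv (extModel d n) 𝓘(ℝ, ℝ) (e.coordY A) q (canonicalLift B ξ q) =
      -e.compY ξ A (e.chart q.proj) := by
  refine (e.mfderiv_of_eqOn_linear hq ((EuclideanSpace.proj A).comp
      ((ContinuousLinearMap.snd ℝ (BaseCoord d) (FibCoord n)).comp
        (ContinuousLinearMap.fst ℝ (BaseCoord d × FibCoord n) (FormModel d n))))
      (fun r _ => rfl) _).trans ?_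
  rw [chartDeriv_canonicalLift hξ hproj e hq]
  exact (neg_neg _).symm

theorem mfderiv_coordP_canonicalLift (A : Fin n) (μ : Fin (d + 1)) :
    mfderiv (extModel d n) 𝓘(ℝ, ℝ) (e.coordP A μ) q (canonicalLift B ξ q) =
      -((∑ ν, partialX (e.compX ξ μ) ν (e.chart q.proj) * e.coordP A ν q)
        - (∑ ν, partialX (e.compX ξ ν) ν (e.chart q.proj)) * e.coordP A μ q
        - (∑ C, partialY (e.compY ξ C) A (e.chart q.proj) * e.coordP C μ q)) := by
  have hz := e.chart.map_source hq
  rw [e.mfderiv_of_eqOn_linear hq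
      ((evalForm (Function.update (modelVecX n) μ (modelVecY d A))).comp
        (ContinuousLinearMap.snd ℝ (BaseCoord d × FibCoord n) (FormModel d n)))
      (fun r hr => e.coordP_eq hr A μ), chartDeriv_canonicalLift hξ hproj e hq]
  refine (formVal_lieAction_update_modelVecX
    (e.fst_fderiv_chartField_eq_zero hξ hproj hz) (e.totalChart q).2 A μ).trans ?_
  simp only [e.partialX_compX hξ hz, e.partialY_compY hξ hz, e.coordP_eq hq, neg_mul,
    Finset.sum_neg_distrib]
  ring

theorem mfderiv_coordP₀_canonicalLift :
    mfderiv (extModel d n) 𝓘(ℝ, ℝ) e.coordP₀ q (canonicalLift B ξ q) =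
      (∑ A, ∑ μ, partialX (e.compY ξ A) μ (e.chart q.proj) * e.coordP A μ q)
        + (∑ μ, partialX (e.compX ξ μ) μ (e.chart q.proj)) * e.coordP₀ q := by
  have hz := e.chart.map_source hq
  rw [e.mfderiv_of_eqOn_linear hq
      ((evalForm (modelVecX n)).comp
        (ContinuousLinearMap.snd ℝ (BaseCoord d × FibCoord n) (FormModel d n)))
      (fun r hr => e.coordP₀_eq hr), chartDeriv_canonicalLift hξ hproj e hq]
  refine (formVal_lieAction_modelVecX
    (e.fst_fderiv_chartField_eq_zero hξ hproj hz) (e.totalChart q).2).trans ?_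
  simp only [e.partialX_compX hξ hz, e.partialX_compY hξ hz, e.coordP_eq hq, e.coordP₀_eq hq,
    neg_mul, Finset.sum_neg_distrib]
  ring

end AdaptedChart
end Coordinates

end Multimomentum

end

theorem mainTheorem2 {d n : ℕ}
    {M : Type*} [TopologicalSpace M] [T2Space M] [SecondCountableTopology M]
    [ChartedSpace (Multimomentum.BaseCoord d) M] [IsManifold (𝓡 (d + 1)) ∞ M]
    {E : Type*} [TopologicalSpace E] [T2Space E] [SecondCountableTopology E]
    [ChartedSpace (Multimomentum.TotCoord d n) E] [IsManifold (𝓡 (d + 1 + n)) ∞ E]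
    {F : Type*} [TopologicalSpace F]
    [ChartedSpace (Multimomentum.FibCoord n) F] [IsManifold (𝓡 n) ∞ F]
    (B : Multimomentum.SmoothFiberBundle d n M E F)
    (ξ : Multimomentum.VecField (𝓡 (d + 1 + n)) E)
    (hξ : Multimomentum.SmoothVecField (𝓡 (d + 1 + n)) ξ)
    (hproj : Multimomentum.IsProjectable B ξ) :
    ∃ Z : Multimomentum.VecField (Multimomentum.extModel d n) (Multimomentum.ExtMultimomentum B),
      (∀ W : Multimomentum.VecField (Multimomentum.extModel d n) (Multimomentum.ExtMultimomentum B),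
        Multimomentum.IsCanonicalLift B ξ W ↔ W = Z) ∧
      (∀ W : Multimomentum.VecField (Multimomentum.extModel d n) (Multimomentum.ExtMultimomentum B),
        Multimomentum.interior W (Multimomentum.multisymplecticForm B) =
          Multimomentum.mextDeriv (Multimomentum.extModel d n) (Multimomentum.gammaForm B ξ) ↔
        W = Z) ∧
      ∀ (e : Multimomentum.AdaptedChart B) (q : Multimomentum.ExtMultimomentum B),
        q.proj ∈ e.chart.source →
        (∀ μ, mfderiv (Multimomentum.extModel d n) 𝓘(ℝ, ℝ) (e.coordX μ) q (Z q) =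
          -e.compX ξ μ (e.chart q.proj)) ∧
        (∀ A, mfderiv (Multimomentum.extModel d n) 𝓘(ℝ, ℝ) (e.coordY A) q (Z q) =
          -e.compY ξ A (e.chart q.proj)) ∧
        (∀ A μ, mfderiv (Multimomentum.extModel d n) 𝓘(ℝ, ℝ) (e.coordP A μ) q (Z q) =
          -((∑ ν, Multimomentum.partialX (e.compX ξ μ) ν (e.chart q.proj) * e.coordP A ν q)
            - (∑ ν, Multimomentum.partialX (e.compX ξ ν) ν (e.chart q.proj)) * e.coordP A μ q
            - (∑ C, Multimomentum.partialY (e.compY ξ C) A (e.chart q.proj) * e.coordP C μ q))) ∧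
        mfderiv (Multimomentum.extModel d n) 𝓘(ℝ, ℝ) e.coordP₀ q (Z q) =
          (∑ A, ∑ μ, Multimomentum.partialX (e.compY ξ A) μ (e.chart q.proj) * e.coordP A μ q)
            + (∑ μ, Multimomentum.partialX (e.compX ξ μ) μ (e.chart q.proj)) * e.coordP₀ q := by
  refine ⟨Multimomentum.canonicalLift B ξ, Multimomentum.isCanonicalLift_iff hξ hproj,
    Multimomentum.interior_eq_iff hξ hproj, fun e q hq => ⟨?_, ?_, ?_, ?_⟩⟩
  · exact e.mfderiv_coordX_canonicalLift hξ hproj hq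
  · exact e.mfderiv_coordY_canonicalLift hξ hproj hq
  · exact e.mfderiv_coordP_canonicalLift hξ hproj hq
  · exact e.mfderiv_coordP₀_canonicalLift hξ hproj hq
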